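/- Let $n\ge 2$, let $\Gamma$ be a discrete torsion-free group of isometries of real hyperbolic space $\mathbb H^n$, and assume that the complete hyperbolic manifold $M=\Gamma\backslash\mathbb H^n$ has finite volume. Let $\beta_\xi(x,y)=\lim_{t\to\infty}\big(d(\rho_t,x)-d(\rho_t,y)\big)$, for $\rho$ any geodesic ray ending at $\xi\in\partial_\infty\mathbb H^n$, be the Busemann cocycle. The spherical Patterson density is the family $(\mu_x)_{x\in\mathbb H^n}$ of measures on $\partial_\infty\mathbb H^n$ such that, in the ball model with centre $0$, $\mu_0$ is the Lebesgue measure of the unit sphere $\mathbb S^{n-1}=\partial_\infty\mathbb H^n$, and $\frac{d\mu_x}{d\mu_0}(\xi)=e^{-(n-1)\beta_\xi(x,0)}$. Let $\widetilde C$ be a nonempty proper closed convex subset of $\mathbb H^n$ with locally finite $\Gamma$-orbit, with stabiliser $\Gamma_{\widetilde C}$ in $\Gamma$ and set of points at infinity $\partial_\infty\widetilde C$; write $C=\Gamma_{\widetilde C}\backslash\widetilde C$ (immersed in $M$). For $\xi\in\partial_\infty\mathbb H^n\setminus\partial_\infty\widetilde C$, let $P_{\widetilde C}(\xi)$ be the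 point of $\widetilde C$ minimising $x\mapsto\beta_\xi(x,x_0)$, and let $P^+_{\widetilde C}(\xi)$ be the unit tangent vector at $P_{\widetilde C}(\xi)$ pointing towards $\xi$. For a unit tangent vector $w$, let $\pi(w)$ be its base point and $w_+$ the positive endpoint of its geodesic line. The outer unit normal bundle $\partial^1_+\widetilde C$ is the set of unit tangent vectors $w$ with $\pi(w)\in\partial\widetilde C$, $w_+\notin\partial_\infty\widetilde C$ and $P_{\widetilde C}(w_+)=\pi(w)$, and $\partial^1_+C=\Gamma_{\widetilde C}\backslash\partial^1_+\widetilde C$. For any base point $x_0\in\mathbb H^n$, the skinning measure of $\widetilde C$ is $$d\widetilde\sigma_{\widetilde C}(w)=e^{-(n-1)\beta_{w_+}(\pi(w),x_0)}\,d\big((P^+_{\widetilde C})_*(\mu_{x_0}|_{\partial_\infty\mathbb H^n\setminus\partial_\infty\widetilde C})\big)(w),$$ and the skinning measure $\sigma_C$ of $C$ is the measure on $T^1M=\Gamma\backslash T^1\mathbb H^n$ induced by the $\Gamma$-invariant measure $\sum_{\gamma\in\Gamma/\Gamma_{\widetilde C}}\gamma_*\widetilde\sigma_{\widetilde C}$.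 When $\partial\widetilde C$ is a submanifold, $\operatorname{Vol}_{\partial^1_+C}$ is the measure on $\partial^1_+C$ (and, by pushing forward, on $T^1M$) induced by the measure on $\partial^1_+\widetilde C$ given by $$\int_{x\in\partial\widetilde C} d\operatorname{Vol}_{\partial^1_+\widetilde C\cap T^1_x\mathbb H^n}\;d\operatorname{Vol}_{\partial\widetilde C}(x),$$ where $\operatorname{Vol}_{\partial\widetilde C}$ is the Riemannian measure and the fibre measures are the spherical measures on the sets of outer unit normal vectors at $x$ (unit Dirac masses for a horoball). Denote by $\|\cdot\|$ the total mass, and put $\operatorname{Vol}(\partial^1_+C)=\|\operatorname{Vol}_{\partial^1_+C}\|$. (1) If $C$ is a Margulis cusp neighbourhood of $M$, that is, if $\widetilde C$ is a closed horoball centred at a fixed point of a parabolic element of $\Gamma$ and the horoballs in its $\Gamma$-orbit have pairwise disjoint interiors, then $$\sigma_C=2^{n-1}\operatorname{Vol}_{\partial^1_+C},$$ and $$\|\sigma_C\|=2^{n-1}\operatorname{Vol}(\partial^1_+C)=2^{n-1}\operatorname{Vol}(\partial C)=2^{n-1}(n-1)\operatorname{Vol}(C),\qquad\text{where }\partial C=\Gamma_{\widetilde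 C}\backslash\partial\widetilde C.$$ (2) If $C$ is a properly immersed totally geodesic submanifold of $M$ of dimension $k\in\{1,\dots,n-1\}$ and of finite volume, that is, if $\widetilde C$ is a $k$-dimensional totally geodesic subspace of $\mathbb H^n$ with locally finite $\Gamma$-orbit such that $\operatorname{Vol}(C)=\operatorname{Vol}(\Gamma_{\widetilde C}\backslash\widetilde C)<\infty$, then $$\sigma_C=\operatorname{Vol}_{\partial^1_+C}\qquad\text{and}\qquad\|\sigma_C\|=\operatorname{Vol}(\mathbb S^{n-k-1})\operatorname{Vol}(C).$$ -/

import Mathlib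

open MeasureTheory Set Filter Topology
open scoped ENNReal NNReal Pointwise RealInnerProductSpace

noncomputable section

namespace HypSkin

/-! ### Minkowski space and the hyperboloid model of real hyperbolic space -/

/-- The vector space `ℝ × ℝⁿ` underlying Minkowski space. -/
abbrev Mink (n : ℕ) : Type := ℝ × EuclideanSpace ℝ (Fin n)

/-- The Minkowski form `-x₀ y₀ + x₁ y₁ + ⋯ + xₙ yₙ`. -/
def mink {n : ℕ} (x y : Mink n) : ℝ := ⟪x.2, y.2⟫ - x.1 * y.1

/-- Real hyperbolic `n`-space: the upper sheet of the hyperboloid `mink x x = -1`. -/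
@[ext]
structure Hyp (n : ℕ) : Type where
  /-- The underlying vector of Minkowski space. -/
  pt : Mink n
  mink_pt : mink pt pt = -1
  pos : 0 < pt.1

section Algebra

variable {n : ℕ}

lemma mink_comm (x y : Mink n) : mink x y = mink y x := by
  simp only [mink, real_inner_comm, mul_comm]

lemma mink_add_left (x y z : Mink n) : mink (x + y) z = mink x z + mink y z := by
  simp only [mink, Prod.fst_add, Prod.snd_add, inner_add_left]; ring

lemma mink_smul_left (c : ℝ) (x z : Mink n) : mink (c • x) z = c * mink x z := by
  simp only [mink, Prod.smul_fst, Prod.smul_snd, real_inner_smul_left, smul_eq_mul]; ring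

lemma mink_add_right (x y z : Mink n) : mink x (y + z) = mink x y + mink x z := by
  rw [mink_comm, mink_add_left, mink_comm y, mink_comm z]

lemma mink_smul_right (c : ℝ) (x z : Mink n) : mink x (c • z) = c * mink x z := by
  rw [mink_comm, mink_smul_left, mink_comm z]

lemma mink_self (x : Mink n) : mink x x = ‖x.2‖ ^ 2 - x.1 ^ 2 := by
  simp only [mink, real_inner_self_eq_norm_sq]; ring

lemma Hyp.norm_sq (x : Hyp n) : ‖x.pt.2‖ ^ 2 = x.pt.1 ^ 2 - 1 := by
  have := x.mink_pt
  rw [mink_self] at this; linarith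

/-- The Minkowski form is positive definite on the orthogonal of a point of the hyperboloid. -/
lemma norm_sq_le_of_mink_eq_zero (x : Hyp n) {u : Mink n} (h : mink x.pt u = 0) :
    ‖u.2‖ ^ 2 ≤ x.pt.1 ^ 2 * mink u u := by
  have h1 : ⟪x.pt.2, u.2⟫ = x.pt.1 * u.1 := by unfold mink at h; linarith
  have h2 : ⟪x.pt.2, u.2⟫ ^ 2 ≤ ‖x.pt.2‖ ^ 2 * ‖u.2‖ ^ 2 := by
    rw [← mul_pow, ← sq_abs]
    exact pow_le_pow_left₀ (abs_nonneg _) (abs_real_inner_le_norm _ _) 2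
  rw [h1, x.norm_sq] at h2
  rw [mink_self]; nlinarith

lemma mink_self_nonneg (x : Hyp n) {u : Mink n} (h : mink x.pt u = 0) : 0 ≤ mink u u := by
  have h1 := norm_sq_le_of_mink_eq_zero x h
  have h2 : 0 < x.pt.1 ^ 2 := pow_pos x.pos 2
  by_contra hc
  push Not at hc
  nlinarith [sq_nonneg ‖u.2‖]

lemma eq_zero_of_mink_self (x : Hyp n) {u : Mink n} (h : mink x.pt u = 0)
    (h0 : mink u u = 0) : u = 0 := by
  have h1 := norm_sq_le_of_mink_eq_zero x h
  rw [h0, mul_zero] at h1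
  have h2 : ‖u.2‖ = 0 := by nlinarith [sq_nonneg ‖u.2‖]
  rw [mink_self, h2] at h0
  have h3 : u.1 = 0 := by nlinarith
  exact Prod.ext h3 (norm_eq_zero.1 h2)

lemma abs_fst_lt (x : Hyp n) {u : Mink n} (h : mink x.pt u = 0) (h1 : mink u u = 1) :
    |u.1| < x.pt.1 := by
  have h2 := norm_sq_le_of_mink_eq_zero x h
  rw [h1, mul_one] at h2
  rw [mink_self] at h1
  exact abs_lt_of_sq_lt_sq (by linarith) x.pos.le

end Algebra

/-! ### Tangent spaces with the Riemannian metric -/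

/-- The tangent space of the hyperboloid at `x`, as the Minkowski orthogonal of `x`. -/
def tangentSubmodule {n : ℕ} (x : Hyp n) : Submodule ℝ (Mink n) where
  carrier := {u | mink x.pt u = 0}
  add_mem' := by
    intro a b ha hb
    simp only [mem_ofPred_eq] at *
    rw [mink_add_right, ha, hb, add_zero]
  zero_mem' := by simp [mink]
  smul_mem' := by
    intro c a ha
    simp only [mem_ofPred_eq] at *
    rw [mink_smul_right, ha, mul_zero]

/-- The tangent space at `x`, with the Riemannian scalar product
(the restriction of the Minkowski form) as its inner product. -/
def Tangent {n : ℕ} (x : Hyp n) : Type := ↥(tangentSubmodule x)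

namespace Tangent

variable {n : ℕ} (x : Hyp n)

instance : AddCommGroup (Tangent x) := inferInstanceAs (AddCommGroup ↥(tangentSubmodule x))
instance : Module ℝ (Tangent x) := inferInstanceAs (Module ℝ ↥(tangentSubmodule x))
instance : Module.Finite ℝ (Tangent x) :=
  inferInstanceAs (Module.Finite ℝ ↥(tangentSubmodule x))

/-- The underlying vector of Minkowski space. -/
def vec {x : Hyp n} (u : Tangent x) : Mink n := u.1

/-- The Riemannian scalar product at `x`. -/
@[reducible] def core : InnerProductSpace.Core ℝ (Tangent x) where
  inner u v := mink u.vec v.vec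
  conj_inner_symm u v := by simp [mink_comm]
  re_inner_nonneg u := mink_self_nonneg x u.2
  add_left u v w := mink_add_left _ _ _
  smul_left u v r := mink_smul_left _ _ _
  definite u hu := Subtype.ext (eq_zero_of_mink_self x u.2 hu)

instance : NormedAddCommGroup (Tangent x) := (core x).toNormedAddCommGroup
instance : InnerProductSpace ℝ (Tangent x) := InnerProductSpace.ofCore (core x).toCore
instance : MeasurableSpace (Tangent x) := borel _
instance : BorelSpace (Tangent x) := ⟨rfl⟩

lemma inner_def {x : Hyp n} (u v : Tangent x) : ⟪u, v⟫ = mink u.vec v.vec := rfl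

end Tangent

/-! ### The hyperbolic distance -/

section Metric

variable {n : ℕ}

lemma one_le_neg_mink (x y : Hyp n) : 1 ≤ -mink x.pt y.pt := by
  have hx := x.norm_sq
  have hy := y.norm_sq
  have h := real_inner_le_norm x.pt.2 y.pt.2
  have h1 : 1 + ‖x.pt.2‖ * ‖y.pt.2‖ ≤ x.pt.1 * y.pt.1 := by
    apply le_of_sq_le_sq _ (mul_pos x.pos y.pos).le
    have e : (x.pt.1 * y.pt.1) ^ 2 = (1 + ‖x.pt.2‖ ^ 2) * (1 + ‖y.pt.2‖ ^ 2) := by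
      rw [hx, hy]; ring
    rw [e]; nlinarith [sq_nonneg (‖x.pt.2‖ - ‖y.pt.2‖)]
  unfold mink; linarith

/-- The hyperbolic distance: `cosh d(x, y) = -mink x y`. -/
instance : Dist (Hyp n) := ⟨fun x y => Real.arcosh (-mink x.pt y.pt)⟩

lemma dist_def (x y : Hyp n) : dist x y = Real.arcosh (-mink x.pt y.pt) := rfl

lemma cosh_dist (x y : Hyp n) : Real.cosh (dist x y) = -mink x.pt y.pt :=
  Real.cosh_arcosh (one_le_neg_mink x y)

lemma dist_triangle_aux (x y z : Hyp n) : dist x z ≤ dist x y + dist y z := by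
  have hP : 0 ≤ dist x y := Real.arcosh_nonneg (one_le_neg_mink x y)
  have hQ : 0 ≤ dist y z := Real.arcosh_nonneg (one_le_neg_mink y z)
  have cP := cosh_dist x y
  have cQ := cosh_dist y z
  set P := -mink x.pt y.pt with hPdef
  set Q := -mink y.pt z.pt with hQdef
  have exy : mink x.pt y.pt = -P := by rw [hPdef, neg_neg]
  have eyx : mink y.pt x.pt = -P := by rw [mink_comm, exy]
  have eyz : mink y.pt z.pt = -Q := by rw [hQdef, neg_neg]
  have ezy : mink z.pt y.pt = -Q := by rw [mink_comm, eyz]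
  let a : Tangent y := ⟨x.pt + (-P) • y.pt, by
    change mink y.pt (x.pt + (-P) • y.pt) = 0
    rw [mink_add_right, mink_smul_right, eyx, y.mink_pt]; ring⟩
  let b : Tangent y := ⟨z.pt + (-Q) • y.pt, by
    change mink y.pt (z.pt + (-Q) • y.pt) = 0
    rw [mink_add_right, mink_smul_right, eyz, y.mink_pt]; ring⟩
  have haa : ⟪a, a⟫ = P ^ 2 - 1 := by
    change mink (x.pt + (-P) • y.pt) (x.pt + (-P) • y.pt) = _
    simp only [mink_add_left, mink_add_right, mink_smul_left, mink_smul_right, exy, eyx,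
      x.mink_pt, y.mink_pt]; ring
  have hbb : ⟪b, b⟫ = Q ^ 2 - 1 := by
    change mink (z.pt + (-Q) • y.pt) (z.pt + (-Q) • y.pt) = _
    simp only [mink_add_left, mink_add_right, mink_smul_left, mink_smul_right, ezy, eyz,
      z.mink_pt, y.mink_pt]; ring
  have hab : ⟪a, b⟫ = P * Q + mink x.pt z.pt := by
    change mink (x.pt + (-P) • y.pt) (z.pt + (-Q) • y.pt) = _
    simp only [mink_add_left, mink_add_right, mink_smul_left, mink_smul_right, exy, eyz,
      y.mink_pt]; ring
  have hsa : ‖a‖ = Real.sinh (dist x y) := by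
    rw [← sq_eq_sq₀ (norm_nonneg _) (Real.sinh_nonneg_iff.2 hP), ← real_inner_self_eq_norm_sq,
      haa, Real.sinh_sq, cP]
  have hsb : ‖b‖ = Real.sinh (dist y z) := by
    rw [← sq_eq_sq₀ (norm_nonneg _) (Real.sinh_nonneg_iff.2 hQ), ← real_inner_self_eq_norm_sq,
      hbb, Real.sinh_sq, cQ]
  have hcs := neg_le_of_abs_le (abs_real_inner_le_norm a b)
  rw [hab, hsa, hsb] at hcs
  have hfin : -mink x.pt z.pt ≤ Real.cosh (dist x y + dist y z) := by
    rw [Real.cosh_add, cP, cQ]; linarith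
  rw [dist_def x z, ← Real.arcosh_cosh (add_nonneg hP hQ)]
  exact (Real.arcosh_le_arcosh (lt_of_lt_of_le one_pos (one_le_neg_mink x z))
    (Real.cosh_pos _)).2 hfin

instance : MetricSpace (Hyp n) where
  dist_self x := by
    rw [dist_def, x.mink_pt, neg_neg, Real.arcosh_zero]
  dist_comm x y := by rw [dist_def, dist_def, mink_comm]
  dist_triangle := dist_triangle_aux
  eq_of_dist_eq_zero := by
    intro x y h
    rw [dist_def, Real.arcosh_eq_zero_iff (one_le_neg_mink x y)] at h
    have hxy : mink x.pt y.pt = -1 := by linarith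
    have hyx : mink y.pt x.pt = -1 := by rw [mink_comm, hxy]
    have e0 : mink x.pt (x.pt + (-1 : ℝ) • y.pt) = 0 := by
      rw [mink_add_right, mink_smul_right, x.mink_pt, hxy]; ring
    have e1 : mink (x.pt + (-1 : ℝ) • y.pt) (x.pt + (-1 : ℝ) • y.pt) = 0 := by
      simp only [mink_add_left, mink_add_right, mink_smul_left, mink_smul_right,
        x.mink_pt, y.mink_pt, hxy, hyx]; ring
    have e2 := eq_zero_of_mink_self x e0 e1
    apply Hyp.ext
    rw [neg_one_smul, ← sub_eq_add_neg, sub_eq_zero] at e2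
    exact e2

instance : MeasurableSpace (Hyp n) := borel _
instance : BorelSpace (Hyp n) := ⟨rfl⟩

/-- The point `(1, 0)` of the hyperboloid (the centre of the ball model). -/
def origin (n : ℕ) : Hyp n := ⟨(1, 0), by simp [mink], one_pos⟩

instance : Nonempty (Hyp n) := ⟨origin n⟩

end Metric

/-! ### The unit tangent bundle, geodesics and the boundary at infinity -/

/-- The unit tangent bundle of hyperbolic space. -/
@[ext]
structure T1 (n : ℕ) : Type where
  /-- The base point of a unit tangent vector. -/
  base : Hyp n
  /-- The underlying vector of Minkowski space of a unit tangent vector. -/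
  dir : Mink n
  orth : mink base.pt dir = 0
  unit : mink dir dir = 1

/-- The boundary at infinity of hyperbolic space: the unit sphere, as boundary of the projective
(or ball) model. The point `ξ` corresponds to the isotropic ray spanned by `(1, ξ)`. -/
abbrev Bdry (n : ℕ) : Type := Metric.sphere (0 : EuclideanSpace ℝ (Fin n)) 1

/-- The isotropic vector `(1, ξ)`. -/
def lightVec {n : ℕ} (ξ : Bdry n) : Mink n := (1, ξ.1)

namespace T1

variable {n : ℕ}

instance : TopologicalSpace (T1 n) :=
  TopologicalSpace.induced (fun v => (v.base, v.dir)) inferInstance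
instance : MeasurableSpace (T1 n) := borel _
instance : BorelSpace (T1 n) := ⟨rfl⟩

/-- The geodesic line with tangent vector `v` at time `0`. -/
def line (v : T1 n) (t : ℝ) : Hyp n :=
  ⟨Real.cosh t • v.base.pt + Real.sinh t • v.dir, by
    have h1 : mink v.base.pt v.dir = 0 := v.orth
    have h2 : mink v.dir v.dir = 1 := v.unit
    have h3 : mink v.dir v.base.pt = 0 := by rw [mink_comm, h1]
    simp only [mink_add_left, mink_add_right, mink_smul_left, mink_smul_right, h1, h2, h3,
      v.base.mink_pt]
    have := Real.cosh_sq t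
    nlinarith, by
      have h4 := abs_fst_lt v.base v.orth v.unit
      have h5 : |Real.sinh t| < Real.cosh t := by
        apply abs_lt_of_sq_lt_sq _ (Real.cosh_pos t).le
        rw [Real.cosh_sq]; linarith
      have h6 : |Real.sinh t * v.dir.1| ≤ Real.cosh t * |v.dir.1| := by
        rw [abs_mul]; exact mul_le_mul_of_nonneg_right h5.le (abs_nonneg _)
      have h7 := neg_le_of_abs_le h6
      have h8 := mul_lt_mul_of_pos_left h4 (Real.cosh_pos t)
      change 0 < Real.cosh t * v.base.pt.1 + Real.sinh t * v.dir.1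
      linarith⟩

/-- The positive endpoint `v₊`: the limit as `t → ∞` of the geodesic line of `v`
in the projective model, that is, the direction of the isotropic vector `x + u`
when `v = (x, u)`. -/
def endpoint (v : T1 n) : Bdry n :=
  ⟨(v.base.pt.1 + v.dir.1)⁻¹ • (v.base.pt.2 + v.dir.2), by
    have h1 : mink v.base.pt v.dir = 0 := v.orth
    have h2 : mink v.dir v.dir = 1 := v.unit
    have h3 : mink v.dir v.base.pt = 0 := by rw [mink_comm, h1]
    have h4 : mink (v.base.pt + v.dir) (v.base.pt + v.dir) = 0 := by
      simp only [mink_add_left, mink_add_right, h1, h2, h3, v.base.mink_pt]; ring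
    have h5 : 0 < v.base.pt.1 + v.dir.1 := by
      have := neg_lt_of_abs_lt (abs_fst_lt v.base h1 h2)
      linarith
    rw [mink_self] at h4
    have h6 : ‖v.base.pt.2 + v.dir.2‖ = v.base.pt.1 + v.dir.1 := by
      rw [← sq_eq_sq₀ (norm_nonneg _) h5.le]
      have h7 : ‖v.base.pt.2 + v.dir.2‖ ^ 2 - (v.base.pt.1 + v.dir.1) ^ 2 = 0 := h4
      linarith
    rw [mem_sphere_zero_iff_norm, norm_smul, h6, norm_inv, Real.norm_eq_abs, abs_of_pos h5,
      inv_mul_cancel₀ h5.ne']⟩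

end T1

section Boundary

variable {n : ℕ}

lemma mink_lightVec_self (ξ : Bdry n) : mink (lightVec ξ) (lightVec ξ) = 0 := by
  have h : ‖ξ.1‖ = 1 := mem_sphere_zero_iff_norm.1 ξ.2
  simp [mink_self, lightVec, h]

lemma mink_lightVec_neg (x : Hyp n) (ξ : Bdry n) : mink x.pt (lightVec ξ) < 0 := by
  have h : ‖ξ.1‖ = 1 := mem_sphere_zero_iff_norm.1 ξ.2
  have h1 : ⟪x.pt.2, ξ.1⟫ ≤ ‖x.pt.2‖ := by
    simpa [h] using real_inner_le_norm x.pt.2 ξ.1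
  have h2 : ‖x.pt.2‖ < x.pt.1 := by
    apply lt_of_pow_lt_pow_left₀ 2 x.pos.le
    rw [x.norm_sq]; linarith
  simp only [mink, lightVec]; linarith

/-- The unit tangent vector at `x` pointing towards `ξ`. -/
def toward (x : Hyp n) (ξ : Bdry n) : T1 n :=
  ⟨x, (-mink x.pt (lightVec ξ))⁻¹ • lightVec ξ + (-1 : ℝ) • x.pt, by
    have h : mink x.pt (lightVec ξ) ≠ 0 := (mink_lightVec_neg x ξ).ne
    simp only [mink_add_right, mink_smul_right, x.mink_pt, inv_neg, neg_mul, inv_mul_cancel₀ h]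
    norm_num, by
    have h : mink x.pt (lightVec ξ) ≠ 0 := (mink_lightVec_neg x ξ).ne
    have hc : mink (lightVec ξ) x.pt = mink x.pt (lightVec ξ) := mink_comm _ _
    simp only [mink_add_left, mink_add_right, mink_smul_left, mink_smul_right, x.mink_pt,
      mink_lightVec_self, hc]
    field_simp
    ring⟩

lemma toward_endpoint (x : Hyp n) (ξ : Bdry n) : (toward x ξ).endpoint = ξ := by
  have h := mink_lightVec_neg x ξ
  have h' : (-mink x.pt (lightVec ξ)) ≠ 0 := by linarith
  have e1 : x.pt.1 + (toward x ξ).dir.1 = (-mink x.pt (lightVec ξ))⁻¹ := by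
    simp [toward, lightVec]
  have e2 : x.pt.2 + (toward x ξ).dir.2 = (-mink x.pt (lightVec ξ))⁻¹ • ξ.1 := by
    simp [toward, lightVec]
  apply Subtype.ext
  change (x.pt.1 + (toward x ξ).dir.1)⁻¹ • (x.pt.2 + (toward x ξ).dir.2) = ξ.1
  rw [e1, e2, inv_inv, smul_smul, mul_inv_cancel₀ h', one_smul]

/-- The Busemann cocycle `β_ξ(x, y) = lim_{t → ∞} d(ρ_t, x) - d(ρ_t, y)`, where `ρ` is a geodesic
ray with point at infinity `ξ` (here the one starting at the origin). -/
def busemann (ξ : Bdry n) (x y : Hyp n) : ℝ :=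
  limUnder atTop fun t : ℝ =>
    dist ((toward (origin n) ξ).line t) x - dist ((toward (origin n) ξ).line t) y

/-- The points at infinity of `C`: the endpoints of the geodesic rays contained in `C`. -/
def infinityOf (C : Set (Hyp n)) : Set (Bdry n) :=
  {ξ | ∃ v : T1 n, (∀ t : ℝ, 0 ≤ t → v.line t ∈ C) ∧ v.endpoint = ξ}

/-- The closest point of `C` to the point at infinity `ξ`:
the point of `C` at which `x ↦ β_ξ(x, x₀)` is minimal. -/
def proj (C : Set (Hyp n)) (ξ : Bdry n) : Hyp n :=
  Classical.epsilon fun x => x ∈ C ∧ ∀ y ∈ C, busemann ξ x (origin n) ≤ busemann ξ y (origin n)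

/-- The lift `P⁺_C` of the closest point map to the unit tangent bundle. -/
def projPlus (C : Set (Hyp n)) (ξ : Bdry n) : T1 n := toward (proj C ξ) ξ

/-- The outer unit normal bundle `∂¹₊C`. -/
def outerNormal (C : Set (Hyp n)) : Set (T1 n) :=
  {v | v.base ∈ frontier C ∧ v.endpoint ∉ infinityOf C ∧ proj C v.endpoint = v.base}

end Boundary

/-! ### Isometries -/

section Isometries

variable {n : ℕ}

/-- The isometry group of hyperbolic space in the hyperboloid model: the linear automorphisms of
Minkowski space preserving the Minkowski form and the upper sheet. -/
def Lorentz (n : ℕ) : Subgroup (Mink n ≃ₗ[ℝ] Mink n) where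
  carrier := {A | (∀ x y, mink (A x) (A y) = mink x y) ∧ ∀ x : Hyp n, 0 < (A x.pt).1}
  one_mem' := ⟨fun _ _ => rfl, fun x => x.pos⟩
  mul_mem' := by
    rintro A B ⟨hA, hA'⟩ ⟨hB, hB'⟩
    refine ⟨fun x y => ?_, fun x => ?_⟩
    · rw [LinearEquiv.mul_apply, LinearEquiv.mul_apply, hA, hB]
    · exact hA' ⟨B x.pt, by rw [hB]; exact x.mink_pt, hB' x⟩
  inv_mem' := by
    rintro A ⟨hA, hA'⟩
    have hinv : ∀ x, A (A⁻¹ x) = x := fun x => A.apply_symm_apply x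
    have hm : ∀ x y, mink (A⁻¹ x) (A⁻¹ y) = mink x y := fun x y => by
      rw [← hA, hinv, hinv]
    refine ⟨hm, fun x => ?_⟩
    by_contra hc
    push Not at hc
    have h1 : mink (A⁻¹ x.pt) (A⁻¹ x.pt) = -1 := by rw [hm]; exact x.mink_pt
    have h2 : (A⁻¹ x.pt).1 ≠ 0 := by
      intro h0
      rw [mink_self, h0] at h1
      nlinarith [sq_nonneg ‖(A⁻¹ x.pt).2‖]
    have h3 : 0 < ((-1 : ℝ) • A⁻¹ x.pt).1 := by
      have := lt_of_le_of_ne hc h2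
      simp only [Prod.smul_fst, smul_eq_mul]; linarith
    have h4 := hA' ⟨(-1 : ℝ) • A⁻¹ x.pt, by
      rw [mink_smul_left, mink_smul_right, h1]; norm_num, h3⟩
    rw [map_smul, hinv, Prod.smul_fst, smul_eq_mul] at h4
    linarith [x.pos]

lemma Lorentz.mink_map (A : Lorentz n) (x y : Mink n) : mink (A.1 x) (A.1 y) = mink x y :=
  A.2.1 x y

instance : MulAction (Lorentz n) (Hyp n) where
  smul A x := ⟨A.1 x.pt, by rw [Lorentz.mink_map]; exact x.mink_pt, A.2.2 x⟩
  one_smul _ := rfl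
  mul_smul _ _ _ := rfl

instance : MulAction (Lorentz n) (T1 n) where
  smul A v := ⟨A • v.base, A.1 v.dir,
    by
      change mink (A.1 v.base.pt) (A.1 v.dir) = 0
      rw [Lorentz.mink_map]; exact v.orth,
    by
        rw [Lorentz.mink_map]; exact v.unit⟩
  one_smul _ := rfl
  mul_smul _ _ _ := rfl

instance : IsIsometricSMul (Lorentz n) (Hyp n) :=
  ⟨fun A => Isometry.of_dist_eq fun x y => by
    change Real.arcosh (-mink (A.1 x.pt) (A.1 y.pt)) = Real.arcosh (-mink x.pt y.pt)
    rw [Lorentz.mink_map]⟩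

/-- `A` fixes the point at infinity `ξ`. -/
def FixesEnd (A : Lorentz n) (ξ : Bdry n) : Prop := ∃ c : ℝ, A.1 (lightVec ξ) = c • lightVec ξ

/-- An isometry is parabolic if it has no fixed point in hyperbolic space and exactly one
fixed point at infinity. -/
def IsParabolic (A : Lorentz n) : Prop := (∀ x : Hyp n, A • x ≠ x) ∧ ∃! ξ : Bdry n, FixesEnd A ξ

/-- `Γ` is a discrete torsion-free group of isometries, so that `Γ \ ℍⁿ` is a complete
hyperbolic manifold. -/
structure IsHyperbolicManifoldGroup (Γ : Subgroup (Lorentz n)) : Prop where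
  discrete : ∀ (x : Hyp n) (r : ℝ), {γ : Lorentz n | γ ∈ Γ ∧ dist x (γ • x) ≤ r}.Finite
  torsionFree : ∀ γ ∈ Γ, ∀ m : ℕ, 0 < m → γ ^ m = 1 → γ = 1

end Isometries

/-! ### Measures on quotients -/

section Quotients

/-- The measure induced by a measure `m` on `X` on the image of `q : X → Y`, counting each fibre of
`q` once: the measure of `B` is the largest `m`-measure of a measurable subset of `q⁻¹ B` that
meets each fibre of `q` at most once. -/
def descend {X Y : Type*} [MeasurableSpace X] [MeasurableSpace Y] (q : X → Y) (hq : Measurable q)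
    (m : Measure X) : Measure Y :=
  Measure.ofMeasurable
    (fun B _ => ⨆ A : {A : Set X // MeasurableSet A ∧ InjOn q A ∧ A ⊆ q ⁻¹' B}, m A.1)
    (by
      rw [ENNReal.iSup_eq_zero]
      rintro ⟨A, -, -, hA⟩
      rw [preimage_empty, subset_empty_iff] at hA
      change m A = 0
      rw [hA, measure_empty])
    (by
      intro B hB hdisj
      apply le_antisymm
      · apply iSup_le
        rintro ⟨A, hA, hinj, hsub⟩
        have hAe : A = ⋃ i, A ∩ q ⁻¹' B i := by
          rw [← inter_iUnion, ← preimage_iUnion]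
          exact (inter_eq_left.2 hsub).symm
        have h1 : m A ≤ ∑' i, m (A ∩ q ⁻¹' B i) := by
          conv_lhs => rw [hAe]
          exact measure_iUnion_le _
        refine h1.trans (ENNReal.tsum_le_tsum fun i => ?_)
        exact le_iSup (fun A : {A : Set X // MeasurableSet A ∧ InjOn q A ∧ A ⊆ q ⁻¹' B i} => m A.1)
          ⟨_, hA.inter (hq (hB i)), hinj.mono inter_subset_left, inter_subset_right⟩
      · rw [ENNReal.tsum_eq_iSup_sum]
        apply iSup_le
        intro s
        have key : (∑ i ∈ s, ⨆ A : {A : Set X // MeasurableSet A ∧ InjOn q A ∧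
            A ⊆ q ⁻¹' B i}, m A.1) ≤
            ⨆ A : {A : Set X // MeasurableSet A ∧ InjOn q A ∧ A ⊆ q ⁻¹' ⋃ i ∈ s, B i}, m A.1 := by
          induction s using Finset.induction_on with
          | empty => simp
          | insert a s ha ih =>
            rw [Finset.sum_insert ha]
            refine (add_le_add le_rfl ih).trans ?_
            have : ∀ D, Nonempty {A : Set X // MeasurableSet A ∧ InjOn q A ∧ A ⊆ q ⁻¹' D} :=
              fun D => ⟨⟨∅, MeasurableSet.empty, injOn_empty _, empty_subset _⟩⟩
            apply ENNReal.iSup_add_iSup_le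
            rintro ⟨A, hA, hAi, hAs⟩ ⟨A', hA', hAi', hAs'⟩
            have hd : Disjoint (B a) (⋃ i ∈ s, B i) := by
              rw [disjoint_iUnion₂_right]
              intro i hi
              exact hdisj (fun h => ha (h ▸ hi))
            have hd' : Disjoint A A' := Disjoint.mono hAs hAs' (hd.preimage _)
            change m A + m A' ≤ _
            rw [← measure_union hd' hA']
            refine le_iSup (fun A : {A : Set X // MeasurableSet A ∧ InjOn q A ∧
              A ⊆ q ⁻¹' ⋃ i ∈ insert a s, B i} => m A.1) ⟨A ∪ A', hA.union hA', ?_, ?_⟩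
            · rw [injOn_union hd']
              exact ⟨hAi, hAi', fun x hx y hy hxy => hd.ne_of_mem (hAs hx) (hAs' hy) hxy⟩
            · rw [Finset.set_biUnion_insert, preimage_union]
              exact union_subset_union hAs hAs'
        refine key.trans (iSup_le ?_)
        rintro ⟨A, hA, hAi, hAs⟩
        exact le_iSup (fun A : {A : Set X // MeasurableSet A ∧ InjOn q A ∧
          A ⊆ q ⁻¹' ⋃ i, B i} => m A.1)
          ⟨A, hA, hAi, hAs.trans (preimage_mono (iUnion₂_subset_iUnion _ _))⟩)

/-- The measure induced on the quotient `G \ X` by a `G`-invariant measure `m` on `X`, for a free and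
properly discontinuous action: the measure of `B` is the `m`-measure of any measurable set of
representatives of the orbits in `B`. -/
def quotientMeasure (G : Type*) {X : Type*} [Group G] [MulAction G X] [MeasurableSpace X]
    (m : Measure X) : Measure (Quotient (MulAction.orbitRel G X)) :=
  descend (Quotient.mk (MulAction.orbitRel G X)) (fun _ hs => hs) m

end Quotients

/-! ### Spherical density and skinning measures -/

section Skinning

variable {n : ℕ}

/-- The spherical density of dimension `n - 1`: the measure at the origin is the Lebesgue measure of
the unit sphere, and `dμ_x/dμ_0(ξ) = exp(-(n-1) β_ξ(x, 0))`. -/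
def sphericalDensity (x : Hyp n) : Measure (Bdry n) :=
  (volume : Measure (EuclideanSpace ℝ (Fin n))).toSphere.withDensity fun ξ =>
    ENNReal.ofReal (Real.exp (-((n : ℝ) - 1) * busemann ξ x (origin n)))

/-- The skinning measure of `C` on the unit tangent bundle of hyperbolic space, defined by a
density `μ` of dimension `δ` and a base point `x₀`:
`dσ̃_C(w) = exp(-δ β_{w₊}(π(w), x₀)) d((P⁺_C)_* μ_{x₀})(w)`. -/
def skinningUp (δ : ℝ) (μ : Hyp n → Measure (Bdry n)) (x₀ : Hyp n) (C : Set (Hyp n)) :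
    Measure (T1 n) :=
  (((μ x₀).restrict (infinityOf C)ᶜ).map (projPlus C)).withDensity fun w =>
    ENNReal.ofReal (Real.exp (-δ * busemann w.endpoint w.base x₀))

/-- The skinning measure `σ_C` on `T¹M = Γ \ T¹ℍⁿ`, induced by the `Γ`-invariant measure
`∑_{γ ∈ Γ/Γ_C} γ_* σ̃_C`. -/
def skinning (Γ : Subgroup (Lorentz n)) (δ : ℝ) (μ : Hyp n → Measure (Bdry n)) (x₀ : Hyp n)
    (C : Set (Hyp n)) : Measure (Quotient (MulAction.orbitRel Γ (T1 n))) :=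
  quotientMeasure Γ (Measure.sum fun q : Γ ⧸ MulAction.stabilizer Γ C =>
    (skinningUp δ μ x₀ C).map fun v => q.out • v)

end Skinning

/-! ### Riemannian measures

The Riemannian measure of a `d`-dimensional submanifold is the `d`-dimensional Hausdorff measure
of the ambient Riemannian distance, normalised to agree with Lebesgue measure on `ℝᵈ`. -/

section Riemannian

open scoped MeasureTheory

variable {n : ℕ}

/-- A unit vector of a subspace of the tangent space at `x`, as a unit tangent vector. -/
def unitOf {x : Hyp n} (N : Submodule ℝ (Tangent x)) (u : Metric.sphere (0 : N) 1) : T1 n :=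
  ⟨x, u.1.1.vec, u.1.1.2, by
    have h : ‖u.1.1‖ = 1 := mem_sphere_zero_iff_norm.1 u.2
    change mink u.1.1.vec u.1.1.vec = 1
    rw [← Tangent.inner_def, real_inner_self_eq_norm_sq, h, one_pow]⟩

/-- The linear span in the tangent space at `x` of the vectors of `S` with base point `x`. -/
def fiberSpan (S : Set (T1 n)) (x : Hyp n) : Submodule ℝ (Tangent x) :=
  Submodule.span ℝ {u | ∃ v ∈ S, v.base = x ∧ v.dir = u.vec}

/-- The spherical measure on the set of vectors of `S` with base point `x`: the standard measure of
the unit sphere of the subspace they span, restricted to `S`. (If `S` is the outer unit normal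
bundle of a totally geodesic submanifold this is the standard measure of the unit sphere of the
normal space; if the normal vector is unique it is the unit Dirac mass.) -/
def fiberMeasure (S : Set (T1 n)) (x : Hyp n) : Measure (T1 n) :=
  ((volume : Measure (fiberSpan S x)).toSphere.map (unitOf (fiberSpan S x))).restrict S

/-- The Riemannian measure of the outer unit normal bundle of `C`, when `∂C` is a `d`-dimensional
submanifold: `∫_{x ∈ ∂C} Vol_{∂¹₊C ∩ T¹_x} dVol_{∂C}(x)`. -/
def normalVolUp (d : ℕ) (C : Set (Hyp n)) : Measure (T1 n) :=
  ((μHE[d] : Measure (Hyp n)).restrict (frontier C)).bind (fiberMeasure (outerNormal C))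

/-- The map `Γ_C \ T¹ℍⁿ → Γ \ T¹ℍⁿ`. -/
def stabToQuotient (Γ : Subgroup (Lorentz n)) (C : Set (Hyp n)) :
    Quotient (MulAction.orbitRel (MulAction.stabilizer Γ C) (T1 n)) →
      Quotient (MulAction.orbitRel Γ (T1 n)) :=
  Quotient.map id (by
    rintro a b ⟨g, rfl⟩
    exact ⟨g.1, rfl⟩)

/-- The Riemannian measure `Vol_{∂¹₊C}` of `∂¹₊C = Γ_C \ ∂¹₊C̃`, as a measure on `T¹M` (its image by
the immersion `∂¹₊C → T¹M`). -/
def normalVol (Γ : Subgroup (Lorentz n)) (d : ℕ) (C : Set (Hyp n)) :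
    Measure (Quotient (MulAction.orbitRel Γ (T1 n))) :=
  (quotientMeasure (MulAction.stabilizer Γ C) (normalVolUp d C)).map (stabToQuotient Γ C)

/-- The `d`-dimensional Riemannian volume of `Γ_C \ S`, for a `Γ_C`-invariant `d`-dimensional
submanifold `S`. -/
def quotientVol (Γ : Subgroup (Lorentz n)) (d : ℕ) (C S : Set (Hyp n)) : ℝ≥0∞ :=
  quotientMeasure (MulAction.stabilizer Γ C) ((μHE[d] : Measure (Hyp n)).restrict S) univ

/-- The Riemannian volume of the manifold `Γ \ ℍⁿ`. -/
def manifoldVol (Γ : Subgroup (Lorentz n)) : ℝ≥0∞ :=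
  quotientMeasure Γ (μHE[n] : Measure (Hyp n)) univ

/-- The volume of the standard unit sphere of dimension `m`. -/
def sphereVol (m : ℕ) : ℝ≥0∞ :=
  (volume : Measure (EuclideanSpace ℝ (Fin (m + 1)))).toSphere univ

end Riemannian

/-! ### Margulis cusp neighbourhoods and totally geodesic submanifolds -/

section Submanifolds

variable {n : ℕ}

/-- `C` is a (closed) horoball centred at `ξ`. -/
def IsHoroballAt (ξ : Bdry n) (C : Set (Hyp n)) : Prop :=
  ∃ c : ℝ, C = {y | busemann ξ y (origin n) ≤ c}

/-- The image of `C` in `Γ \ ℍⁿ` is a Margulis cusp neighbourhood: `C` is a horoball centred at a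
fixed point of a parabolic element of `Γ`, and the horoballs of its `Γ`-orbit have pairwise disjoint
interiors. -/
def IsMargulisCusp (Γ : Subgroup (Lorentz n)) (C : Set (Hyp n)) : Prop :=
  (∃ ξ : Bdry n, IsHoroballAt ξ C ∧ ∃ γ ∈ Γ, IsParabolic γ ∧ FixesEnd γ ξ) ∧
    (MulAction.orbit Γ C).Pairwise fun D D' => Disjoint (interior D) (interior D')

/-- `C` is a `k`-dimensional totally geodesic subspace of hyperbolic space: the nonempty
intersection of the hyperboloid with a `(k+1)`-dimensional linear subspace. -/
def IsTotallyGeodesic (k : ℕ) (C : Set (Hyp n)) : Prop :=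
  C.Nonempty ∧ ∃ V : Submodule ℝ (Mink n), Module.finrank ℝ V = k + 1 ∧ C = {x | x.pt ∈ V}

/-- The `Γ`-orbit of `C` is locally finite. -/
def LocallyFiniteOrbit (Γ : Subgroup (Lorentz n)) (C : Set (Hyp n)) : Prop :=
  ∀ K : Set (Hyp n), IsCompact K → {D ∈ MulAction.orbit Γ C | (D ∩ K).Nonempty}.Finite

end Submanifolds

end HypSkin

end

open HypSkin

noncomputable section

namespace HypSkin

/-! The measure `lam m`, with density 1/√(m + ‖z‖²) on Euclidean space, is the Lorentz-invariant
measure of the sheet t² - ‖z‖² = m, read in the coordinate z. For m = 1 it is the Riemannian measure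
of hyperbolic space, for m = 0 the invariant measure of the light cone. The boundary at infinity is
the set of rays of the cone, and `busemann_eq` gives β_ξ(x, y) = log (hor ξ x / hor ξ y), where hor
ξ x is minus the Minkowski product of x with (1, ξ).

In the definition of the skinning measure the two exponential factors multiply to h^(-(n-1)), where
h is the height `hor` of the closest point; the base point x₀ disappears. Since ∫ r^(n-2) dr over
(0, 1/h) is h^(-(n-1))/(n-1), polar coordinates on the cone give `IsProjData.skinningUp_eq`: the
skinning measure is n-1 times the image of `lam 0`, restricted to {0 < N < 1}, under P. Here P and N
extend the lifted closest point map and the height h homogeneously, in degrees 0 and 1. Each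
comparison becomes an explicit integral over a piece of the cone.

For the horoball hor ξ ≤ s, N is t/(2s), with t the light-cone coordinate `dep`. In coordinates (t,
w) the measure `lam m` is dt dw / t and the foot point is (s/t) w, so the slab t < a contributes
(a/s)^(n-1)/(n-1) times Lebesgue measure of the horosphere (`lintegral_lam_horosphere`). On the cone
a = 2s, whence the constant 2^(n-1). On the hyperboloid (m = 1) with a = s the same formula says
that the horoball has 1/(n-1) times the volume of its boundary.

For a totally geodesic subspace through the origin, lying above a linear subspace K, write z = a + b
with a in K and b orthogonal to K. Then N = ‖b‖, the foot lies above a/‖b‖ and the normal vector is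
b/‖b‖. The tube ‖b‖ < 1 of the cone splits as `lam 1` on K times the sphere of normals, with factor
∫ r^(n-2) dr = 1/(n-1) (`lintegral_lam_tube`), so the final constant is 1. Other subspaces are moved
to this position by a geodesic symmetry.

Two bridges remain. The normalised Hausdorff measures are identified with the explicit densities by
almost isometric local parametrisations (`measure_le_of_local_le`). The equalities descend to the
quotient through a strict measurable fundamental domain (`quotientMeasure_sum`,
`quotientMeasure_map_univ`). -/

set_option linter.unusedSectionVars false

/-! ### Invariant measures of the hyperboloid and of the light cone. -/

section Sheet

variable {E : Type*} [NormedAddCommGroup E] [InnerProductSpace ℝ E]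

/-- The height above `z` of the sheet `{(t, z) | t ^ 2 - ‖z‖ ^ 2 = m, t ≥ 0}`. -/
def hgt (m : ℝ) (z : E) : ℝ := √(m + ‖z‖ ^ 2)

lemma hgt_sq {m : ℝ} (hm : 0 ≤ m) (z : E) : hgt m z ^ 2 = m + ‖z‖ ^ 2 :=
  Real.sq_sqrt (by positivity)

lemma hgt_nonneg (m : ℝ) (z : E) : 0 ≤ hgt m z := Real.sqrt_nonneg _

lemma hgt_zero_left (z : E) : hgt 0 z = ‖z‖ := by simp [hgt]

lemma norm_le_hgt {m : ℝ} (hm : 0 ≤ m) (z : E) : ‖z‖ ≤ hgt m z :=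
  Real.le_sqrt_of_sq_le (by linarith)

lemma hgt_neg (m : ℝ) (z : E) : hgt m (-z) = hgt m z := by simp [hgt]

lemma hgt_one_pos (z : E) : 0 < hgt 1 z := Real.sqrt_pos.2 (by positivity)

lemma continuous_hgt (m : ℝ) : Continuous (hgt m : E → ℝ) := by
  unfold hgt; fun_prop

lemma hasFDerivAt_hgt {m : ℝ} {z : E} (h : 0 < m + ‖z‖ ^ 2) :
    HasFDerivAt (hgt m) ((hgt m z)⁻¹ • innerSL ℝ z) z := by
  have h1 : HasFDerivAt (fun z : E => m + ‖z‖ ^ 2) (2 • innerSL ℝ z) z :=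
    (hasStrictFDerivAt_norm_sq z).hasFDerivAt.const_add m
  have h2 := h1.sqrt h.ne'
  refine h2.congr_fderiv ?_
  ext w
  simp [hgt]
  ring

/-- The invariant measure of the sheet of height `hgt m`, in the coordinate `z`. -/
def lam [FiniteDimensional ℝ E] [MeasurableSpace E] [BorelSpace E] (m : ℝ) : Measure E :=
  volume.withDensity fun z => ENNReal.ofReal (hgt m z)⁻¹

variable [FiniteDimensional ℝ E] [MeasurableSpace E] [BorelSpace E]

lemma measurable_hgt (m : ℝ) : Measurable (hgt m : E → ℝ) := (continuous_hgt m).measurable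

lemma measurableSet_hgt_pos (m : ℝ) : MeasurableSet {z : E | 0 < m + ‖z‖ ^ 2} :=
  measurableSet_lt measurable_const (by fun_prop)

lemma lintegral_lam (m : ℝ) {f : E → ℝ≥0∞} (hf : Measurable f) :
    ∫⁻ z, f z ∂(lam m) = ∫⁻ z, ENNReal.ofReal (hgt m z)⁻¹ * f z := by
  rw [lam, lintegral_withDensity_eq_lintegral_mul _ (by
    exact ((measurable_hgt m).inv).ennreal_ofReal) hf]
  rfl

/-- Where the height vanishes the density is 0⁻¹ = 0, so the tip of the cone can be discarded
without a null-set argument. -/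
lemma lintegral_lam' (m : ℝ) {f : E → ℝ≥0∞} (hf : Measurable f) :
    ∫⁻ z, f z ∂(lam m) =
      ∫⁻ z in {z : E | 0 < m + ‖z‖ ^ 2}, ENNReal.ofReal (hgt m z)⁻¹ * f z := by
  rw [lintegral_lam m hf, ← lintegral_indicator (measurableSet_hgt_pos m)]
  congr 1 with z
  by_cases h : 0 < m + ‖z‖ ^ 2
  · simp [h]
  · have : hgt m z = 0 := Real.sqrt_eq_zero_of_nonpos (not_lt.1 h)
    simp [h, this]

/-- Change of variables for a translation by a multiple of a fixed vector. -/
lemma setLIntegral_image_add_smul {U : Set E} (hU : MeasurableSet U) {g : E → ℝ}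
    {g' : E → E →L[ℝ] ℝ} (v : E) (hg : ∀ z ∈ U, HasFDerivAt g (g' z) z)
    (hinj : InjOn (fun z => z + g z • v) U) (f : E → ℝ≥0∞) :
    ∫⁻ y in (fun z => z + g z • v) '' U, f y =
      ∫⁻ z in U, ENNReal.ofReal |1 + g' z v| * f (z + g z • v) := by
  have hd : ∀ z ∈ U, HasFDerivWithinAt (fun z => z + g z • v)
      (ContinuousLinearMap.id ℝ E + (g' z).smulRight v) U z := fun z hz =>
    ((hasFDerivAt_id z).add ((hg z hz).smul_const v)).hasFDerivWithinAt
  rw [lintegral_image_eq_lintegral_abs_det_fderiv_mul volume hU hd hinj f]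
  congr 1 with z
  congr 3
  -- The derivative is a rank-one perturbation of the identity, with determinant 1 + g'(v).
  have : ((ContinuousLinearMap.id ℝ E + (g' z).smulRight v : E →L[ℝ] E) : E →ₗ[ℝ] E) =
      LinearMap.transvection (g' z : E →ₗ[ℝ] ℝ) v := by
    ext w; simp [LinearMap.transvection.apply]
  rw [ContinuousLinearMap.det, this, LinearMap.transvection.det]
  simp

/-- The coordinate expression of the geodesic symmetry exchanging `(1, 0)` and `(c, v)`. -/
def symMap (m c : ℝ) (v : E) (z : E) : E := -(z + (⟪z, v⟫ / (1 + c) - hgt m z) • v)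

lemma measurable_symMap (m c : ℝ) (v : E) : Measurable (symMap m c v) := by
  have := continuous_hgt (E := E) m
  unfold symMap
  exact Continuous.measurable (by fun_prop)

lemma norm_symMap_sq {m c : ℝ} {v : E} (hm : 0 ≤ m) (hc : 0 ≤ c) (hv : ‖v‖ ^ 2 = c ^ 2 - 1) (z : E) :
    m + ‖symMap m c v z‖ ^ 2 = (c * hgt m z - ⟪z, v⟫) ^ 2 := by
  have hc1 : 1 + c ≠ 0 := by positivity
  have hq := hgt_sq hm z
  rw [symMap, norm_neg, norm_add_sq_real, real_inner_smul_right, norm_smul, mul_pow, hv,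
    Real.norm_eq_abs, sq_abs]
  have : ‖z‖ ^ 2 = hgt m z ^ 2 - m := by linarith
  rw [this]
  field_simp
  ring

lemma inner_le_mul_hgt {m c : ℝ} {v : E} (hm : 0 ≤ m) (hc : 0 ≤ c) (hv : ‖v‖ ^ 2 = c ^ 2 - 1)
    (z : E) : ⟪z, v⟫ ≤ c * hgt m z := by
  have h1 : ‖v‖ ≤ c := le_of_sq_le_sq (by linarith) hc
  calc ⟪z, v⟫ ≤ ‖z‖ * ‖v‖ := real_inner_le_norm z v
    _ ≤ hgt m z * c := mul_le_mul (norm_le_hgt hm z) h1 (norm_nonneg _) (hgt_nonneg _ _)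
    _ = _ := mul_comm _ _

lemma hgt_symMap {m c : ℝ} {v : E} (hm : 0 ≤ m) (hc : 0 ≤ c) (hv : ‖v‖ ^ 2 = c ^ 2 - 1) (z : E) :
    hgt m (symMap m c v z) = c * hgt m z - ⟪z, v⟫ := by
  rw [hgt, norm_symMap_sq hm hc hv, Real.sqrt_sq]
  linarith [inner_le_mul_hgt hm hc hv z]

lemma symMap_symMap {m c : ℝ} {v : E} (hm : 0 ≤ m) (hc : 0 ≤ c) (hv : ‖v‖ ^ 2 = c ^ 2 - 1) (z : E) :
    symMap m c v (symMap m c v z) = z := by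
  have hc1 : 1 + c ≠ 0 := by positivity
  have e : ⟪symMap m c v z, v⟫ =
      -(⟪z, v⟫ + (⟪z, v⟫ / (1 + c) - hgt m z) * (c ^ 2 - 1)) := by
    rw [symMap, inner_neg_left, inner_add_left, real_inner_smul_left, real_inner_self_eq_norm_sq, hv]
  -- The coefficient of v is itself unchanged by the symmetry, which makes the map an involution.
  have : ⟪symMap m c v z, v⟫ / (1 + c) - hgt m (symMap m c v z) =
      ⟪z, v⟫ / (1 + c) - hgt m z := by
    rw [hgt_symMap hm hc hv, e]
    field_simp
    ring
  rw [symMap, this, symMap]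
  simp

/-- The invariant measures of the sheets are invariant under geodesic symmetries. -/
lemma measurePreserving_symMap {m c : ℝ} {v : E} (hm : 0 ≤ m) (hc : 0 ≤ c)
    (hv : ‖v‖ ^ 2 = c ^ 2 - 1) : MeasurePreserving (symMap m c v) (lam m) (lam m) := by
  refine ⟨measurable_symMap m c v, ?_⟩
  have hc1 : 0 < 1 + c := by positivity
  refine Measure.ext_of_lintegral _ fun f hf => ?_
  have hfm : Measurable fun z => f (symMap m c v z) := hf.comp (measurable_symMap m c v)
  rw [lintegral_map hf (measurable_symMap m c v), lintegral_lam' m hf, lintegral_lam' m hfm]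
  -- For m = 0 this removes the tip of the cone, where the height is not differentiable.
  set U := {z : E | 0 < m + ‖z‖ ^ 2} with hU
  have hUm : MeasurableSet U := measurableSet_hgt_pos m
  have hUiff : ∀ z, z ∈ U ↔ 0 < hgt m z := fun z => Real.sqrt_pos.symm
  have hinv := symMap_symMap (E := E) hm hc hv
  have hcq : ∀ z ∈ U, ⟪z, v⟫ < c * hgt m z := by
    intro z hz
    by_cases hv0 : v = 0
    · have : 0 < c := by
        rcases hc.lt_or_eq with h | h
        · exact h
        · rw [hv0, ← h] at hv; norm_num at hv
      have := mul_pos this ((hUiff z).1 hz)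
      simpa [hv0] using this
    · have h1 : ‖v‖ < c := lt_of_pow_lt_pow_left₀ 2 hc (by linarith)
      calc ⟪z, v⟫ ≤ ‖z‖ * ‖v‖ := real_inner_le_norm z v
        _ ≤ hgt m z * ‖v‖ := mul_le_mul_of_nonneg_right (norm_le_hgt hm z) (norm_nonneg _)
        _ < hgt m z * c := mul_lt_mul_of_pos_left h1 ((hUiff z).1 hz)
        _ = _ := mul_comm _ _
  -- The symmetry is minus a map T of the form z + g(z) v; the Jacobian is computed for T, and the
  -- sign is absorbed by the evenness of the height.
  have hmaps : ∀ z ∈ U, symMap m c v z ∈ U := by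
    intro z hz
    rw [hUiff, hgt_symMap hm hc hv]
    linarith [hcq z hz]
  set T : E → E := fun z => z + (⟪z, v⟫ / (1 + c) - hgt m z) • v with hT
  have hTs : ∀ z, symMap m c v z = -T z := fun z => rfl
  have hnegU : ∀ z, -z ∈ U ↔ z ∈ U := by intro z; simp [hU]
  have himg : T '' U = U := by
    ext y
    constructor
    · rintro ⟨z, hz, rfl⟩
      rw [← hnegU, ← hTs]; exact hmaps z hz
    · intro hy
      refine ⟨symMap m c v (-y), hmaps _ ((hnegU y).2 hy), ?_⟩
      rw [← neg_neg (T _), ← hTs, hinv, neg_neg]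
  have hTinj : InjOn T U := by
    intro a _ b _ hab
    rw [← hinv a, ← hinv b, hTs a, hTs b]
    exact congrArg (fun y => symMap m c v (-y)) hab
  have key := setLIntegral_image_add_smul hUm (g := fun z => ⟪z, v⟫ / (1 + c) - hgt m z)
    (g' := fun z => (1 + c)⁻¹ • innerSL ℝ v - (hgt m z)⁻¹ • innerSL ℝ z) v (fun z hz => by
      refine HasFDerivAt.sub ?_ (hasFDerivAt_hgt hz)
      have := ((innerSL ℝ v).hasFDerivAt (x := z)).const_mul (1 + c)⁻¹
      refine this.congr_of_eventuallyEq (Eventually.of_forall fun y => ?_)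
      simp [real_inner_comm, div_eq_inv_mul]) hTinj
    (fun y => ENNReal.ofReal (hgt m y)⁻¹ * f (-y))
  change ∫⁻ y in T '' U, _ = _ at key
  rw [himg] at key
  have hneg : ∫⁻ y in U, ENNReal.ofReal (hgt m y)⁻¹ * f (-y) =
      ∫⁻ y in U, ENNReal.ofReal (hgt m y)⁻¹ * f y := by
    have := (LinearIsometryEquiv.neg ℝ (E := E)).measurePreserving.setLIntegral_comp_preimage_emb
      (LinearIsometryEquiv.neg ℝ (E := E)).toHomeomorph.measurableEmbedding
      (fun y => ENNReal.ofReal (hgt m y)⁻¹ * f y) U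
    rw [← this]
    have hpre : (LinearIsometryEquiv.neg ℝ (E := E)) ⁻¹' U = U := by
      ext z; simpa using hnegU z
    rw [hpre]
    simp [hgt_neg]
  rw [← hneg, key]
  refine setLIntegral_congr_fun hUm fun z hz => ?_
  have hq := (hUiff z).1 hz
  -- The Jacobian is the ratio of the heights of the image and of z, which the density 1/hgt
  -- compensates exactly.
  have h1 : |1 + ((1 + c)⁻¹ • innerSL ℝ v - (hgt m z)⁻¹ • innerSL ℝ z) v| =
      (hgt m z)⁻¹ * hgt m (symMap m c v z) := by
    rw [hgt_symMap hm hc hv]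
    have : 1 + ((1 + c)⁻¹ • innerSL ℝ v - (hgt m z)⁻¹ • innerSL ℝ z) v =
        (hgt m z)⁻¹ * (c * hgt m z - ⟪z, v⟫) := by
      simp only [sub_apply, smul_apply, innerSL_apply_apply,
        real_inner_self_eq_norm_sq, hv, smul_eq_mul]
      field_simp
      ring
    rw [this, abs_of_nonneg]
    exact mul_nonneg (inv_nonneg.2 hq.le) (by linarith [hcq z hz])
  have hq' := (hUiff _).1 (hmaps z hz)
  symm
  change ENNReal.ofReal |_| * (ENNReal.ofReal (hgt m (T z))⁻¹ * f (-T z)) = _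
  rw [h1, ← hTs, ← hgt_neg m (T z), ← hTs, ← mul_assoc, ← ENNReal.ofReal_mul (by positivity),
    mul_assoc, mul_inv_cancel₀ hq'.ne', mul_one]

end Sheet

/-! ### Integration in polar, light-cone and Fermi coordinates. -/

section Decomposition

variable {E : Type*} [NormedAddCommGroup E] [InnerProductSpace ℝ E]
  [FiniteDimensional ℝ E] [MeasurableSpace E] [BorelSpace E]

/-- Integration on `E` as an iterated integral over a subspace and its orthogonal. -/
lemma lintegral_orthogonal (K : Submodule ℝ E) {f : E → ℝ≥0∞} (hf : Measurable f) :
    ∫⁻ z, f z = ∫⁻ b : Kᗮ, ∫⁻ a : K, f ((a : E) + b) := by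
  have h := (K.orthogonalDecomposition.symm.measurePreserving).comp
    (WithLp.volume_preserving_toLp K Kᗮ)
  have e : ∀ p : K × Kᗮ, (K.orthogonalDecomposition.symm ∘ WithLp.toLp 2) p = (p.1 : E) + p.2 := by
    intro p
    rw [Function.comp_apply, LinearIsometryEquiv.symm_apply_eq]
    rw [Submodule.orthogonalDecomposition_apply]
    have := K.orthogonalProjectionOnto_apply_of_mem_orthogonal p.2.2
    have h' : Kᗮ.orthogonalProjectionOnto (p.1 : E) = 0 :=
      Submodule.orthogonalProjectionOnto_orthogonal_apply_eq_zero p.1.2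
    simp [this, h']
  rw [← h.lintegral_comp hf, Measure.volume_eq_prod, lintegral_prod_symm _ (by
    exact (hf.comp h.measurable).aemeasurable)]
  simp only [e]

/-- Integration on `E` as an iterated integral over a line and its orthogonal. -/
lemma lintegral_span_orthogonal {e : E} (he : ‖e‖ = 1) {f : E → ℝ≥0∞} (hf : Measurable f) :
    ∫⁻ z, f z = ∫⁻ t : ℝ, ∫⁻ b : (ℝ ∙ e)ᗮ, f (t • e + b) := by
  have h2 : Measurable fun p : (ℝ ∙ e)ᗮ × ℝ => f (p.2 • e + p.1) := by
    apply hf.comp; fun_prop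
  rw [lintegral_orthogonal (ℝ ∙ e) hf, lintegral_lintegral_swap (f := fun (t : ℝ) (b : (ℝ ∙ e)ᗮ) =>
    f (t • e + b)) (by
      apply Measurable.aemeasurable
      apply hf.comp; fun_prop)]
  congr 1 with b
  have := (LinearIsometryEquiv.toSpanUnitSingleton (𝕜 := ℝ) e he).measurePreserving.lintegral_comp
    (f := fun a : (ℝ ∙ e) => f (a + b)) (by apply hf.comp; fun_prop)
  rw [← this]
  rfl

lemma lintegral_comp_smul_pos {r : ℝ} (hr : 0 < r) {f : E → ℝ≥0∞} (hf : Measurable f) :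
    ∫⁻ z, f (r • z) = ENNReal.ofReal (r⁻¹ ^ Module.finrank ℝ E) * ∫⁻ z, f z := by
  have h := Measure.map_addHaar_smul (volume : Measure E) hr.ne'
  rw [← lintegral_map (f := f) hf (measurable_const_smul r), h, lintegral_smul_measure,
    abs_of_pos (by positivity), inv_pow, smul_eq_mul]

lemma setLIntegral_pow_Ioo (k : ℕ) {a : ℝ} (ha : 0 ≤ a) :
    ∫⁻ t in Ioo 0 a, ENNReal.ofReal (t ^ k) = ENNReal.ofReal (a ^ (k + 1) / (k + 1)) := by
  rw [Measure.restrict_congr_set Ioo_ae_eq_Ioc,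
    ← ofReal_integral_eq_lintegral_ofReal (intervalIntegral.intervalIntegrable_pow k).1,
    ← intervalIntegral.integral_of_le ha]
  · simp
  · filter_upwards [ae_restrict_mem measurableSet_Ioc] with y hy
    exact pow_nonneg hy.1.le _

/-- Integration in polar coordinates. -/
lemma lintegral_polar {f : E → ℝ≥0∞} (hf : Measurable f) [Nontrivial E] :
    ∫⁻ z, f z = ∫⁻ ξ, (∫⁻ r in Ioi (0 : ℝ), ENNReal.ofReal (r ^ (Module.finrank ℝ E - 1)) *
      f (r • (ξ : E))) ∂(volume : Measure E).toSphere := by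
  have h := (volume : Measure E).measurePreserving_homeomorphUnitSphereProd
  have h1 : ∫⁻ z, f z = ∫⁻ z : ({0}ᶜ : Set E), f z ∂((volume : Measure E).comap (↑)) := by
    have := setLIntegral_subtype (μ := (volume : Measure E)) (s := ({0}ᶜ : Set E))
      (measurableSet_singleton _).compl univ f
    rw [Measure.restrict_univ] at this
    rw [this, image_univ, Subtype.range_coe, restrict_compl_singleton]
  have h2 : ∀ z : ({0}ᶜ : Set E), f z =
      (fun p : Metric.sphere (0 : E) 1 × Ioi (0 : ℝ) => f ((p.2 : ℝ) • (p.1 : E)))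
        (homeomorphUnitSphereProd E z) := by
    intro z
    have hz : ‖(z : E)‖ ≠ 0 := norm_ne_zero_iff.2 z.2
    simp [smul_smul, mul_inv_cancel₀ hz]
  have hfm : Measurable (fun p : Metric.sphere (0 : E) 1 × Ioi (0 : ℝ) => f ((p.2 : ℝ) • (p.1 : E))) := by
    apply hf.comp; fun_prop
  rw [h1, lintegral_congr h2, h.lintegral_comp hfm, lintegral_prod _ hfm.aemeasurable]
  congr 1 with ξ
  rw [Measure.volumeIoiPow, lintegral_withDensity_eq_lintegral_mul _ (by fun_prop) (by
    apply hf.comp; fun_prop)]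
  have := setLIntegral_subtype (μ := (volume : Measure ℝ)) (s := Ioi (0 : ℝ))
      measurableSet_Ioi univ (fun r => ENNReal.ofReal (r ^ (Module.finrank ℝ E - 1)) *
      f (r • (ξ : E)))
  rw [Measure.restrict_univ, image_univ, Subtype.range_coe] at this
  exact this

/-- The light-cone coordinate of the point of height `hgt m z` above `z` in the direction `e`. -/
def dep (m : ℝ) (e z : E) : ℝ := hgt m z - ⟪z, e⟫

lemma measurable_dep (m : ℝ) (e : E) : Measurable (dep m e) := by
  have := continuous_hgt (E := E) m
  unfold dep
  exact Continuous.measurable (by fun_prop)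

/-- Light-cone coordinates for the invariant measures of the sheets. -/
lemma lintegral_lam_lightCone {m : ℝ} (hm : 0 ≤ m) {e : E} (he : ‖e‖ = 1) (f : E → ℝ≥0∞) :
    ∫⁻ z in {z | 0 < dep m e z}, ENNReal.ofReal (hgt m z)⁻¹ * f (z + (hgt m z - 2 * ⟪z, e⟫) • e) =
      ∫⁻ y in {y : E | 0 < ⟪y, e⟫}, ENNReal.ofReal ⟪y, e⟫⁻¹ * f y := by
  have hee : ⟪e, e⟫ = 1 := by rw [real_inner_self_eq_norm_sq, he, one_pow]
  set U := {z | 0 < dep m e z} with hU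
  have hUm : MeasurableSet U := measurableSet_lt measurable_const (measurable_dep m e)
  have hq : ∀ z ∈ U, 0 < hgt m z := by
    intro z hz
    rcases (hgt_nonneg m z).lt_or_eq with h | h
    · exact h
    · have h0 : ‖z‖ = 0 := le_antisymm ((norm_le_hgt hm z).trans h.symm.le) (norm_nonneg _)
      rw [norm_eq_zero] at h0
      have hz' : 0 < hgt m z - ⟪z, e⟫ := hz
      rw [← h, h0, inner_zero_left] at hz'
      norm_num at hz'
  -- T replaces the coordinate of z along e by `dep m e z` and keeps the orthogonal part. Its
  -- Jacobian determinant is -dep/hgt, so the density 1/hgt becomes 1/dep.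
  set T : E → E := fun z => z + (hgt m z - 2 * ⟪z, e⟫) • e with hT
  have hTe : ∀ z, ⟪T z, e⟫ = dep m e z := by
    intro z
    simp only [hT, inner_add_left, real_inner_smul_left, hee, dep]; ring
  have hTn : ∀ z, ‖T z‖ ^ 2 = ‖z‖ ^ 2 + (hgt m z - 2 * ⟪z, e⟫) * hgt m z := by
    intro z
    simp only [hT, norm_add_sq_real, real_inner_smul_right, norm_smul, he, Real.norm_eq_abs,
      mul_one, sq_abs]; ring
  -- the inverse of `T`
  set R : E → E := fun y => y + ((‖y‖ ^ 2 - ⟪y, e⟫ ^ 2 + m - ⟪y, e⟫ ^ 2) / (2 * ⟪y, e⟫) - ⟪y, e⟫) • e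
    with hR
  -- If t = hgt - ⟪z, e⟫ and w is the part of z orthogonal to e, then hgt + ⟪z, e⟫ = (m + ‖w‖²)/t.
  -- The half-difference recovers ⟪z, e⟫, the half-sum recovers the height.
  have hRT : ∀ z ∈ U, R (T z) = z := by
    intro z hz
    have hz' : dep m e z ≠ 0 := ne_of_gt hz
    have h1 : (‖T z‖ ^ 2 - ⟪T z, e⟫ ^ 2 + m - ⟪T z, e⟫ ^ 2) / (2 * ⟪T z, e⟫) - ⟪T z, e⟫ =
        -(hgt m z - 2 * ⟪z, e⟫) := by
      rw [hTe, hTn, div_sub' (by positivity), div_eq_iff (by positivity)]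
      have := hgt_sq hm z
      unfold dep
      linear_combination -this
    simp only [hR]
    rw [h1]
    simp only [hT]
    module
  have hRe : ∀ y, ⟪y, e⟫ ≠ 0 → ⟪R y, e⟫ = (‖y‖ ^ 2 - ⟪y, e⟫ ^ 2 + m - ⟪y, e⟫ ^ 2) / (2 * ⟪y, e⟫) := by
    intro y hy
    simp only [hR, inner_add_left, real_inner_smul_left, hee]; ring
  have hys : ∀ y : E, ⟪y, e⟫ ^ 2 ≤ ‖y‖ ^ 2 := by
    intro y
    rw [← sq_abs]
    have := abs_real_inner_le_norm y e
    rw [he, mul_one] at this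
    exact pow_le_pow_left₀ (abs_nonneg _) this 2
  have hRq : ∀ y, 0 < ⟪y, e⟫ →
      hgt m (R y) = (‖y‖ ^ 2 - ⟪y, e⟫ ^ 2 + m + ⟪y, e⟫ ^ 2) / (2 * ⟪y, e⟫) := by
    intro y hy
    rw [hgt, Real.sqrt_eq_iff_eq_sq (by positivity) (div_nonneg (by nlinarith [sq_nonneg ‖y‖]) (by positivity))]
    simp only [hR, norm_add_sq_real, real_inner_smul_right, norm_smul, he, Real.norm_eq_abs,
      mul_one, sq_abs]
    field_simp
    ring
  have himg : T '' U = {y : E | 0 < ⟪y, e⟫} := by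
    ext y
    constructor
    · rintro ⟨z, hz, rfl⟩
      rw [mem_ofPred_eq, hTe]; exact hz
    · intro hy
      have hy' : 0 < ⟪y, e⟫ := hy
      have hd : dep m e (R y) = ⟪y, e⟫ := by
        rw [dep, hRq y hy', hRe y hy'.ne']
        field_simp
        ring
      refine ⟨R y, ?_, ?_⟩
      · rw [hU, mem_ofPred_eq, hd]; exact hy
      · have h1 : hgt m (R y) - 2 * ⟪R y, e⟫ =
          -((‖y‖ ^ 2 - ⟪y, e⟫ ^ 2 + m - ⟪y, e⟫ ^ 2) / (2 * ⟪y, e⟫) - ⟪y, e⟫) := by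
          rw [hRq y hy', hRe y hy'.ne']
          field_simp
          ring
        simp only [hT]
        rw [h1]
        simp only [hR]
        module
  have hTinj : InjOn T U := fun a ha b hb hab => by rw [← hRT a ha, ← hRT b hb, hab]
  have key := setLIntegral_image_add_smul hUm (g := fun z => hgt m z - 2 * ⟪z, e⟫)
    (g' := fun z => (hgt m z)⁻¹ • innerSL ℝ z - 2 • innerSL ℝ e) e (fun z hz => by
      refine HasFDerivAt.sub (hasFDerivAt_hgt (Real.sqrt_pos.1 (hq z hz))) ?_
      have := ((innerSL ℝ e).hasFDerivAt (x := z)).const_mul 2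
      refine (this.congr_of_eventuallyEq (Eventually.of_forall fun y => ?_)).congr_fderiv ?_
      · simp [real_inner_comm]
      · ext; simp) hTinj
    (fun y => ENNReal.ofReal ⟪y, e⟫⁻¹ * f y)
  change ∫⁻ y in T '' U, _ = _ at key
  rw [himg] at key
  rw [key]
  refine setLIntegral_congr_fun hUm fun z hz => ?_
  have hq' := hq z hz
  have hz' : 0 < dep m e z := hz
  have h1 : |1 + ((hgt m z)⁻¹ • innerSL ℝ z - 2 • innerSL ℝ e) e| = (hgt m z)⁻¹ * dep m e z := by
    have : 1 + ((hgt m z)⁻¹ • innerSL ℝ z - 2 • innerSL ℝ e) e = -((hgt m z)⁻¹ * dep m e z) := by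
      simp only [sub_apply, smul_apply, innerSL_apply_apply, hee, smul_eq_mul, dep, nsmul_eq_mul]
      field_simp
      ring
    rw [this, abs_neg, abs_of_pos (by positivity)]
  symm
  change ENNReal.ofReal |_| * (ENNReal.ofReal ⟪T z, e⟫⁻¹ * f (T z)) = _
  rw [h1, hTe, ← mul_assoc, ← ENNReal.ofReal_mul (by positivity), mul_assoc,
    mul_inv_cancel₀ hz'.ne', mul_one]

/-- The integral over a slab of a function of the horospherical coordinate. -/
lemma lintegral_lam_horosphere {m : ℝ} (hm : 0 ≤ m) {e : E} (he : ‖e‖ = 1)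
    (hd : 2 ≤ Module.finrank ℝ E) {s a : ℝ} (hs : 0 < s) (ha : 0 < a)
    {f : (ℝ ∙ e)ᗮ → ℝ≥0∞} (hf : Measurable f) :
    ∫⁻ z in {z | 0 < dep m e z ∧ dep m e z < a},
        f ((s / dep m e z) • (ℝ ∙ e)ᗮ.orthogonalProjectionOnto z) ∂(lam m) =
      ENNReal.ofReal ((a / s) ^ (Module.finrank ℝ E - 1) / (Module.finrank ℝ E - 1 : ℕ)) *
        ∫⁻ w, f w := by
  have hee : ⟪e, e⟫ = 1 := by rw [real_inner_self_eq_norm_sq, he, one_pow]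
  have he0 : e ≠ 0 := by rintro rfl; simp at he
  have hdm := measurable_dep (E := E) m e
  have hfin : Module.finrank ℝ (ℝ ∙ e)ᗮ = Module.finrank ℝ E - 1 := by
    have h1 := Submodule.finrank_add_finrank_orthogonal (ℝ ∙ e)
    rw [finrank_span_singleton he0] at h1
    omega
  set g : E → ℝ≥0∞ := fun y => ({y : E | ⟪y, e⟫ < a}).indicator (fun y =>
    f ((s / ⟪y, e⟫) • (ℝ ∙ e)ᗮ.orthogonalProjectionOnto y)) y with hg
  have hgm : Measurable g := by
    apply Measurable.indicator
    · apply hf.comp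
      fun_prop
    · exact measurableSet_lt (by fun_prop) measurable_const
  have hS : MeasurableSet {z | 0 < dep m e z ∧ dep m e z < a} :=
    (measurableSet_lt measurable_const hdm).inter (measurableSet_lt hdm measurable_const)
  have hproj : ∀ (z : E) (r : ℝ), (ℝ ∙ e)ᗮ.orthogonalProjectionOnto (z + r • e) =
      (ℝ ∙ e)ᗮ.orthogonalProjectionOnto z := by
    intro z r
    rw [map_add, map_smul, Submodule.orthogonalProjectionOnto_orthogonal_apply_eq_zero
      (Submodule.mem_span_singleton_self e), smul_zero, add_zero]
  have step1 : ∫⁻ z in {z | 0 < dep m e z ∧ dep m e z < a},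
        f ((s / dep m e z) • (ℝ ∙ e)ᗮ.orthogonalProjectionOnto z) ∂(lam m) =
      ∫⁻ z in {z | 0 < dep m e z},
        ENNReal.ofReal (hgt m z)⁻¹ * g (z + (hgt m z - 2 * ⟪z, e⟫) • e) := by
    rw [← lintegral_indicator hS, lintegral_lam m (by
        apply Measurable.indicator _ hS
        apply hf.comp
        fun_prop), ← lintegral_indicator (measurableSet_lt measurable_const hdm)]
    congr 1 with z
    have h1 : ⟪z + (hgt m z - 2 * ⟪z, e⟫) • e, e⟫ = dep m e z := by
      simp only [inner_add_left, real_inner_smul_left, hee, dep]; ring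
    by_cases h0 : 0 < dep m e z
    · by_cases h2 : dep m e z < a
      · simp [hg, indicator, h0, h2, h1, hproj]
      · simp [hg, indicator, h0, h2, h1]
    · simp [indicator, h0]
  have hgt : ∀ (t : ℝ) (b : (ℝ ∙ e)ᗮ), ⟪t • e + (b : E), e⟫ = t := by
    intro t b
    have := Submodule.mem_orthogonal_singleton_iff_inner_left.1 b.2
    rw [inner_add_left, real_inner_smul_left, hee, this]; ring
  have hpb : ∀ (t : ℝ) (b : (ℝ ∙ e)ᗮ), (ℝ ∙ e)ᗮ.orthogonalProjectionOnto (t • e + (b : E)) = b := by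
    intro t b
    rw [add_comm, hproj]
    exact Submodule.orthogonalProjectionOnto_mem_subspace_eq_self b
  have hHm : MeasurableSet {y : E | 0 < ⟪y, e⟫} := measurableSet_lt measurable_const (by fun_prop)
  have hgm' : Measurable fun y : E => ENNReal.ofReal ⟪y, e⟫⁻¹ * g y := by
    apply Measurable.mul _ hgm
    fun_prop
  rw [step1, lintegral_lam_lightCone hm he g, ← lintegral_indicator hHm,
    lintegral_span_orthogonal he (hgm'.indicator hHm)]
  -- On the slice at height t the rescaling w = (s/t) b costs (t/s)^(dim E - 1); with the density
  -- 1/t this leaves t^(dim E - 2), integrated over (0, a) afterwards.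
  have step2 : ∀ t : ℝ, ∫⁻ b : (ℝ ∙ e)ᗮ, ({y : E | 0 < ⟪y, e⟫}).indicator
      (fun y : E => ENNReal.ofReal ⟪y, e⟫⁻¹ * g y) (t • e + b) =
      (Ioo 0 a).indicator (fun t => ENNReal.ofReal (t ^ (Module.finrank ℝ E - 2)) *
        (ENNReal.ofReal (s⁻¹ ^ (Module.finrank ℝ E - 1)) * ∫⁻ w, f w)) t := by
    intro t
    by_cases ht : t ∈ Ioo 0 a
    · have : ∀ b : (ℝ ∙ e)ᗮ, ({y : E | 0 < ⟪y, e⟫}).indicator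
          (fun y : E => ENNReal.ofReal ⟪y, e⟫⁻¹ * g y) (t • e + b) =
          ENNReal.ofReal t⁻¹ * f ((s / t) • b) := by
        intro b
        simp [indicator, hg, hgt, ht.1, ht.2, hpb]
      have hst : 0 < s / t := div_pos hs ht.1
      rw [lintegral_congr this, lintegral_const_mul _ (show Measurable fun b => f ((s / t) • b) from
          hf.comp (measurable_const_smul _)),
        lintegral_comp_smul_pos hst hf, indicator_of_mem ht, hfin, ← mul_assoc, ← mul_assoc,
        ← ENNReal.ofReal_mul (inv_nonneg.2 ht.1.le),
        ← ENNReal.ofReal_mul (pow_nonneg ht.1.le _)]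
      congr 2
      obtain ⟨d, hd'⟩ : ∃ d, Module.finrank ℝ E = d + 2 := ⟨_, (Nat.sub_add_cancel hd).symm⟩
      have := ht.1.ne'
      rw [hd']
      simp only [Nat.add_sub_cancel, show d + 2 - 1 = d + 1 by omega, inv_div, div_pow, inv_pow]
      field_simp
      ring
    · rw [indicator_of_notMem ht]
      have : ∀ b : (ℝ ∙ e)ᗮ, ({y : E | 0 < ⟪y, e⟫}).indicator
          (fun y : E => ENNReal.ofReal ⟪y, e⟫⁻¹ * g y) (t • e + b) = 0 := by
        intro b
        rw [mem_Ioo, not_and] at ht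
        by_cases h0 : 0 < t
        · simp [indicator, hg, hgt, ht h0]
        · simp [indicator, hgt, h0]
      rw [lintegral_congr this, lintegral_zero]
  rw [lintegral_congr step2, lintegral_indicator measurableSet_Ioo,
    lintegral_mul_const _ (by fun_prop), setLIntegral_pow_Ioo _ ha.le, ← mul_assoc,
    ← ENNReal.ofReal_mul (by positivity)]
  congr 2
  obtain ⟨d, hd'⟩ : ∃ d, Module.finrank ℝ E = d + 2 := ⟨_, (Nat.sub_add_cancel hd).symm⟩
  rw [hd']
  simp only [Nat.add_sub_cancel, show d + 2 - 1 = d + 1 by omega, div_pow, inv_pow]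
  push_cast
  field_simp

/-- The integral over a tube around a subspace of a function of the Fermi coordinates. -/
lemma lintegral_lam_tube (K : Submodule ℝ E) [Nontrivial Kᗮ] (hd : 2 ≤ Module.finrank ℝ E)
    {f : K × Kᗮ → ℝ≥0∞} (hf : Measurable f) :
    ∫⁻ z in {z | 0 < ‖Kᗮ.orthogonalProjectionOnto z‖ ∧ ‖Kᗮ.orthogonalProjectionOnto z‖ < 1},
        f (‖Kᗮ.orthogonalProjectionOnto z‖⁻¹ • K.orthogonalProjectionOnto z,
          ‖Kᗮ.orthogonalProjectionOnto z‖⁻¹ • Kᗮ.orthogonalProjectionOnto z) ∂(lam 0) =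
      ENNReal.ofReal ((Module.finrank ℝ E - 1 : ℕ) : ℝ)⁻¹ *
        ∫⁻ ν, (∫⁻ y, f (y, ν) ∂(lam 1)) ∂(volume : Measure Kᗮ).toSphere := by
  set S := {z : E | 0 < ‖Kᗮ.orthogonalProjectionOnto z‖ ∧ ‖Kᗮ.orthogonalProjectionOnto z‖ < 1}
  have hnm : Measurable fun z : E => ‖Kᗮ.orthogonalProjectionOnto z‖ := by fun_prop
  have hS : MeasurableSet S :=
    (measurableSet_lt measurable_const hnm).inter (measurableSet_lt hnm measurable_const)
  have hF : Measurable (S.indicator fun z : E =>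
      f (‖Kᗮ.orthogonalProjectionOnto z‖⁻¹ • K.orthogonalProjectionOnto z,
          ‖Kᗮ.orthogonalProjectionOnto z‖⁻¹ • Kᗮ.orthogonalProjectionOnto z)) := by
    apply Measurable.indicator _ hS
    apply hf.comp
    fun_prop
  have hhm := measurable_hgt (E := E) 0
  have hdim := Submodule.finrank_add_finrank_orthogonal K
  have hpos : 0 < Module.finrank ℝ Kᗮ := Module.finrank_pos
  have hp1 : ∀ (a : K) (b : Kᗮ), K.orthogonalProjectionOnto ((a : E) + b) = a := by
    intro a b
    simp [K.orthogonalProjectionOnto_apply_of_mem_orthogonal b.2]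
  have hp2 : ∀ (a : K) (b : Kᗮ), Kᗮ.orthogonalProjectionOnto ((a : E) + b) = b := by
    intro a b
    simp [Submodule.orthogonalProjectionOnto_orthogonal_apply_eq_zero a.2]
  -- The light cone above a + b, rescaled by ‖b‖, is the hyperboloid above a/‖b‖: this is how `lam
  -- 0` produces `lam 1` on K.
  have hnorm : ∀ (a : K) (b : Kᗮ), 0 < ‖b‖ →
      hgt 0 ((a : E) + b) = ‖b‖ * hgt 1 (‖b‖⁻¹ • a) := by
    intro a b hb
    have h0 : ⟪(a : E), (b : E)⟫ = 0 := b.2 a a.2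
    rw [hgt, Real.sqrt_eq_iff_eq_sq (by positivity) (mul_nonneg hb.le (hgt_nonneg _ _)), mul_pow,
      hgt_sq zero_le_one, norm_add_sq_real, h0, norm_smul, mul_pow, norm_inv, norm_norm]
    simp only [Submodule.coe_norm] at hb ⊢
    field_simp
    ring
  set H : Kᗮ → ℝ≥0∞ := fun ν => ∫⁻ y, f (y, ν) ∂(lam 1) with hH
  have hlam : SFinite (lam 1 : Measure K) := by unfold lam; infer_instance
  have hHm : Measurable H := hf.lintegral_prod_left'
  have inner : ∀ b : Kᗮ, ∫⁻ a : K, ENNReal.ofReal (hgt 0 ((a : E) + b))⁻¹ * S.indicator (fun z : E =>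
      f (‖Kᗮ.orthogonalProjectionOnto z‖⁻¹ • K.orthogonalProjectionOnto z,
          ‖Kᗮ.orthogonalProjectionOnto z‖⁻¹ • Kᗮ.orthogonalProjectionOnto z)) ((a : E) + b) =
      ({b : Kᗮ | 0 < ‖b‖ ∧ ‖b‖ < 1}).indicator (fun b => ENNReal.ofReal (‖b‖ ^ Module.finrank ℝ K * ‖b‖⁻¹) *
        H (‖b‖⁻¹ • b)) b := by
    intro b
    by_cases hb : 0 < ‖b‖ ∧ ‖b‖ < 1
    · rw [indicator_of_mem (show b ∈ {b : Kᗮ | 0 < ‖b‖ ∧ ‖b‖ < 1} from hb)]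
      have hfm : Measurable fun y : K => f (y, ‖b‖⁻¹ • b) := hf.comp (by fun_prop)
      have e : ∀ a : K, ENNReal.ofReal (hgt 0 ((a : E) + b))⁻¹ * S.indicator (fun z : E =>
          f (‖Kᗮ.orthogonalProjectionOnto z‖⁻¹ • K.orthogonalProjectionOnto z,
          ‖Kᗮ.orthogonalProjectionOnto z‖⁻¹ • Kᗮ.orthogonalProjectionOnto z)) ((a : E) + b) =
          ENNReal.ofReal ‖b‖⁻¹ * (fun y : K => ENNReal.ofReal (hgt 1 y)⁻¹ * f (y, ‖b‖⁻¹ • b))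
            (‖b‖⁻¹ • a) := by
        intro a
        have hm : (a : E) + b ∈ S := by simpa only [S, mem_ofPred_eq, hp2] using hb
        rw [indicator_of_mem hm, hp1, hp2, hnorm a b hb.1, mul_inv,
          ENNReal.ofReal_mul (inv_nonneg.2 hb.1.le), mul_assoc]
      have hGm : Measurable fun y : K => ENNReal.ofReal (hgt 1 y)⁻¹ * f (y, ‖b‖⁻¹ • b) :=
        ((measurable_hgt 1).inv.ennreal_ofReal).mul hfm
      rw [lintegral_congr e, lintegral_const_mul _ (show Measurable fun a : K =>
          (fun y : K => ENNReal.ofReal (hgt 1 y)⁻¹ * f (y, ‖b‖⁻¹ • b)) (‖b‖⁻¹ • a) from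
          hGm.comp (measurable_const_smul _)),
        lintegral_comp_smul_pos (inv_pos.2 hb.1) hGm, ← lintegral_lam 1 hfm, ← mul_assoc,
        ← ENNReal.ofReal_mul (inv_nonneg.2 hb.1.le), inv_inv, mul_comm ‖b‖⁻¹]
    · rw [indicator_of_notMem (show b ∉ {b : Kᗮ | 0 < ‖b‖ ∧ ‖b‖ < 1} from hb)]
      have e : ∀ a : K, ENNReal.ofReal (hgt 0 ((a : E) + b))⁻¹ * S.indicator (fun z : E =>
          f (‖Kᗮ.orthogonalProjectionOnto z‖⁻¹ • K.orthogonalProjectionOnto z,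
          ‖Kᗮ.orthogonalProjectionOnto z‖⁻¹ • Kᗮ.orthogonalProjectionOnto z)) ((a : E) + b) = 0 := by
        intro a
        have hm : (a : E) + b ∉ S := by simpa only [S, mem_ofPred_eq, hp2] using hb
        rw [indicator_of_notMem hm, mul_zero]
      rw [lintegral_congr e, lintegral_zero]
  have hbS : MeasurableSet {b : Kᗮ | 0 < ‖b‖ ∧ ‖b‖ < 1} :=
    (measurableSet_lt measurable_const measurable_norm).inter
      (measurableSet_lt measurable_norm measurable_const)
  have hHm' : Measurable (({b : Kᗮ | 0 < ‖b‖ ∧ ‖b‖ < 1}).indicator (fun b =>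
      ENNReal.ofReal (‖b‖ ^ Module.finrank ℝ K * ‖b‖⁻¹) * H (‖b‖⁻¹ • b))) := by
    apply Measurable.indicator _ hbS
    apply Measurable.mul (by fun_prop)
    apply hHm.comp
    fun_prop
  have hGF : Measurable fun z : E => ENNReal.ofReal (hgt 0 z)⁻¹ * S.indicator (fun z : E =>
      f (‖Kᗮ.orthogonalProjectionOnto z‖⁻¹ • K.orthogonalProjectionOnto z,
          ‖Kᗮ.orthogonalProjectionOnto z‖⁻¹ • Kᗮ.orthogonalProjectionOnto z)) z :=
    hhm.inv.ennreal_ofReal.mul hF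
  rw [← lintegral_indicator hS, lintegral_lam 0 hF, lintegral_orthogonal K hGF]
  refine (lintegral_congr inner).trans ?_
  rw [lintegral_polar hHm']
  -- The polar factor r^(dim Kᗮ - 1), the scaling factor r^(dim K) and the density 1/r combine to
  -- r^(dim E - 2), whose integral over (0, 1) is 1/(dim E - 1) for every K.
  have radial : ∀ ν : Metric.sphere (0 : Kᗮ) 1, ∫⁻ r in Ioi (0 : ℝ),
      ENNReal.ofReal (r ^ (Module.finrank ℝ Kᗮ - 1)) * ({b : Kᗮ | 0 < ‖b‖ ∧ ‖b‖ < 1}).indicator (fun b =>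
      ENNReal.ofReal (‖b‖ ^ Module.finrank ℝ K * ‖b‖⁻¹) * H (‖b‖⁻¹ • b)) (r • (ν : Kᗮ)) =
      ENNReal.ofReal ((Module.finrank ℝ E - 1 : ℕ) : ℝ)⁻¹ * H ν := by
    intro ν
    have hν : ‖(ν : Kᗮ)‖ = 1 := mem_sphere_zero_iff_norm.1 ν.2
    have e : ∀ r ∈ Ioi (0 : ℝ), ENNReal.ofReal (r ^ (Module.finrank ℝ Kᗮ - 1)) *
        ({b : Kᗮ | 0 < ‖b‖ ∧ ‖b‖ < 1}).indicator (fun b =>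
        ENNReal.ofReal (‖b‖ ^ Module.finrank ℝ K * ‖b‖⁻¹) * H (‖b‖⁻¹ • b)) (r • (ν : Kᗮ)) =
        (Ioo (0 : ℝ) 1).indicator (fun r => ENNReal.ofReal (r ^ (Module.finrank ℝ E - 2)) * H ν) r := by
      intro r hr
      have hr0 : 0 < r := hr
      have hrn : ‖r • (ν : Kᗮ)‖ = r := by rw [norm_smul, hν, mul_one, Real.norm_of_nonneg hr0.le]
      by_cases h1 : r < 1
      · rw [indicator_of_mem (by rw [mem_ofPred_eq, hrn]; exact ⟨hr, h1⟩), indicator_of_mem (show r ∈ Ioo (0 : ℝ) 1 from ⟨hr, h1⟩),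
          hrn, smul_smul, inv_mul_cancel₀ hr0.ne', one_smul, ← mul_assoc,
          ← ENNReal.ofReal_mul (by positivity)]
        congr 2
        rw [← mul_assoc, ← pow_add, mul_inv_eq_iff_eq_mul₀ hr0.ne', ← pow_succ]
        congr 1
        omega
      · rw [indicator_of_notMem (by rw [mem_ofPred_eq, hrn]; exact fun h => h1 h.2),
          indicator_of_notMem (fun h => h1 h.2), mul_zero]
    rw [setLIntegral_congr_fun measurableSet_Ioi e, lintegral_indicator measurableSet_Ioo,
      Measure.restrict_restrict measurableSet_Ioo,
      inter_eq_left.2 (fun r hr => hr.1), lintegral_mul_const _ (by fun_prop),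
      setLIntegral_pow_Ioo _ zero_le_one]
    congr 2
    obtain ⟨d, hd'⟩ : ∃ d, Module.finrank ℝ E = d + 2 := ⟨_, (Nat.sub_add_cancel hd).symm⟩
    rw [hd']
    simp only [Nat.add_sub_cancel, show d + 2 - 1 = d + 1 by omega, one_pow]
    push_cast
    field_simp
  rw [lintegral_congr radial, lintegral_const_mul _ (show Measurable fun ν :
    Metric.sphere (0 : Kᗮ) 1 => H ν from hHm.comp measurable_subtype_coe)]

end Decomposition

/-! ### The metric topology agrees with the topology induced from Minkowski space. -/

section HypTopology

variable {n : ℕ}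

lemma continuous_mink : Continuous fun p : Mink n × Mink n => mink p.1 p.2 := by
  unfold mink; fun_prop

lemma Continuous.mink' {X : Type*} [TopologicalSpace X] {f g : X → Mink n} (hf : Continuous f)
    (hg : Continuous g) : Continuous fun x => mink (f x) (g x) :=
  continuous_mink.comp (hf.prodMk hg)

/-- Split y as c x + u with u tangent at x. As y tends to x, c = cosh d(x, y) tends to 1 and the
Minkowski square c² - 1 of u tends to 0. The form is positive definite on the tangent space, so u
tends to 0 in the Euclidean sense. -/
lemma continuous_pt : Continuous (Hyp.pt : Hyp n → Mink n) := by
  rw [continuous_iff_continuousAt]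
  intro x
  set c : Hyp n → ℝ := fun y => -mink x.pt y.pt with hc
  have hcd : ∀ y, c y = Real.cosh (dist x y) := fun y => (cosh_dist x y).symm
  have hct : Tendsto c (𝓝 x) (𝓝 1) := by
    have : Continuous fun y : Hyp n => Real.cosh (dist x y) := by
      exact Real.continuous_cosh.comp (continuous_const.dist continuous_id)
    have h := this.tendsto x
    rw [dist_self, Real.cosh_zero] at h
    exact h.congr fun y => (hcd y).symm
  set u : Hyp n → Mink n := fun y => y.pt + (-(c y)) • x.pt with hu
  have hux : ∀ y, mink x.pt (u y) = 0 := by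
    intro y
    simp only [hu, hc, mink_add_right, mink_smul_right, x.mink_pt]; ring
  have huu : ∀ y, mink (u y) (u y) = c y ^ 2 - 1 := by
    intro y
    have : mink y.pt x.pt = mink x.pt y.pt := mink_comm _ _
    simp only [hu, hc, mink_add_right, mink_smul_right, mink_add_left, mink_smul_left, x.mink_pt,
      y.mink_pt, this]; ring
  have hlim : Tendsto (fun y => x.pt.1 ^ 2 * (c y ^ 2 - 1)) (𝓝 x) (𝓝 0) := by
    have := (((hct.pow 2).sub_const 1).const_mul (x.pt.1 ^ 2))
    simpa using this
  have h2 : Tendsto (fun y => ‖(u y).2‖ ^ 2) (𝓝 x) (𝓝 0) :=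
    squeeze_zero (fun y => sq_nonneg _) (fun y => by
      have := norm_sq_le_of_mink_eq_zero x (hux y)
      rwa [huu] at this) hlim
  have h2' : Tendsto (fun y => (u y).2) (𝓝 x) (𝓝 0) := by
    rw [tendsto_zero_iff_norm_tendsto_zero]
    have := h2.sqrt
    simpa using this
  have h1 : Tendsto (fun y => (u y).1 ^ 2) (𝓝 x) (𝓝 0) := by
    have h3 : Tendsto (fun y => ‖(u y).2‖ ^ 2 - (c y ^ 2 - 1)) (𝓝 x) (𝓝 0) := by
      have := h2.sub ((hct.pow 2).sub_const 1)
      simpa using this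
    refine h3.congr fun y => ?_
    rw [← huu, mink_self]; ring
  have h1' : Tendsto (fun y => (u y).1) (𝓝 x) (𝓝 0) := by
    rw [tendsto_zero_iff_norm_tendsto_zero]
    have := h1.sqrt
    simpa [Real.sqrt_sq_eq_abs] using this
  have hut : Tendsto u (𝓝 x) (𝓝 0) := by
    rw [Prod.zero_eq_mk, nhds_prod_eq]
    exact h1'.prodMk h2'
  have : Tendsto (fun y => u y + c y • x.pt) (𝓝 x) (𝓝 (0 + (1 : ℝ) • x.pt)) :=
    hut.add (hct.smul_const x.pt)
  rw [zero_add, one_smul] at this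
  refine this.congr fun y => ?_
  simp [hu]

lemma continuous_hyp_iff {X : Type*} [TopologicalSpace X] {f : X → Hyp n} :
    Continuous f ↔ Continuous fun x => (f x).pt := by
  refine ⟨fun h => continuous_pt.comp h, fun h => ?_⟩
  rw [continuous_iff_continuousAt]
  intro x
  rw [ContinuousAt, tendsto_iff_dist_tendsto_zero]
  have h1 : Continuous fun y => -mink (f y).pt (f x).pt := (Continuous.mink' h continuous_const).neg
  have h2 : Continuous fun y => Real.arcosh (-mink (f y).pt (f x).pt) :=
    Real.continuousOn_arcosh.comp_continuous h1 fun y => one_le_neg_mink _ _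
  have := h2.tendsto x
  rwa [← dist_def, dist_self] at this

lemma isEmbedding_pt : IsEmbedding (Hyp.pt : Hyp n → Mink n) := by
  refine ⟨⟨?_⟩, fun x y h => Hyp.ext h⟩
  refine le_antisymm continuous_pt.le_induced ?_
  rw [← continuous_id_iff_le]
  exact (@continuous_hyp_iff n _ (TopologicalSpace.induced Hyp.pt inferInstance) id).2
    (@continuous_induced_dom _ _ Hyp.pt _)

instance : SecondCountableTopology (Hyp n) := isEmbedding_pt.secondCountableTopology

lemma isEmbedding_base_dir : IsEmbedding fun v : T1 n => (v.base, v.dir) :=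
  ⟨⟨rfl⟩, fun _ _ h => T1.ext (Prod.ext_iff.1 h).1 (Prod.ext_iff.1 h).2⟩

instance : SecondCountableTopology (T1 n) := isEmbedding_base_dir.secondCountableTopology

lemma continuous_base : Continuous (T1.base : T1 n → Hyp n) :=
  continuous_fst.comp isEmbedding_base_dir.continuous

lemma continuous_dir : Continuous (T1.dir : T1 n → Mink n) :=
  continuous_snd.comp isEmbedding_base_dir.continuous

lemma continuous_T1_iff {X : Type*} [TopologicalSpace X] {f : X → T1 n} :
    Continuous f ↔ Continuous (fun x => (f x).base) ∧ Continuous (fun x => (f x).dir) := by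
  rw [isEmbedding_base_dir.continuous_iff]
  exact continuous_prodMk

lemma isClosed_orth_unit : IsClosed {p : Hyp n × Mink n | mink p.1.pt p.2 = 0 ∧ mink p.2 p.2 = 1} := by
  refine IsClosed.inter (isClosed_eq (Continuous.mink' (continuous_pt.comp continuous_fst)
    continuous_snd) continuous_const) (isClosed_eq (Continuous.mink' continuous_snd
    continuous_snd) continuous_const)

lemma range_base_dir : range (fun v : T1 n => (v.base, v.dir)) =
    {p : Hyp n × Mink n | mink p.1.pt p.2 = 0 ∧ mink p.2 p.2 = 1} := by
  ext p
  exact ⟨fun ⟨v, hv⟩ => hv ▸ ⟨v.orth, v.unit⟩, fun h => ⟨⟨p.1, p.2, h.1, h.2⟩, rfl⟩⟩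

lemma measurableEmbedding_base_dir : MeasurableEmbedding fun v : T1 n => (v.base, v.dir) :=
  isEmbedding_base_dir.measurableEmbedding (by
    rw [range_base_dir]; exact isClosed_orth_unit.measurableSet)

/-- The unit tangent vector at `x` with underlying vector `u`, if `u` is a unit vector
orthogonal to `x` (and `v₀` otherwise). -/
def mkT1 (v₀ : T1 n) (p : Hyp n × Mink n) : T1 n :=
  open scoped Classical in
  if h : mink p.1.pt p.2 = 0 ∧ mink p.2 p.2 = 1 then ⟨p.1, p.2, h.1, h.2⟩ else v₀

lemma mkT1_of (v₀ : T1 n) {x : Hyp n} {u : Mink n} (h : mink x.pt u = 0) (h' : mink u u = 1) :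
    mkT1 v₀ (x, u) = ⟨x, u, h, h'⟩ := dif_pos ⟨h, h'⟩

/-- The unit tangent bundle is a closed subset of the product, so the map is defined piecewise on a
measurable set and its complement. -/
lemma measurable_mkT1 (v₀ : T1 n) : Measurable (mkT1 v₀) := by
  intro B hB
  have h : mkT1 v₀ ⁻¹' B = (fun v : T1 n => (v.base, v.dir)) '' B ∪
      {p : Hyp n × Mink n | mink p.1.pt p.2 = 0 ∧ mink p.2 p.2 = 1}ᶜ ∩ {p | v₀ ∈ B} := by
    ext p
    by_cases hp : mink p.1.pt p.2 = 0 ∧ mink p.2 p.2 = 1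
    · have : mkT1 v₀ p = ⟨p.1, p.2, hp.1, hp.2⟩ := dif_pos hp
      simp only [mem_preimage, this, mem_union, mem_inter_iff, mem_compl_iff, mem_ofPred_eq, hp,
        and_self, not_true, false_and, or_false, mem_image]
      constructor
      · intro h; exact ⟨_, h, rfl⟩
      · rintro ⟨v, hv, rfl⟩; exact hv
    · have : mkT1 v₀ p = v₀ := dif_neg hp
      simp only [mem_preimage, this, mem_union, mem_inter_iff, mem_compl_iff, mem_ofPred_eq, hp,
        not_false_eq_true, true_and, mem_image]
      constructor
      · intro h; exact Or.inr h
      · rintro (⟨v, hv, rfl⟩ | h)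
        · exact absurd ⟨v.orth, v.unit⟩ hp
        · exact h
  rw [h]
  exact (measurableEmbedding_base_dir.measurableSet_image.2 hB).union
    (isClosed_orth_unit.measurableSet.compl.inter (MeasurableSet.const _))

end HypTopology

/-! ### Action of isometries on tangent vectors, geodesics and the boundary. -/

section LorentzAction

variable {n : ℕ}

lemma smul_pt (A : Lorentz n) (x : Hyp n) : (A • x).pt = A.1 x.pt := rfl
lemma smul_base (A : Lorentz n) (v : T1 n) : (A • v).base = A • v.base := rfl
lemma smul_dir (A : Lorentz n) (v : T1 n) : (A • v).dir = A.1 v.dir := rfl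

lemma Lorentz.continuous_coe (A : Lorentz n) : Continuous (A.1 : Mink n → Mink n) :=
  A.1.toLinearMap.continuous_of_finiteDimensional

instance : ContinuousConstSMul (Lorentz n) (T1 n) where
  continuous_const_smul A := by
    rw [continuous_T1_iff]
    exact ⟨(continuous_const_smul A).comp continuous_base,
      (Lorentz.continuous_coe A).comp continuous_dir⟩

/-- The vector `(1, 0)` gives the height of a vector. -/
lemma mink_origin (x : Mink n) : mink x (origin n).pt = -x.1 := by
  simp [mink, origin]

/-- The vector `x + u` for a unit tangent vector `v = (x, u)` has positive height. -/
lemma fst_add_pos (v : T1 n) : 0 < v.base.pt.1 + v.dir.1 := by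
  have := neg_lt_of_abs_lt (abs_fst_lt v.base v.orth v.unit)
  linarith

lemma smul_lightVec_endpoint (v : T1 n) :
    (v.base.pt.1 + v.dir.1) • lightVec v.endpoint = v.base.pt + v.dir := by
  have h := (fst_add_pos v).ne'
  refine Prod.ext ?_ ?_
  · simp [lightVec]
  · simp [lightVec, T1.endpoint, smul_smul, h]

/-- The image of a light vector has positive height. -/
lemma Lorentz.fst_lightVec_pos (A : Lorentz n) (ξ : Bdry n) : 0 < (A.1 (lightVec ξ)).1 := by
  have h : mink (A • (A⁻¹ • origin n)).pt (A.1 (lightVec ξ)) < 0 := by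
    rw [smul_pt, Lorentz.mink_map A]; exact mink_lightVec_neg _ _
  rw [smul_inv_smul, mink_comm, mink_origin] at h
  linarith

/-- An isotropic vector of positive height is a multiple of a light vector. -/
lemma exists_lightVec {u : Mink n} (h : mink u u = 0) (h0 : 0 < u.1) :
    ∃ ξ : Bdry n, u = u.1 • lightVec ξ := by
  rw [mink_self] at h
  have h1 : ‖u.2‖ = u.1 := by
    rw [← sq_eq_sq₀ (norm_nonneg _) h0.le]; linarith
  refine ⟨⟨u.1⁻¹ • u.2, ?_⟩, ?_⟩
  · rw [mem_sphere_zero_iff_norm, norm_smul, h1, Real.norm_of_nonneg (inv_nonneg.2 h0.le),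
      inv_mul_cancel₀ h0.ne']
  · refine Prod.ext ?_ ?_ <;> simp [lightVec, smul_smul, h0.ne']

lemma lightVec_injective : Function.Injective (lightVec : Bdry n → Mink n) := fun _ _ h =>
  Subtype.ext (congrArg Prod.snd h)

lemma eq_of_smul_lightVec {a b : ℝ} {ξ η : Bdry n} (ha : a ≠ 0)
    (h : a • lightVec ξ = b • lightVec η) : ξ = η := by
  have h1 : a = b := by simpa [lightVec] using congrArg Prod.fst h
  rw [← h1] at h
  exact lightVec_injective (smul_right_injective _ ha h)

/-- The action of an isometry on the boundary at infinity. -/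
def bdAct (A : Lorentz n) (ξ : Bdry n) : Bdry n :=
  (exists_lightVec (u := A.1 (lightVec ξ)) (by rw [Lorentz.mink_map A, mink_lightVec_self])
    (Lorentz.fst_lightVec_pos A ξ)).choose

lemma smul_lightVec_bdAct (A : Lorentz n) (ξ : Bdry n) :
    (A.1 (lightVec ξ)).1 • lightVec (bdAct A ξ) = A.1 (lightVec ξ) :=
  (exists_lightVec (u := A.1 (lightVec ξ)) (by rw [Lorentz.mink_map A, mink_lightVec_self])
    (Lorentz.fst_lightVec_pos A ξ)).choose_spec.symm

lemma eq_bdAct {A : Lorentz n} {ξ η : Bdry n} {c : ℝ} (hc : c ≠ 0)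
    (h : A.1 (lightVec ξ) = c • lightVec η) : η = bdAct A ξ := by
  rw [← smul_lightVec_bdAct] at h
  exact eq_of_smul_lightVec hc h.symm

lemma endpoint_smul (A : Lorentz n) (v : T1 n) : (A • v).endpoint = bdAct A v.endpoint := by
  have h1 := smul_lightVec_endpoint v
  have h2 := smul_lightVec_endpoint (A • v)
  rw [smul_base, smul_dir, smul_pt, ← map_add, ← h1, map_smul, ← smul_lightVec_bdAct, smul_smul] at h2
  exact eq_of_smul_lightVec (by
    have := (fst_add_pos (A • v)).ne'
    rwa [smul_base, smul_dir, smul_pt] at this) h2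

lemma bdAct_mul (A B : Lorentz n) (ξ : Bdry n) : bdAct (A * B) ξ = bdAct A (bdAct B ξ) := by
  symm
  apply eq_bdAct (c := (B.1 (lightVec ξ)).1 * (A.1 (lightVec (bdAct B ξ))).1)
    (mul_ne_zero (Lorentz.fst_lightVec_pos B _).ne' (Lorentz.fst_lightVec_pos A _).ne')
  rw [mul_smul, smul_lightVec_bdAct, ← map_smul, smul_lightVec_bdAct]
  rfl

lemma bdAct_one (ξ : Bdry n) : bdAct 1 ξ = ξ :=
  (eq_bdAct (A := 1) one_ne_zero (by rw [one_smul]; rfl)).symm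

lemma bdAct_inv_bdAct (A : Lorentz n) (ξ : Bdry n) : bdAct A⁻¹ (bdAct A ξ) = ξ := by
  rw [← bdAct_mul, inv_mul_cancel, bdAct_one]

lemma bdAct_bdAct_inv (A : Lorentz n) (ξ : Bdry n) : bdAct A (bdAct A⁻¹ ξ) = ξ := by
  rw [← bdAct_mul, mul_inv_cancel, bdAct_one]

lemma smul_line (A : Lorentz n) (v : T1 n) (t : ℝ) : (A • v).line t = A • v.line t := by
  apply Hyp.ext
  change Real.cosh t • A.1 v.base.pt + Real.sinh t • A.1 v.dir =
    A.1 (Real.cosh t • v.base.pt + Real.sinh t • v.dir)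
  rw [map_add, map_smul, map_smul]

lemma smul_toward (A : Lorentz n) (x : Hyp n) (ξ : Bdry n) :
    A • toward x ξ = toward (A • x) (bdAct A ξ) := by
  have hl := smul_lightVec_bdAct A ξ
  have hp := (Lorentz.fst_lightVec_pos A ξ).ne'
  refine T1.ext rfl ?_
  change A.1 ((-mink x.pt (lightVec ξ))⁻¹ • lightVec ξ + (-1 : ℝ) • x.pt) =
    (-mink (A.1 x.pt) (lightVec (bdAct A ξ)))⁻¹ • lightVec (bdAct A ξ) + (-1 : ℝ) • A.1 x.pt
  have h2 : mink x.pt (lightVec ξ) = (A.1 (lightVec ξ)).1 * mink (A.1 x.pt) (lightVec (bdAct A ξ)) := by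
    rw [← Lorentz.mink_map A, ← mink_smul_right, hl]
  rw [map_add, map_smul, map_smul, h2]
  nth_rw 2 [← hl]
  rw [smul_smul]
  congr 2
  rw [← mul_neg, mul_inv, mul_comm, ← mul_assoc, mul_inv_cancel₀ hp, one_mul]

/-- A unit tangent vector points towards its endpoint. -/
lemma toward_base_endpoint (v : T1 n) : toward v.base v.endpoint = v := by
  have h1 := smul_lightVec_endpoint v
  have h0 := (fst_add_pos v).ne'
  have h2 : (v.base.pt.1 + v.dir.1) * mink v.base.pt (lightVec v.endpoint) = -1 := by
    rw [← mink_smul_right, h1, mink_add_right, v.orth, v.base.mink_pt, add_zero]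
  have h3 : (-mink v.base.pt (lightVec v.endpoint))⁻¹ = v.base.pt.1 + v.dir.1 :=
    inv_eq_of_mul_eq_one_left (by linarith)
  refine T1.ext rfl ?_
  change (-mink v.base.pt (lightVec v.endpoint))⁻¹ • lightVec v.endpoint + (-1 : ℝ) • v.base.pt = _
  rw [h3, h1]
  simp

/-- In terms of the isotropic vector instead of the direction, the heights along a geodesic ray can
be read off by linearity. -/
lemma toward_line_pt (x : Hyp n) (ξ : Bdry n) (t : ℝ) : ((toward x ξ).line t).pt =
    Real.exp (-t) • x.pt + (Real.sinh t * (-mink x.pt (lightVec ξ))⁻¹) • lightVec ξ := by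
  change Real.cosh t • x.pt + Real.sinh t • ((-mink x.pt (lightVec ξ))⁻¹ • lightVec ξ +
    (-1 : ℝ) • x.pt) = _
  rw [← Real.cosh_sub_sinh]
  module

end LorentzAction

/-! ### Busemann functions as logarithms of heights; closest points and equivariance. -/

section Busemann

variable {n : ℕ}

/-- The height of `x` seen from `ξ`: the exponential of the Busemann function normalised at the
origin. -/
def hor (ξ : Bdry n) (x : Hyp n) : ℝ := -mink x.pt (lightVec ξ)

lemma hor_pos (ξ : Bdry n) (x : Hyp n) : 0 < hor ξ x := by
  have := mink_lightVec_neg x ξ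
  unfold hor; linarith

lemma hor_origin (ξ : Bdry n) : hor ξ (origin n) = 1 := by
  rw [hor, mink_comm, mink_origin, neg_neg]; rfl

/-- The factor depends on ξ but not on x, so isometries preserve comparisons of heights and hence
closest points. -/
lemma hor_smul (A : Lorentz n) (ξ : Bdry n) (x : Hyp n) :
    (A.1 (lightVec ξ)).1 * hor (bdAct A ξ) (A • x) = hor ξ x := by
  rw [hor, hor, mul_neg, ← mink_smul_right, smul_lightVec_bdAct, smul_pt, Lorentz.mink_map]

/-- Along the ray, cosh of the distance to x is e^(-t) a + N sinh t, asymptotic to N e^t / 2.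
Writing arcosh c = log (c + √(c² - 1)) and putting e^(-t) inside the logarithm gives the limit log
N. -/
lemma tendsto_dist_line_sub (ξ : Bdry n) (x : Hyp n) :
    Tendsto (fun t : ℝ => dist ((toward (origin n) ξ).line t) x - t) atTop
      (𝓝 (Real.log (hor ξ x))) := by
  set a := -mink (origin n).pt x.pt with ha
  set N := hor ξ x with hN
  have hNpos : 0 < N := hor_pos ξ x
  have hm : ∀ t, -mink ((toward (origin n) ξ).line t).pt x.pt =
      Real.exp (-t) * a + Real.sinh t * N := by
    intro t
    have h1 : -mink (origin n).pt (lightVec ξ) = 1 := hor_origin ξ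
    have h2 : mink (lightVec ξ) x.pt = -N := by rw [mink_comm, hN, hor, neg_neg]
    rw [toward_line_pt, mink_add_left, mink_smul_left, mink_smul_left, h1, h2, ha]
    ring
  set c : ℝ → ℝ := fun t => Real.exp (-t) * a + Real.sinh t * N with hc
  have hexp : Tendsto (fun t : ℝ => Real.exp (-t)) atTop (𝓝 0) := Real.tendsto_exp_neg_atTop_nhds_zero
  have h1 : Tendsto (fun t => Real.exp (-t) * c t) atTop (𝓝 (N / 2)) := by
    have : ∀ t, Real.exp (-t) * c t = Real.exp (-t) ^ 2 * a + (1 - Real.exp (-t) ^ 2) / 2 * N := by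
      intro t
      have : Real.exp (-t) * Real.exp t = 1 := by rw [← Real.exp_add]; simp
      simp only [hc, Real.sinh_eq]
      linear_combination (N / 2) * this
    simp_rw [this]
    have h2 := ((hexp.pow 2).mul_const a).add
      ((((hexp.pow 2).const_sub 1).div_const 2).mul_const N)
    convert h2 using 2
    ring
  have h2 : Tendsto (fun t => Real.exp (-t) * c t + √((Real.exp (-t) * c t) ^ 2 - Real.exp (-t) ^ 2))
      atTop (𝓝 N) := by
    have h3 := h1.add ((h1.pow 2).sub (hexp.pow 2)).sqrt
    convert h3 using 2
    have : (N / 2) ^ 2 - 0 ^ 2 = (N / 2) ^ 2 := by ring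
    rw [this, Real.sqrt_sq (by positivity)]; ring
  have h3 := h2.log hNpos.ne'
  refine h3.congr fun t => ?_
  rw [dist_def, hm t, Real.arcosh]
  change _ = Real.log (c t + √(c t ^ 2 - 1)) - t
  have hct : 1 ≤ c t := by
    have := one_le_neg_mink ((toward (origin n) ξ).line t) x
    rwa [hm t] at this
  have e : Real.exp (-t) * c t + √((Real.exp (-t) * c t) ^ 2 - Real.exp (-t) ^ 2) =
      Real.exp (-t) * (c t + √(c t ^ 2 - 1)) := by
    have : (Real.exp (-t) * c t) ^ 2 - Real.exp (-t) ^ 2 = Real.exp (-t) ^ 2 * (c t ^ 2 - 1) := by ring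
    rw [this, Real.sqrt_mul (sq_nonneg _), Real.sqrt_sq (Real.exp_pos _).le]; ring
  rw [e, Real.log_mul (Real.exp_ne_zero _) (by
    have := Real.sqrt_nonneg (c t ^ 2 - 1)
    linarith), Real.log_exp]
  ring

lemma busemann_eq (ξ : Bdry n) (x y : Hyp n) :
    busemann ξ x y = Real.log (hor ξ x) - Real.log (hor ξ y) := by
  have h := (tendsto_dist_line_sub ξ x).sub (tendsto_dist_line_sub ξ y)
  refine Tendsto.limUnder_eq (h.congr fun t => ?_)
  ring

lemma busemann_origin (ξ : Bdry n) (x : Hyp n) : busemann ξ x (origin n) = Real.log (hor ξ x) := by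
  rw [busemann_eq, hor_origin, Real.log_one, sub_zero]

lemma busemann_origin_le_iff (ξ : Bdry n) (x y : Hyp n) :
    busemann ξ x (origin n) ≤ busemann ξ y (origin n) ↔ hor ξ x ≤ hor ξ y := by
  rw [busemann_origin, busemann_origin, Real.log_le_log_iff (hor_pos ξ x) (hor_pos ξ y)]

/-- `p` is the only point of `C` closest to `ξ`. -/
def IsClosest (C : Set (Hyp n)) (ξ : Bdry n) (p : Hyp n) : Prop :=
  p ∈ C ∧ ∀ y ∈ C, y ≠ p → hor ξ p < hor ξ y

/-- `proj` is an arbitrary choice among minimisers; strict minimality leaves only one candidate. -/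
lemma IsClosest.proj_eq {C : Set (Hyp n)} {ξ : Bdry n} {p : Hyp n} (h : IsClosest C ξ p) :
    proj C ξ = p := by
  have hex : ∃ x, x ∈ C ∧ ∀ y ∈ C, busemann ξ x (origin n) ≤ busemann ξ y (origin n) := by
    refine ⟨p, h.1, fun y hy => ?_⟩
    rw [busemann_origin_le_iff]
    by_cases hyp : y = p
    · rw [hyp]
    · exact (h.2 y hy hyp).le
  obtain ⟨h1, h2⟩ := Classical.epsilon_spec hex
  by_contra hne
  have h3 := (busemann_origin_le_iff _ _ _).1 (h2 p h.1)
  exact absurd (h.2 _ h1 hne) (not_lt.2 h3)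

lemma IsClosest.smul {C : Set (Hyp n)} {ξ : Bdry n} {p : Hyp n} (h : IsClosest C ξ p)
    (A : Lorentz n) : IsClosest (A • C) (bdAct A ξ) (A • p) := by
  refine ⟨smul_mem_smul_set h.1, ?_⟩
  rintro _ ⟨y, hy, rfl⟩ hne
  have hlt := h.2 y hy fun h' => hne (congrArg (A • ·) h')
  rw [← hor_smul A ξ p, ← hor_smul A ξ y] at hlt
  exact lt_of_mul_lt_mul_left hlt (Lorentz.fst_lightVec_pos A ξ).le

/-- Each point at infinity not in `infinityOf C` has exactly one closest point in `C`. -/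
def HasClosest (C : Set (Hyp n)) : Prop := ∀ ξ ∉ infinityOf C, ∃ p, IsClosest C ξ p

lemma bdAct_mem_infinityOf {A : Lorentz n} {C : Set (Hyp n)} {ξ : Bdry n} :
    bdAct A ξ ∈ infinityOf (A • C) ↔ ξ ∈ infinityOf C := by
  have key : ∀ (A : Lorentz n) (C : Set (Hyp n)) (ξ : Bdry n), ξ ∈ infinityOf C →
      bdAct A ξ ∈ infinityOf (A • C) := by
    rintro A C ξ ⟨v, hv, rfl⟩
    refine ⟨A • v, fun t ht => ?_, endpoint_smul A v⟩
    rw [smul_line]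
    exact smul_mem_smul_set (hv t ht)
  refine ⟨fun h => ?_, key A C ξ⟩
  have := key A⁻¹ _ _ h
  rwa [bdAct_inv_bdAct, inv_smul_smul] at this

lemma HasClosest.smul {C : Set (Hyp n)} (h : HasClosest C) (A : Lorentz n) :
    HasClosest (A • C) := by
  intro ξ hξ
  rw [← bdAct_bdAct_inv A ξ, bdAct_mem_infinityOf] at hξ
  obtain ⟨p, hp⟩ := h _ hξ
  have := hp.smul A
  rw [bdAct_bdAct_inv] at this
  exact ⟨_, this⟩

lemma HasClosest.proj_smul {C : Set (Hyp n)} (h : HasClosest C) (A : Lorentz n) {ξ : Bdry n}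
    (hξ : ξ ∉ infinityOf C) : proj (A • C) (bdAct A ξ) = A • proj C ξ := by
  obtain ⟨p, hp⟩ := h ξ hξ
  rw [hp.proj_eq, (hp.smul A).proj_eq]

lemma frontier_smul_set (A : Lorentz n) (C : Set (Hyp n)) : frontier (A • C) = A • frontier C :=
  ((Homeomorph.smul A).image_frontier C).symm

/-- Uniqueness of closest points is what makes the choice in `proj`, and so the normal bundle,
equivariant. -/
lemma HasClosest.smul_mem_outerNormal {C : Set (Hyp n)} (h : HasClosest C) (A : Lorentz n)
    (v : T1 n) : A • v ∈ outerNormal (A • C) ↔ v ∈ outerNormal C := by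
  simp only [outerNormal, mem_ofPred_eq, endpoint_smul, smul_base, frontier_smul_set,
    smul_mem_smul_set_iff, bdAct_mem_infinityOf]
  refine and_congr_right fun _ => and_congr_right fun h2 => ?_
  rw [h.proj_smul A h2]
  exact (MulAction.injective A).eq_iff

end Busemann

/-! ### Geodesic symmetries exchanging the origin with a given point. -/

section Symmetry

variable {n : ℕ}

/-- The geodesic symmetry at the midpoint of the origin and `p`. -/
def symFun (p : Hyp n) (x : Mink n) : Mink n :=
  (2 * mink x (p.pt + (origin n).pt) / mink (p.pt + (origin n).pt) (p.pt + (origin n).pt)) •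
    (p.pt + (origin n).pt) + (-1 : ℝ) • x

lemma mink_symCenter (p : Hyp n) : mink (p.pt + (origin n).pt) (p.pt + (origin n).pt) =
    -2 * (1 + p.pt.1) := by
  have h : mink (origin n).pt p.pt = -p.pt.1 := by rw [mink_comm, mink_origin]
  rw [mink_add_right, mink_origin, mink_add_left, p.mink_pt, h, Prod.fst_add]
  simp only [origin]
  ring

lemma mink_symFun (p : Hyp n) (x y : Mink n) : mink (symFun p x) (symFun p y) = mink x y := by
  have h := mink_symCenter p
  have hp := p.pos
  have hne : mink (p.pt + (origin n).pt) (p.pt + (origin n).pt) ≠ 0 := by rw [h]; nlinarith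
  unfold symFun
  set e := p.pt + (origin n).pt
  have hc : mink e y = mink y e := mink_comm _ _
  simp only [mink_add_left, mink_add_right, mink_smul_left, mink_smul_right, hc]
  field_simp
  ring

lemma symFun_symFun (p : Hyp n) (x : Mink n) : symFun p (symFun p x) = x := by
  have h := mink_symCenter p
  have hp := p.pos
  have hne : mink (p.pt + (origin n).pt) (p.pt + (origin n).pt) ≠ 0 := by rw [h]; nlinarith
  unfold symFun
  set e := p.pt + (origin n).pt
  have : 2 * mink ((2 * mink x e / mink e e) • e + (-1 : ℝ) • x) e / mink e e =
      2 * mink x e / mink e e := by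
    simp only [mink_add_left, mink_smul_left]
    field_simp
    ring
  rw [this]
  module

/-- The geodesic symmetry at the midpoint of the origin and `p`, as a linear automorphism. -/
def symEquiv (p : Hyp n) : Mink n ≃ₗ[ℝ] Mink n where
  toFun := symFun p
  invFun := symFun p
  map_add' x y := by
    simp only [symFun, mink_add_left, mul_add, add_div, add_smul, smul_add]; abel
  map_smul' c x := by
    have h : ∀ a b : ℝ, 2 * (c * a) / b = c * (2 * a / b) := fun a b => by ring
    simp only [symFun, mink_smul_left, RingHom.id_apply, smul_add, smul_smul, h, mul_comm (-1) c]
  left_inv := symFun_symFun p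
  right_inv := symFun_symFun p

lemma symFun_pt_fst (p x : Hyp n) : (symFun p x.pt).1 = -mink p.pt x.pt := by
  have hp := p.pos
  have h2 : 1 + p.pt.1 ≠ 0 := by linarith
  rw [symFun, mink_symCenter, mink_add_right, mink_origin, mink_comm x.pt]
  simp only [Prod.fst_add, Prod.smul_fst, smul_eq_mul, origin]
  field_simp
  ring

/-- The geodesic symmetry at the midpoint of the origin and `p`, as an isometry. -/
def symLor (p : Hyp n) : Lorentz n :=
  ⟨symEquiv p, mink_symFun p, fun x => by
    change 0 < (symFun p x.pt).1
    rw [symFun_pt_fst]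
    linarith [one_le_neg_mink p x]⟩

lemma symLor_apply (p : Hyp n) (x : Mink n) : (symLor p).1 x = symFun p x := rfl

lemma symLor_inv (p : Hyp n) : (symLor p)⁻¹ = symLor p := by
  apply inv_eq_of_mul_eq_one_right
  apply Subtype.ext
  apply LinearEquiv.ext
  intro x
  exact symFun_symFun p x

lemma symLor_origin (p : Hyp n) : symLor p • origin n = p := by
  apply Hyp.ext
  rw [smul_pt, symLor_apply, symFun, mink_symCenter, mink_comm, mink_add_left, mink_origin,
    (origin n).mink_pt]
  have hp := p.pos
  have h2 : 1 + p.pt.1 ≠ 0 := by linarith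
  have : 2 * (-p.pt.1 + -1) / (-2 * (1 + p.pt.1)) = 1 := by
    field_simp
    ring
  rw [this]
  module

/-- The link between the isometry and `symMap`: one formula serves both the hyperboloid and the
light cone. -/
lemma symLor_hgt_snd (p : Hyp n) (m : ℝ) (z : EuclideanSpace ℝ (Fin n)) :
    ((symLor p).1 (hgt m z, z)).2 = symMap m p.pt.1 p.pt.2 z := by
  have hp := p.pos
  have h2 : 1 + p.pt.1 ≠ 0 := by linarith
  rw [symLor_apply, symFun, mink_symCenter]
  simp only [Prod.snd_add, Prod.smul_snd, origin, add_zero, symMap, neg_add, neg_smul,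
    one_smul]
  rw [add_comm, ← neg_smul]
  congr 2
  simp only [mink, Prod.snd_add, Prod.fst_add, add_zero]
  field_simp
  ring

end Symmetry

/-! ### The skinning measure as an image of the invariant measure of the light cone. -/

section ProjData

variable {n : ℕ}

/-- Homogeneous extensions to `ℝⁿ` of the lift `P` of the closest point map to `C` and of the height
`N` of the closest points. -/
structure IsProjData (C : Set (Hyp n)) (P : EuclideanSpace ℝ (Fin n) → T1 n)
    (N : EuclideanSpace ℝ (Fin n) → ℝ) : Prop where
  measurable_P : Measurable P
  measurable_N : Measurable N
  P_smul : ∀ r : ℝ, 0 < r → ∀ z, P (r • z) = P z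
  N_smul : ∀ r : ℝ, 0 < r → ∀ z, N (r • z) = r * N z
  notMem_iff : ∀ ξ : Bdry n, ξ ∉ infinityOf C ↔ 0 < N ξ
  projPlus_eq : ∀ ξ : Bdry n, ξ ∉ infinityOf C → projPlus C ξ = P ξ
  N_eq : ∀ ξ : Bdry n, ξ ∉ infinityOf C → N ξ = hor ξ (proj C ξ)

lemma continuous_lightVec : Continuous (lightVec : Bdry n → Mink n) := by
  unfold lightVec; fun_prop

lemma continuous_hor (x : Hyp n) : Continuous fun ξ => hor ξ x :=
  (Continuous.mink' continuous_const continuous_lightVec).neg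

lemma measurable_lightVec_endpoint : Measurable fun v : T1 n => lightVec v.endpoint := by
  have h : ∀ v : T1 n, lightVec v.endpoint = (v.base.pt.1 + v.dir.1)⁻¹ • (v.base.pt + v.dir) := by
    intro v
    rw [← smul_lightVec_endpoint, smul_smul, inv_mul_cancel₀ (fst_add_pos v).ne', one_smul]
  simp_rw [h]
  have h1 : Measurable fun v : T1 n => v.base.pt := (continuous_pt.comp continuous_base).measurable
  have h2 : Measurable fun v : T1 n => v.dir := continuous_dir.measurable
  exact (h1.fst.add h2.fst).inv.smul (h1.add h2)

lemma measurable_hor_endpoint : Measurable fun v : T1 n => hor v.endpoint v.base :=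
  (continuous_mink.measurable.comp ((continuous_pt.comp continuous_base).measurable.prodMk
    measurable_lightVec_endpoint)).neg

lemma measurable_hor_endpoint_const (x : Hyp n) : Measurable fun v : T1 n => hor v.endpoint x :=
  (continuous_mink.measurable.comp (measurable_const.prodMk measurable_lightVec_endpoint)).neg

lemma exp_neg_mul_log {a x : ℝ} (hx : 0 < x) : Real.exp (-a * Real.log x) = x ^ (-a) := by
  rw [Real.rpow_def_of_pos hx, mul_comm]

/-- The skinning measure in terms of the invariant measure of the light cone. -/
lemma IsProjData.skinningUp_eq {C : Set (Hyp n)} {P : EuclideanSpace ℝ (Fin n) → T1 n}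
    {N : EuclideanSpace ℝ (Fin n) → ℝ} (h : IsProjData C P N) (hn : 2 ≤ n) (x₀ : Hyp n) :
    skinningUp ((n : ℝ) - 1) sphericalDensity x₀ C =
      ENNReal.ofReal ((n - 1 : ℕ) : ℝ) • ((lam 0).restrict {z | 0 < N z ∧ N z < 1}).map P := by
  obtain ⟨d, rfl⟩ : ∃ d, n = d + 2 := ⟨_, (Nat.sub_add_cancel hn).symm⟩
  have hcast : ((d + 2 : ℕ) : ℝ) - 1 = (d + 1 : ℕ) := by push_cast; ring
  have hnat : d + 2 - 1 = d + 1 := by omega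
  set μ := (volume : Measure (EuclideanSpace ℝ (Fin (d + 2)))).toSphere with hμ
  have hNm : Measurable fun ξ : Bdry (d + 2) => N ξ := h.measurable_N.comp measurable_subtype_coe
  have hPm : Measurable fun ξ : Bdry (d + 2) => P ξ := h.measurable_P.comp measurable_subtype_coe
  have hI : (infinityOf C)ᶜ = {ξ : Bdry (d + 2) | 0 < N ξ} := by
    ext ξ; exact h.notMem_iff ξ
  have hIm : MeasurableSet {ξ : Bdry (d + 2) | 0 < N ξ} := measurableSet_lt measurable_const hNm
  have hD0 : Measurable fun ξ : Bdry (d + 2) =>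
      ENNReal.ofReal (Real.exp (-((d + 2 : ℕ) - 1 : ℝ) * busemann ξ x₀ (origin (d + 2)))) := by
    simp_rw [busemann_origin]
    exact (((continuous_hor x₀).measurable.log).const_mul _).exp.ennreal_ofReal
  have hD1 : Measurable fun w : T1 (d + 2) =>
      ENNReal.ofReal (Real.exp (-((d + 2 : ℕ) - 1 : ℝ) * busemann w.endpoint w.base x₀)) := by
    simp_rw [busemann_eq]
    exact ((measurable_hor_endpoint.log.sub (measurable_hor_endpoint_const x₀).log).const_mul
      _).exp.ennreal_ofReal
  have hmap : ((sphericalDensity x₀).restrict (infinityOf C)ᶜ).map (projPlus C) =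
      ((sphericalDensity x₀).restrict {ξ : Bdry (d + 2) | 0 < N ξ}).map fun ξ : Bdry (d + 2) => P ξ := by
    rw [hI]
    refine Measure.map_congr ?_
    filter_upwards [ae_restrict_mem hIm] with ξ hξ
    exact h.projPlus_eq ξ ((h.notMem_iff ξ).2 hξ)
  refine Measure.ext_of_lintegral _ fun f hf => ?_
  have hS : MeasurableSet {z | 0 < N z ∧ N z < 1} :=
    (measurableSet_lt measurable_const h.measurable_N).inter
      (measurableSet_lt h.measurable_N measurable_const)
  -- The density of μ_{x₀} and the exponential factor have exponents adding up to β_ξ(p, 0) = log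
  -- N(ξ) at the closest point p, so x₀ cancels.
  have lhs : ∫⁻ w, f w ∂(skinningUp ((d + 2 : ℕ) - 1 : ℝ) sphericalDensity x₀ C) =
      ∫⁻ ξ in {ξ : Bdry (d + 2) | 0 < N ξ}, ENNReal.ofReal ((N ξ ^ (d + 1))⁻¹) * f (P ξ) ∂μ := by
    have hgP : Measurable fun ξ : Bdry (d + 2) => ((fun w : T1 (d + 2) => ENNReal.ofReal (Real.exp
        (-((d + 2 : ℕ) - 1 : ℝ) * busemann w.endpoint w.base x₀))) * f) (P ξ) :=
      (hD1.mul hf).comp hPm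
    rw [skinningUp, lintegral_withDensity_eq_lintegral_mul _ hD1 hf, hmap,
      lintegral_map (hD1.mul hf) hPm, sphericalDensity,
      setLIntegral_withDensity_eq_setLIntegral_mul _ hD0 hgP hIm]
    refine setLIntegral_congr_fun hIm fun ξ hξ => ?_
    have hξ' := (h.notMem_iff ξ).2 hξ
    have hP := h.projPlus_eq ξ hξ'
    have hNξ := h.N_eq ξ hξ'
    have hb : (P ξ).base = proj C ξ := by rw [← hP]; rfl
    have he : (P ξ).endpoint = ξ := by rw [← hP]; exact toward_endpoint _ _
    simp only [Pi.mul_apply]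
    rw [hb, he, ← mul_assoc, ← ENNReal.ofReal_mul (Real.exp_pos _).le, ← Real.exp_add,
      busemann_origin, busemann_eq, ← hNξ]
    congr 2
    rw [← mul_add, add_sub_cancel, exp_neg_mul_log hξ, hcast, Real.rpow_neg (le_of_lt hξ),
      Real.rpow_natCast]
  have hfP : Measurable fun z => f (P z) := hf.comp h.measurable_P
  have hG : Measurable fun z => ENNReal.ofReal (hgt 0 z)⁻¹ *
      ({z | 0 < N z ∧ N z < 1}).indicator (fun z => f (P z)) z :=
    ((measurable_hgt 0).inv.ennreal_ofReal).mul (hfP.indicator hS)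
  -- On the ray through ξ the condition N < 1 reads r < 1/N(ξ); the polar factor r^(d+1) times the
  -- cone density 1/r is r^d, which integrates to N(ξ)^(-(d+1))/(d+1).
  have radial : ∀ ξ : Bdry (d + 2), ∫⁻ r in Ioi (0 : ℝ), ENNReal.ofReal (r ^ (d + 1)) *
      (ENNReal.ofReal (hgt 0 (r • (ξ : EuclideanSpace ℝ (Fin (d + 2)))))⁻¹ *
      ({z | 0 < N z ∧ N z < 1}).indicator (fun z => f (P z)) (r • (ξ : EuclideanSpace ℝ (Fin (d + 2))))) =
      ENNReal.ofReal ((d + 1 : ℕ) : ℝ)⁻¹ * ({ξ : Bdry (d + 2) | 0 < N ξ}).indicator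
        (fun ξ => ENNReal.ofReal ((N ξ ^ (d + 1))⁻¹) * f (P ξ)) ξ := by
    intro ξ
    have hξ1 : ‖(ξ : EuclideanSpace ℝ (Fin (d + 2)))‖ = 1 := mem_sphere_zero_iff_norm.1 ξ.2
    by_cases hξ : 0 < N ξ
    · have e : ∀ r ∈ Ioi (0 : ℝ), ENNReal.ofReal (r ^ (d + 1)) *
          (ENNReal.ofReal (hgt 0 (r • (ξ : EuclideanSpace ℝ (Fin (d + 2)))))⁻¹ *
          ({z | 0 < N z ∧ N z < 1}).indicator (fun z => f (P z))
            (r • (ξ : EuclideanSpace ℝ (Fin (d + 2))))) =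
          (Ioo 0 (N ξ)⁻¹).indicator (fun r => ENNReal.ofReal (r ^ d) * f (P ξ)) r := by
        intro r hr
        have hr0 : 0 < r := hr
        have hrn : hgt 0 (r • (ξ : EuclideanSpace ℝ (Fin (d + 2)))) = r := by
          rw [hgt_zero_left, norm_smul, hξ1, mul_one, Real.norm_of_nonneg hr0.le]
        have hiff : r * N ξ < 1 ↔ r < (N ξ)⁻¹ := by
          rw [lt_inv_comm₀ hr0 hξ, ← one_div, lt_div_iff₀ hr0, mul_comm]
        by_cases h1 : r < (N ξ)⁻¹
        · rw [indicator_of_mem (by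
            rw [mem_ofPred_eq, h.N_smul r hr]; exact ⟨by positivity, hiff.2 h1⟩),
            indicator_of_mem (show r ∈ Ioo 0 (N ξ)⁻¹ from ⟨hr, h1⟩), hrn, ← mul_assoc,
            ← ENNReal.ofReal_mul (by positivity), h.P_smul r hr, pow_succ, mul_assoc,
            mul_inv_cancel₀ hr0.ne', mul_one]
        · rw [indicator_of_notMem (by
            rw [mem_ofPred_eq, h.N_smul r hr]; exact fun h' => h1 (hiff.1 h'.2)),
            indicator_of_notMem (fun h' => h1 h'.2), mul_zero, mul_zero]
      rw [setLIntegral_congr_fun measurableSet_Ioi e, lintegral_indicator measurableSet_Ioo,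
        Measure.restrict_restrict measurableSet_Ioo, inter_eq_left.2 (fun r hr => hr.1),
        lintegral_mul_const _ (by fun_prop), setLIntegral_pow_Ioo _ (inv_nonneg.2 hξ.le),
        indicator_of_mem (show ξ ∈ {ξ : Bdry (d + 2) | 0 < N ξ} from hξ), ← mul_assoc,
        ← ENNReal.ofReal_mul (by positivity)]
      congr 2
      push_cast
      rw [inv_pow]
      field_simp
    · have e : ∀ r ∈ Ioi (0 : ℝ), ENNReal.ofReal (r ^ (d + 1)) *
          (ENNReal.ofReal (hgt 0 (r • (ξ : EuclideanSpace ℝ (Fin (d + 2)))))⁻¹ *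
          ({z | 0 < N z ∧ N z < 1}).indicator (fun z => f (P z))
            (r • (ξ : EuclideanSpace ℝ (Fin (d + 2))))) = 0 := by
        intro r hr
        rw [indicator_of_notMem (by
            rw [mem_ofPred_eq, h.N_smul r hr]
            exact fun h' => hξ (pos_of_mul_pos_right h'.1 (le_of_lt hr))), mul_zero, mul_zero]
      rw [setLIntegral_congr_fun measurableSet_Ioi e, lintegral_zero,
        indicator_of_notMem (show ξ ∉ {ξ : Bdry (d + 2) | 0 < N ξ} from hξ), mul_zero]
  have hfS : Measurable fun ξ : Bdry (d + 2) => ({ξ : Bdry (d + 2) | 0 < N ξ}).indicator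
        (fun ξ => ENNReal.ofReal ((N ξ ^ (d + 1))⁻¹) * f (P ξ)) ξ := by
    apply Measurable.indicator _ hIm
    exact ((hNm.pow_const _).inv.ennreal_ofReal).mul (hf.comp hPm)
  rw [lhs, lintegral_smul_measure, lintegral_map hf h.measurable_P, ← lintegral_indicator hS,
    lintegral_lam 0 (hfP.indicator hS), lintegral_polar hG]
  simp only [finrank_euclideanSpace_fin, hnat]
  rw [lintegral_congr radial, lintegral_const_mul _ hfS, lintegral_indicator hIm, smul_eq_mul,
    ← mul_assoc, ← ENNReal.ofReal_mul (by positivity), mul_inv_cancel₀ (by positivity),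
    ENNReal.ofReal_one, one_mul]

/-- Transport of `IsProjData` under an isometry. -/
lemma IsProjData.smul {C : Set (Hyp n)} {P : EuclideanSpace ℝ (Fin n) → T1 n}
    {N : EuclideanSpace ℝ (Fin n) → ℝ} (h : IsProjData C P N) (hC : HasClosest C) (A : Lorentz n) :
    IsProjData (A • C) (fun z => A • P (A⁻¹.1 (hgt 0 z, z)).2) fun z => N (A⁻¹.1 (hgt 0 z, z)).2 := by
  have hT : Measurable fun z : EuclideanSpace ℝ (Fin n) => (A⁻¹.1 (hgt 0 z, z)).2 := by
    have h1 := Lorentz.continuous_coe A⁻¹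
    have h2 := continuous_hgt (E := EuclideanSpace ℝ (Fin n)) 0
    exact (continuous_snd.comp (h1.comp (h2.prodMk continuous_id))).measurable
  have hTs : ∀ r : ℝ, 0 < r → ∀ z : EuclideanSpace ℝ (Fin n),
      (A⁻¹.1 (hgt 0 (r • z), r • z)).2 = r • (A⁻¹.1 (hgt 0 z, z)).2 := by
    intro r hr z
    have : (hgt 0 (r • z), r • z) = r • (hgt 0 z, z) := by
      simp [hgt_zero_left, norm_smul, Real.norm_of_nonneg hr.le]
    rw [this, map_smul, Prod.smul_snd]
  -- On the unit sphere the cone action is the boundary action times a positive factor; homogeneity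
  -- of P and N handles that factor.
  have hTξ : ∀ ξ : Bdry n, (A⁻¹.1 (hgt 0 (ξ : EuclideanSpace ℝ (Fin n)), (ξ : EuclideanSpace ℝ (Fin n)))).2 =
      (A⁻¹.1 (lightVec ξ)).1 • (bdAct A⁻¹ ξ : EuclideanSpace ℝ (Fin n)) := by
    intro ξ
    have : (hgt 0 (ξ : EuclideanSpace ℝ (Fin n)), (ξ : EuclideanSpace ℝ (Fin n))) = lightVec ξ := by
      rw [hgt_zero_left, mem_sphere_zero_iff_norm.1 ξ.2]; rfl
    rw [this]
    exact (congrArg Prod.snd (smul_lightVec_bdAct A⁻¹ ξ)).symm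
  have hmem : ∀ ξ : Bdry n, ξ ∉ infinityOf (A • C) ↔ bdAct A⁻¹ ξ ∉ infinityOf C := by
    intro ξ
    rw [← bdAct_mem_infinityOf (A := A) (ξ := bdAct A⁻¹ ξ), bdAct_bdAct_inv]
  have hproj : ∀ ξ : Bdry n, ξ ∉ infinityOf (A • C) → proj (A • C) ξ = A • proj C (bdAct A⁻¹ ξ) := by
    intro ξ hξ
    rw [← hC.proj_smul A ((hmem ξ).1 hξ), bdAct_bdAct_inv]
  have hpos := Lorentz.fst_lightVec_pos A⁻¹
  refine ⟨(measurable_const_smul A).comp (h.measurable_P.comp hT), h.measurable_N.comp hT, ?_, ?_, ?_, ?_, ?_⟩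
  · intro r hr z
    simp only [hTs r hr, h.P_smul r hr]
  · intro r hr z
    simp only [hTs r hr, h.N_smul r hr]
  · intro ξ
    rw [hTξ, h.N_smul _ (hpos ξ), hmem, h.notMem_iff, mul_pos_iff_of_pos_left (hpos ξ)]
  · intro ξ hξ
    rw [hTξ, h.P_smul _ (hpos ξ), ← h.projPlus_eq _ ((hmem ξ).1 hξ), projPlus, projPlus,
      smul_toward, hproj ξ hξ, bdAct_bdAct_inv]
  · intro ξ hξ
    rw [hTξ, h.N_smul _ (hpos ξ), h.N_eq _ ((hmem ξ).1 hξ), hproj ξ hξ,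
      ← hor_smul A⁻¹ ξ (A • proj C (bdAct A⁻¹ ξ)), inv_smul_smul]

/-- Naturality of the skinning measures under geodesic symmetries. -/
lemma IsProjData.skinningUp_symLor {C : Set (Hyp n)} {P : EuclideanSpace ℝ (Fin n) → T1 n}
    {N : EuclideanSpace ℝ (Fin n) → ℝ} (h : IsProjData C P N) (hC : HasClosest C) (hn : 2 ≤ n)
    (p x₀ : Hyp n) :
    skinningUp ((n : ℝ) - 1) sphericalDensity x₀ (symLor p • C) =
      (skinningUp ((n : ℝ) - 1) sphericalDensity x₀ C).map (symLor p • ·) := by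
  have hT : ∀ z : EuclideanSpace ℝ (Fin n), ((symLor p)⁻¹.1 (hgt 0 z, z)).2 =
      symMap 0 p.pt.1 p.pt.2 z := by
    intro z
    rw [symLor_inv, symLor_hgt_snd]
  have hmp := measurePreserving_symMap (E := EuclideanSpace ℝ (Fin n)) le_rfl p.pos.le p.norm_sq
  have hS : MeasurableSet {z | 0 < N z ∧ N z < 1} :=
    (measurableSet_lt measurable_const h.measurable_N).inter
      (measurableSet_lt h.measurable_N measurable_const)
  have hAm : Measurable fun v : T1 n => symLor p • v := measurable_const_smul _
  rw [(h.smul hC (symLor p)).skinningUp_eq hn x₀, h.skinningUp_eq hn x₀, Measure.map_smul,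
    Measure.map_map hAm h.measurable_P]
  congr 1
  simp only [hT]
  -- The transported data differ from the original by a precomposition with `symMap 0`, which
  -- preserves `lam 0`.
  have h1 : (fun z => symLor p • P (symMap 0 p.pt.1 p.pt.2 z)) =
      ((symLor p • ·) ∘ P) ∘ symMap 0 p.pt.1 p.pt.2 := rfl
  rw [h1, ← Measure.map_map (hAm.comp h.measurable_P) hmp.measurable]
  congr 1
  exact (hmp.restrict_preimage hS).map_eq

end ProjData

/-! ### Comparison of measures by local inequalities with constants tending to 1. -/

section Comparison

/-- Countably many balls of radius δ cover X; cutting A along their disjointification reduces to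
pieces lying in one ball. -/
lemma measure_le_mul_of_ball {X : Type*} [PseudoMetricSpace X] [SecondCountableTopology X]
    [MeasurableSpace X] [OpensMeasurableSpace X] {μ ν : Measure X} {c : ℝ≥0∞} {δ : ℝ} (hδ : 0 < δ)
    (h : ∀ (x : X) (A : Set X), A ⊆ Metric.ball x δ → MeasurableSet A → μ A ≤ c * ν A)
    {A : Set X} (hA : MeasurableSet A) : μ A ≤ c * ν A := by
  rcases isEmpty_or_nonempty X with hX | hX
  · rw [eq_empty_of_isEmpty A, measure_empty]; exact zero_le
  set B : ℕ → Set X := disjointed fun i => Metric.ball (TopologicalSpace.denseSeq X i) δ with hB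
  have hBm : ∀ i, MeasurableSet (B i) := MeasurableSet.disjointed fun i => measurableSet_ball
  have hU : ⋃ i, B i = univ := by
    rw [hB, iUnion_disjointed, iUnion_eq_univ_iff]
    intro x
    obtain ⟨_, hi, ⟨i, rfl⟩⟩ := Metric.dense_iff.1 (TopologicalSpace.denseRange_denseSeq X) x δ hδ
    exact ⟨i, by rw [Metric.mem_ball, dist_comm]; exact hi⟩
  have hA' : A = ⋃ i, A ∩ B i := by rw [← inter_iUnion, hU, inter_univ]
  calc μ A ≤ ∑' i, μ (A ∩ B i) := by
        conv_lhs => rw [hA']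
        exact measure_iUnion_le _
    _ ≤ ∑' i, c * ν (A ∩ B i) := ENNReal.tsum_le_tsum fun i =>
        h _ _ (inter_subset_right.trans (disjointed_subset _ _)) (hA.inter (hBm i))
    _ = c * ν A := by
        rw [ENNReal.tsum_mul_left]
        conv_rhs => rw [hA']
        rw [measure_iUnion (fun i j hij => ((disjoint_disjointed _) hij).mono inter_subset_right
          inter_subset_right) fun i => hA.inter (hBm i)]

/-- The local inequality at scale δ globalises with the same constant K δ, which then tends to 1.
Used in both directions, this identifies a Hausdorff measure with a density. -/
lemma measure_le_of_local_le {X : Type*} [PseudoMetricSpace X] [SecondCountableTopology X]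
    [MeasurableSpace X] [OpensMeasurableSpace X] {μ ν : Measure X} {K : ℝ → ℝ}
    (hK : Tendsto K (𝓝[>] 0) (𝓝 1))
    (h : ∀ δ, 0 < δ → ∀ (x : X) (A : Set X), A ⊆ Metric.ball x δ → MeasurableSet A →
      μ A ≤ ENNReal.ofReal (K δ) * ν A) : μ ≤ ν := by
  refine Measure.le_iff.2 fun A hA => ?_
  have h1 : Tendsto (fun δ => ENNReal.ofReal (K δ) * ν A) (𝓝[>] 0) (𝓝 (ENNReal.ofReal 1 * ν A)) :=
    ENNReal.Tendsto.mul_const (ENNReal.tendsto_ofReal hK) (by simp)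
  rw [ENNReal.ofReal_one, one_mul] at h1
  refine ge_of_tendsto h1 ?_
  filter_upwards [self_mem_nhdsWithin] with δ hδ
  exact measure_le_mul_of_ball hδ (h δ hδ) hA

variable {E : Type*} [NormedAddCommGroup E] [InnerProductSpace ℝ E] [FiniteDimensional ℝ E]
  [MeasurableSpace E] [BorelSpace E] {X : Type*} [MetricSpace X] [MeasurableSpace X] [BorelSpace X]

lemma euclideanHausdorffMeasure_image_le {φ : E → X} {B : Set E}
    (h : ∀ y ∈ B, ∀ y' ∈ B, dist (φ y) (φ y') ≤ dist y y') :
    (μHE[Module.finrank ℝ E] : Measure X) (φ '' B) ≤ volume B := by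
  have hL : LipschitzOnWith 1 φ B := LipschitzOnWith.of_dist_le_mul fun y hy y' hy' => by
    simpa using h y hy y' hy'
  have := hL.hausdorffMeasure_image_le (d := Module.finrank ℝ E) (Nat.cast_nonneg _)
  rw [ENNReal.coe_one, ENNReal.one_rpow, one_mul] at this
  rw [← InnerProductSpace.euclideanHausdorffMeasure_eq_volume]
  simp only [Measure.euclideanHausdorffMeasure_def, Measure.smul_apply]
  gcongr

/-- The hypothesis makes φ injective on B with K-Lipschitz inverse, and Hausdorff measure grows at
most by the factor K^dim under that inverse. -/
lemma volume_le_euclideanHausdorffMeasure_image {φ : E → X} {B : Set E} {K : ℝ} (hK : 0 ≤ K)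
    (h : ∀ y ∈ B, ∀ y' ∈ B, dist y y' ≤ K * dist (φ y) (φ y')) :
    volume B ≤ ENNReal.ofReal (K ^ Module.finrank ℝ E) *
      (μHE[Module.finrank ℝ E] : Measure X) (φ '' B) := by
  have hinj : InjOn φ B := fun y hy y' hy' hyy => by
    have := h y hy y' hy'
    rw [hyy, dist_self, mul_zero] at this
    exact dist_le_zero.1 this
  have hL : LipschitzOnWith K.toNNReal (Function.invFunOn φ B) (φ '' B) := by
    refine LipschitzOnWith.of_dist_le_mul ?_
    rintro _ ⟨y, hy, rfl⟩ _ ⟨y', hy', rfl⟩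
    rw [hinj.leftInvOn_invFunOn hy, hinj.leftInvOn_invFunOn hy', Real.coe_toNNReal _ hK]
    exact h y hy y' hy'
  have := hL.hausdorffMeasure_image_le (d := Module.finrank ℝ E) (Nat.cast_nonneg _)
  rw [hinj.leftInvOn_invFunOn.image_image, ENNReal.rpow_natCast] at this
  rw [← InnerProductSpace.euclideanHausdorffMeasure_eq_volume]
  simp only [Measure.euclideanHausdorffMeasure_def, Measure.smul_apply]
  rw [ENNReal.smul_def, ENNReal.smul_def, smul_eq_mul, smul_eq_mul, mul_left_comm]
  gcongr
  rw [ENNReal.ofReal_pow hK]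
  exact this

end Comparison

/-! ### Elementary bounds comparing 2 (cosh d - 1) with d². -/

section Estimates

lemma sq_le_two_mul_cosh_sub_one {d : ℝ} (hd : 0 ≤ d) : d ^ 2 ≤ 2 * (Real.cosh d - 1) := by
  have h1 : d / 2 ≤ Real.sinh (d / 2) := Real.self_le_sinh_iff.2 (by positivity)
  have h2 : Real.cosh d = 1 + 2 * Real.sinh (d / 2) ^ 2 := by
    have := Real.cosh_two_mul (d / 2)
    rw [mul_div_cancel₀ d two_ne_zero, Real.cosh_sq] at this
    rw [this]; ring
  rw [h2]
  nlinarith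

/-- With u = d²/2, cosh d ≤ e^u, and e^u - 1 ≤ u e^u because 1 - u ≤ e^(-u). -/
lemma two_mul_cosh_sub_one_le (d : ℝ) : 2 * (Real.cosh d - 1) ≤ d ^ 2 * Real.exp (d ^ 2 / 2) := by
  have h1 := Real.cosh_le_exp_half_sq d
  have h2 := Real.add_one_le_exp (-(d ^ 2 / 2))
  have h3 : Real.exp (d ^ 2 / 2) * Real.exp (-(d ^ 2 / 2)) = 1 := by rw [← Real.exp_add]; simp
  have h4 := Real.exp_pos (d ^ 2 / 2)
  nlinarith

end Estimates

/-! ### Riemannian measure of totally geodesic subspaces through the origin. -/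

section SheetParam

variable {n : ℕ}

/-- The point of the hyperboloid above `z`. -/
def sheetPt (z : EuclideanSpace ℝ (Fin n)) : Hyp n :=
  ⟨(hgt 1 z, z), by rw [mink_self, hgt_sq zero_le_one]; ring, hgt_one_pos z⟩

lemma sheetPt_snd (x : Hyp n) : sheetPt x.pt.2 = x := by
  apply Hyp.ext
  refine Prod.ext ?_ rfl
  change √(1 + ‖x.pt.2‖ ^ 2) = x.pt.1
  rw [x.norm_sq, add_sub_cancel, Real.sqrt_sq x.pos.le]

lemma hgt_snd (x : Hyp n) : hgt 1 x.pt.2 = x.pt.1 := congrArg (fun y => y.pt.1) (sheetPt_snd x)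

lemma continuous_sheetPt : Continuous (sheetPt : EuclideanSpace ℝ (Fin n) → Hyp n) :=
  continuous_hyp_iff.2 ((continuous_hgt 1).prodMk continuous_id)

lemma continuous_snd_pt : Continuous fun x : Hyp n => x.pt.2 := continuous_snd.comp continuous_pt

/-- Both sides are the Minkowski square of the chord x - y; this converts metric comparisons into
Euclidean ones. -/
lemma two_mul_cosh_dist_sub_one (x y : Hyp n) :
    2 * (Real.cosh (dist x y) - 1) = ‖x.pt.2 - y.pt.2‖ ^ 2 - (x.pt.1 - y.pt.1) ^ 2 := by
  rw [cosh_dist, norm_sub_sq_real, x.norm_sq, y.norm_sq, mink]; ring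

lemma dist_sheetPt_le (y y' : EuclideanSpace ℝ (Fin n)) : dist (sheetPt y) (sheetPt y') ≤ dist y y' := by
  refine le_of_sq_le_sq ((sq_le_two_mul_cosh_sub_one dist_nonneg).trans ?_) dist_nonneg
  rw [two_mul_cosh_dist_sub_one, dist_eq_norm]
  change ‖y - y'‖ ^ 2 - _ ≤ _
  nlinarith [sq_nonneg ((sheetPt y).pt.1 - (sheetPt y').pt.1)]

lemma cosh_dist_origin (x : Hyp n) : Real.cosh (dist x (origin n)) = x.pt.1 := by
  rw [cosh_dist, mink_origin, neg_neg]

lemma fst_lt_cosh {x : Hyp n} {r : ℝ} (h : dist x (origin n) < r) : x.pt.1 < Real.cosh r := by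
  rw [← cosh_dist_origin, Real.cosh_lt_cosh, abs_of_nonneg dist_nonneg]
  exact h.trans_le (le_abs_self r)

/-- Near the origin the hyperboloid is a graph of slope at most tanh r, so dropping the height loses
at most cosh r on chords. The factor exp (r²) passes from chords to distances, the distance being at
most 2r. -/
lemma dist_le_mul_dist_sheetPt {r : ℝ} (hr : 0 < r) {y y' : EuclideanSpace ℝ (Fin n)}
    (hy : dist (sheetPt y) (origin n) < r) (hy' : dist (sheetPt y') (origin n) < r) :
    dist y y' ≤ Real.cosh r * Real.exp (r ^ 2) * dist (sheetPt y) (sheetPt y') := by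
  set q := hgt 1 y with hq
  set q' := hgt 1 y' with hq'
  have hqr : q < Real.cosh r := fst_lt_cosh hy
  have hqr' : q' < Real.cosh r := fst_lt_cosh hy'
  have hq0 : 0 < q := hgt_one_pos y
  have hq0' : 0 < q' := hgt_one_pos y'
  set C := Real.cosh r with hC
  have hCpos : 0 < C := Real.cosh_pos r
  have hS : Real.sinh r ^ 2 = C ^ 2 - 1 := Real.sinh_sq r
  have hSpos : 0 ≤ Real.sinh r := Real.sinh_nonneg_iff.2 hr.le
  -- With hgt 1 z = cosh ρ and ‖z‖ = sinh ρ this is tanh ρ ≤ tanh r.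
  have aux : ∀ z : EuclideanSpace ℝ (Fin n), hgt 1 z < C → C * ‖z‖ ≤ Real.sinh r * hgt 1 z := by
    intro z hz
    refine le_of_sq_le_sq ?_ (mul_nonneg hSpos (hgt_nonneg _ _))
    have h1 := hgt_sq zero_le_one z
    have h2 := hgt_one_pos z
    rw [mul_pow, mul_pow, hS]
    nlinarith
  have h1 : C ^ 2 * (q - q') ^ 2 ≤ (C ^ 2 - 1) * ‖y - y'‖ ^ 2 := by
    have e1 : (q - q') * (q + q') = (‖y‖ - ‖y'‖) * (‖y‖ + ‖y'‖) := by
      have := hgt_sq zero_le_one y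
      have := hgt_sq zero_le_one y'
      nlinarith
    have e2 : |‖y‖ - ‖y'‖| ≤ ‖y - y'‖ := abs_norm_sub_norm_le y y'
    have e3 : C * |q - q'| ≤ Real.sinh r * ‖y - y'‖ := by
      have h5 : 0 < q + q' := by positivity
      refine le_of_mul_le_mul_right ?_ h5
      calc C * |q - q'| * (q + q') = C * |(q - q') * (q + q')| := by
            rw [abs_mul, abs_of_pos h5]; ring
        _ = |‖y‖ - ‖y'‖| * (C * ‖y‖ + C * ‖y'‖) := by
            rw [e1, abs_mul, abs_of_nonneg (by positivity : 0 ≤ ‖y‖ + ‖y'‖)]; ring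
        _ ≤ ‖y - y'‖ * (Real.sinh r * q + Real.sinh r * q') := by
            have h6 := aux y hqr
            have h7 := aux y' hqr'
            exact mul_le_mul e2 (add_le_add h6 h7) (by positivity) (norm_nonneg _)
        _ = _ := by ring
    have := pow_le_pow_left₀ (by positivity) e3 2
    rwa [mul_pow, mul_pow, sq_abs, hS] at this
  set d := dist (sheetPt y) (sheetPt y') with hd
  have hd0 : 0 ≤ d := dist_nonneg
  have hd2 : d ≤ 2 * r := by
    have := dist_triangle_right (sheetPt y) (sheetPt y') (origin n)
    linarith
  have h2 := two_mul_cosh_dist_sub_one (sheetPt y) (sheetPt y')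
  change 2 * (Real.cosh d - 1) = ‖y - y'‖ ^ 2 - (q - q') ^ 2 at h2
  have h3 := two_mul_cosh_sub_one_le d
  have h4 : Real.exp (d ^ 2 / 2) ≤ Real.exp (r ^ 2) ^ 2 := by
    rw [← Real.exp_nat_mul]
    apply Real.exp_le_exp.2
    push_cast
    nlinarith
  refine le_of_sq_le_sq ?_ (by positivity)
  rw [dist_eq_norm, mul_pow, mul_pow]
  calc ‖y - y'‖ ^ 2 ≤ C ^ 2 * (2 * (Real.cosh d - 1)) := by rw [h2]; linarith
    _ ≤ C ^ 2 * (d ^ 2 * Real.exp (r ^ 2) ^ 2) := by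
        refine mul_le_mul_of_nonneg_left (h3.trans ?_) (by positivity)
        gcongr
    _ = _ := by ring

/-- The points of the hyperboloid above the subspace `K`. -/
def geo (K : Submodule ℝ (EuclideanSpace ℝ (Fin n))) : Set (Hyp n) := {x | x.pt.2 ∈ K}

lemma isClosed_geo (K : Submodule ℝ (EuclideanSpace ℝ (Fin n))) : IsClosed (geo K) :=
  K.closed_of_finiteDimensional.preimage continuous_snd_pt

lemma range_sheetPt (K : Submodule ℝ (EuclideanSpace ℝ (Fin n))) :
    range (fun y : K => sheetPt (y : EuclideanSpace ℝ (Fin n))) = geo K := by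
  ext x
  constructor
  · rintro ⟨y, rfl⟩; exact y.2
  · intro hx; exact ⟨⟨x.pt.2, hx⟩, sheetPt_snd x⟩

lemma measurable_sheetPt_coe (K : Submodule ℝ (EuclideanSpace ℝ (Fin n))) :
    Measurable fun y : K => sheetPt (y : EuclideanSpace ℝ (Fin n)) :=
  (continuous_sheetPt.comp continuous_subtype_val).measurable

lemma symLor_sheetPt (p : Hyp n) (z : EuclideanSpace ℝ (Fin n)) :
    symLor p • sheetPt z = sheetPt (symMap 1 p.pt.1 p.pt.2 z) := by
  rw [← sheetPt_snd (symLor p • sheetPt z), smul_pt]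
  exact congrArg sheetPt (symLor_hgt_snd p 1 z)

lemma symLor_smul_mem_geo {K : Submodule ℝ (EuclideanSpace ℝ (Fin n))} {p x : Hyp n}
    (hp : p ∈ geo K) (hx : x ∈ geo K) : symLor p • x ∈ geo K := by
  rw [← sheetPt_snd x, symLor_sheetPt]
  exact K.neg_mem (K.add_mem hx (K.smul_mem _ hp))

lemma symLor_smul_smul (p x : Hyp n) : symLor p • symLor p • x = x := by
  nth_rw 1 [← symLor_inv]; exact inv_smul_smul _ _

/-- The geodesic symmetries in `geo K` preserve the Riemannian measure in sheet coordinates. -/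
lemma map_symLor_map_lam {K : Submodule ℝ (EuclideanSpace ℝ (Fin n))} {p : Hyp n} (hp : p ∈ geo K) :
    ((lam 1 : Measure K).map fun y : K => sheetPt (y : EuclideanSpace ℝ (Fin n))).map
      (symLor p • ·) = (lam 1 : Measure K).map fun y : K => sheetPt (y : EuclideanSpace ℝ (Fin n)) := by
  have hv : ‖(⟨p.pt.2, hp⟩ : K)‖ ^ 2 = p.pt.1 ^ 2 - 1 := p.norm_sq
  have hmp := measurePreserving_symMap (E := K) zero_le_one p.pos.le hv
  rw [Measure.map_map (measurable_const_smul _) (measurable_sheetPt_coe K)]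
  have : ((symLor p • ·) ∘ fun y : K => sheetPt (y : EuclideanSpace ℝ (Fin n))) =
      (fun y : K => sheetPt (y : EuclideanSpace ℝ (Fin n))) ∘ symMap 1 p.pt.1 ⟨p.pt.2, hp⟩ := by
    funext y
    exact symLor_sheetPt p y
  rw [this, ← Measure.map_map (measurable_sheetPt_coe K) hmp.measurable, hmp.map_eq]

lemma map_smul_euclideanHausdorffMeasure (d : ℕ) (A : Lorentz n) :
    (μHE[d] : Measure (Hyp n)).map (A • ·) = μHE[d] :=
  ((IsometryEquiv.constSMul A).measurePreserving_euclideanHausdorffMeasure d).map_eq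

/-- The Riemannian measure of `geo K` in sheet coordinates. -/
lemma euclideanHausdorffMeasure_restrict_geo (K : Submodule ℝ (EuclideanSpace ℝ (Fin n))) :
    (μHE[Module.finrank ℝ K] : Measure (Hyp n)).restrict (geo K) =
      (lam 1 : Measure K).map fun y : K => sheetPt (y : EuclideanSpace ℝ (Fin n)) := by
  set k := Module.finrank ℝ K
  set φ : K → Hyp n := fun y => sheetPt (y : EuclideanSpace ℝ (Fin n)) with hφ
  have hφm : Measurable φ := measurable_sheetPt_coe K
  set μ₁ := (μHE[k] : Measure (Hyp n)).restrict (geo K) with hμ₁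
  set μ₂ := (lam 1 : Measure K).map φ with hμ₂
  have hgm : MeasurableSet (geo K) := (isClosed_geo K).measurableSet
  have h₁ : ∀ A, MeasurableSet A → μ₁ A = (μHE[k] : Measure (Hyp n)) (φ '' (φ ⁻¹' A)) := by
    intro A hA
    rw [image_preimage_eq_inter_range, range_sheetPt, hμ₁, Measure.restrict_apply hA]
  -- Both measures are invariant under the symmetries associated with points of `geo K`, so it is
  -- enough to compare them near the origin.
  have hinv₁ : ∀ p ∈ geo K, ∀ A, MeasurableSet A → μ₁ ((symLor p • ·) ⁻¹' A) = μ₁ A := by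
    intro p hp A hA
    have hm := measurable_const_smul (symLor p) hA
    rw [hμ₁, Measure.restrict_apply hm, Measure.restrict_apply hA]
    have : (symLor p • ·) ⁻¹' A ∩ geo K = (symLor p • ·) ⁻¹' (A ∩ geo K) := by
      rw [preimage_inter]
      congr 1
      ext x
      refine ⟨fun hx => symLor_smul_mem_geo hp hx, fun hx => ?_⟩
      rw [← symLor_smul_smul p x]
      exact symLor_smul_mem_geo hp hx
    rw [this, ← Measure.map_apply (measurable_const_smul (symLor p)) (hA.inter hgm),
      map_smul_euclideanHausdorffMeasure]
  have hinv₂ : ∀ p ∈ geo K, ∀ A, MeasurableSet A → μ₂ ((symLor p • ·) ⁻¹' A) = μ₂ A := by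
    intro p hp A hA
    rw [← Measure.map_apply (measurable_const_smul (symLor p)) hA, hμ₂, map_symLor_map_lam hp]
  -- comparison near the origin
  have hnear : ∀ r, 0 < r → ∀ A, A ⊆ Metric.ball (origin n) r → MeasurableSet A →
      μ₁ A ≤ ENNReal.ofReal (Real.cosh r) * μ₂ A ∧
      μ₂ A ≤ ENNReal.ofReal ((Real.cosh r * Real.exp (r ^ 2)) ^ k) * μ₁ A := by
    intro r hr A hAr hA
    have hB : ∀ y ∈ φ ⁻¹' A, dist (φ y) (origin n) < r := fun y hy => hAr hy
    have hBm : MeasurableSet (φ ⁻¹' A) := hφm hA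
    have hlam : μ₂ A = ∫⁻ y in φ ⁻¹' A, ENNReal.ofReal (hgt 1 y)⁻¹ := by
      rw [hμ₂, Measure.map_apply hφm hA, lam, withDensity_apply _ hBm]
    rw [h₁ A hA, hlam]
    constructor
    -- The parametrisation is 1-Lipschitz, and the density 1/hgt is at least 1/cosh r on the ball.
    · refine (euclideanHausdorffMeasure_image_le (B := φ ⁻¹' A) fun y _ y' _ =>
        dist_sheetPt_le _ _).trans ?_
      have hm1 : Measurable fun y : K => ENNReal.ofReal (hgt 1 y)⁻¹ :=
        (measurable_hgt 1).inv.ennreal_ofReal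
      rw [← lintegral_const_mul _ hm1, ← setLIntegral_one]
      refine setLIntegral_mono (hm1.const_mul _) fun y hy => ?_
      rw [← ENNReal.ofReal_mul (Real.cosh_pos r).le, ENNReal.one_le_ofReal,
        ← div_eq_mul_inv, one_le_div (hgt_one_pos y)]
      exact (fst_lt_cosh (hB y hy)).le
    · refine le_trans ?_ (volume_le_euclideanHausdorffMeasure_image (B := φ ⁻¹' A)
        (K := Real.cosh r * Real.exp (r ^ 2)) (by positivity) fun y hy y' hy' =>
        dist_le_mul_dist_sheetPt hr (hB y hy) (hB y' hy'))
      rw [← setLIntegral_one]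
      refine setLIntegral_mono measurable_const fun y hy => ?_
      rw [ENNReal.ofReal_le_one, inv_le_one₀ (hgt_one_pos y), hgt, Real.one_le_sqrt]
      linarith [sq_nonneg ‖y‖]
  -- comparison near any point
  have hlocal : ∀ r, 0 < r → ∀ x A, A ⊆ Metric.ball x r → MeasurableSet A →
      μ₁ A ≤ ENNReal.ofReal (Real.cosh (2 * r)) * μ₂ A ∧
      μ₂ A ≤ ENNReal.ofReal ((Real.cosh (2 * r) * Real.exp ((2 * r) ^ 2)) ^ k) * μ₁ A := by
    intro r hr x A hAr hA
    by_cases hne : (A ∩ geo K).Nonempty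
    · obtain ⟨p, hpA, hp⟩ := hne
      rw [← hinv₁ p hp A hA, ← hinv₂ p hp A hA]
      -- The symmetry exchanges p and the origin; points of A are within 2r of p because both lie in
      -- the ball of radius r.
      refine hnear (2 * r) (by positivity) _ (fun y hy => ?_) (measurable_const_smul _ hA)
      have h1 : dist (symLor p • y) x < r := hAr hy
      have h2 : dist p x < r := hAr hpA
      have h3 := dist_triangle_right (symLor p • y) p x
      rw [Metric.mem_ball, ← dist_smul (symLor p), symLor_origin]
      linarith
    · rw [not_nonempty_iff_eq_empty] at hne
      have e1 : μ₁ A = 0 := by rw [hμ₁, Measure.restrict_apply hA, hne, measure_empty]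
      have e2 : μ₂ A = 0 := by
        rw [hμ₂, Measure.map_apply hφm hA]
        have : φ ⁻¹' A = ∅ := by
          rw [preimage_eq_empty_iff, range_sheetPt, disjoint_iff_inter_eq_empty, hne]
        rw [this, measure_empty]
      simp [e1, e2]
  refine le_antisymm (measure_le_of_local_le (K := fun r => Real.cosh (2 * r)) ?_ fun r hr x A h1 h2 =>
    (hlocal r hr x A h1 h2).1) (measure_le_of_local_le
    (K := fun r => (Real.cosh (2 * r) * Real.exp ((2 * r) ^ 2)) ^ k) ?_ fun r hr x A h1 h2 =>
    (hlocal r hr x A h1 h2).2)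
  · have : Continuous fun r : ℝ => Real.cosh (2 * r) := by fun_prop
    have h := this.tendsto 0
    simp only [mul_zero, Real.cosh_zero] at h
    exact h.mono_left nhdsWithin_le_nhds
  · have : Continuous fun r : ℝ => (Real.cosh (2 * r) * Real.exp ((2 * r) ^ 2)) ^ k := by fun_prop
    have h := this.tendsto 0
    simp only [mul_zero, Real.cosh_zero, ne_eq, OfNat.ofNat_ne_zero, not_false_eq_true, zero_pow,
      Real.exp_zero, mul_one, one_pow] at h
    exact h.mono_left nhdsWithin_le_nhds

end SheetParam

/-! ### Horospheres, their Riemannian measure and the volume of horoballs. -/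

section Horosphere

variable {n : ℕ}

lemma norm_bdry (ξ : Bdry n) : ‖(ξ : EuclideanSpace ℝ (Fin n))‖ = 1 := mem_sphere_zero_iff_norm.1 ξ.2

lemma inner_bdry_self (ξ : Bdry n) :
    ⟪(ξ : EuclideanSpace ℝ (Fin n)), (ξ : EuclideanSpace ℝ (Fin n))⟫ = 1 := by
  rw [real_inner_self_eq_norm_sq, norm_bdry, one_pow]

/-- The hyperplane orthogonal to `ξ`. -/
abbrev perp (ξ : Bdry n) : Submodule ℝ (EuclideanSpace ℝ (Fin n)) :=
  (ℝ ∙ (ξ : EuclideanSpace ℝ (Fin n)))ᗮ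

lemma inner_perp (ξ : Bdry n) (w : perp ξ) : ⟪(w : EuclideanSpace ℝ (Fin n)), (ξ : EuclideanSpace ℝ (Fin n))⟫ = 0 :=
  Submodule.mem_orthogonal_singleton_iff_inner_left.1 w.2

lemma finrank_perp (ξ : Bdry n) : Module.finrank ℝ (perp ξ) = n - 1 := by
  have h1 := Submodule.finrank_add_finrank_orthogonal (ℝ ∙ (ξ : EuclideanSpace ℝ (Fin n)))
  rw [finrank_span_singleton (by
    intro h; have := norm_bdry ξ; rw [h, norm_zero] at this; norm_num at this),
    finrank_euclideanSpace_fin] at h1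
  unfold perp
  omega

lemma hor_eq_dep (ξ : Bdry n) (x : Hyp n) : hor ξ x = dep 1 (ξ : EuclideanSpace ℝ (Fin n)) x.pt.2 := by
  rw [dep, hgt_snd]
  simp [hor, mink, lightVec]

lemma continuous_hor_right (ξ : Bdry n) : Continuous (hor ξ) :=
  (Continuous.mink' continuous_pt continuous_const).neg

/-- The isometric parametrisation of the horosphere `hor ξ = s`. -/
def horoPt (s : ℝ) (ξ : Bdry n) (w : perp ξ) : Hyp n :=
  sheetPt ((((1 + ‖w‖ ^ 2) / s - s) / 2) • (ξ : EuclideanSpace ℝ (Fin n)) + w)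

lemma continuous_horoPt (s : ℝ) (ξ : Bdry n) : Continuous (horoPt s ξ) := by
  refine continuous_sheetPt.comp ?_
  fun_prop

lemma horoPt_fst {s : ℝ} (hs : 0 < s) (ξ : Bdry n) (w : perp ξ) :
    (horoPt s ξ w).pt.1 = ((1 + ‖w‖ ^ 2) / s + s) / 2 := by
  change √_ = _
  rw [Real.sqrt_eq_iff_eq_sq (by positivity) (by positivity), norm_add_sq_real,
    real_inner_smul_left, real_inner_comm, inner_perp, norm_smul, norm_bdry, mul_one,
    Real.norm_eq_abs, sq_abs, Submodule.coe_norm]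
  field_simp
  ring

lemma hor_horoPt {s : ℝ} (hs : 0 < s) (ξ : Bdry n) (w : perp ξ) : hor ξ (horoPt s ξ w) = s := by
  rw [hor_eq_dep, dep, hgt_snd, horoPt_fst hs]
  change _ - ⟪_ + (w : EuclideanSpace ℝ (Fin n)), _⟫ = s
  rw [inner_add_left, real_inner_smul_left, inner_bdry_self, inner_perp]
  ring

/-- The linear part of a point of hyperbolic space orthogonal to `ξ`. -/
def perpPart (ξ : Bdry n) (x : Hyp n) : perp ξ := (perp ξ).orthogonalProjectionOnto x.pt.2

lemma continuous_perpPart (ξ : Bdry n) : Continuous (perpPart ξ) := by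
  unfold perpPart
  exact (ContinuousLinearMap.continuous _).comp continuous_snd_pt

lemma perpPart_decomp (ξ : Bdry n) (z : EuclideanSpace ℝ (Fin n)) :
    z = ⟪z, (ξ : EuclideanSpace ℝ (Fin n))⟫ • (ξ : EuclideanSpace ℝ (Fin n)) +
      ((perp ξ).orthogonalProjectionOnto z : EuclideanSpace ℝ (Fin n)) := by
  have h := Submodule.starProjection_add_starProjection_orthogonal
    (K := ℝ ∙ (ξ : EuclideanSpace ℝ (Fin n))) z
  rw [Submodule.starProjection_unit_singleton ℝ (norm_bdry ξ), real_inner_comm] at h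
  exact h.symm

lemma perpPart_horoPt (s : ℝ) (ξ : Bdry n) (w : perp ξ) : perpPart ξ (horoPt s ξ w) = w := by
  change (perp ξ).orthogonalProjectionOnto (_ • (ξ : EuclideanSpace ℝ (Fin n)) + w) = w
  rw [map_add, map_smul, Submodule.orthogonalProjectionOnto_orthogonal_apply_eq_zero
      (Submodule.mem_span_singleton_self _), smul_zero, zero_add]
  exact Submodule.orthogonalProjectionOnto_mem_subspace_eq_self w

lemma norm_snd_sq (ξ : Bdry n) (z : EuclideanSpace ℝ (Fin n)) : ‖z‖ ^ 2 =
    ⟪z, (ξ : EuclideanSpace ℝ (Fin n))⟫ ^ 2 + ‖(perp ξ).orthogonalProjectionOnto z‖ ^ 2 := by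
  have h : ⟪(ξ : EuclideanSpace ℝ (Fin n)),
      ((perp ξ).orthogonalProjectionOnto z : EuclideanSpace ℝ (Fin n))⟫ = 0 := by
    rw [real_inner_comm]; exact inner_perp ξ _
  conv_lhs => rw [perpPart_decomp ξ z]
  rw [norm_add_sq_real, real_inner_smul_left, h, norm_smul, norm_bdry,
    mul_one, Real.norm_eq_abs, sq_abs, Submodule.coe_norm]
  ring

lemma horoPt_perpPart (ξ : Bdry n) (x : Hyp n) : horoPt (hor ξ x) ξ (perpPart ξ x) = x := by
  have h1 := norm_snd_sq ξ x.pt.2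
  have h2 := hor_eq_dep ξ x
  rw [dep, hgt_snd] at h2
  have h3 := x.norm_sq
  have h4 := hor_pos ξ x
  conv_rhs => rw [← sheetPt_snd x, perpPart_decomp ξ x.pt.2]
  rw [horoPt]
  congr 3
  rw [div_sub' h4.ne', div_div, div_eq_iff (by positivity)]
  change 1 + ‖(perp ξ).orthogonalProjectionOnto x.pt.2‖ ^ 2 - _ = _
  rw [h2]
  linear_combination h3 - h1

lemma range_horoPt {s : ℝ} (hs : 0 < s) (ξ : Bdry n) : range (horoPt s ξ) = {x | hor ξ x = s} := by
  ext x
  constructor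
  · rintro ⟨w, rfl⟩; exact hor_horoPt hs ξ w
  · rintro rfl; exact ⟨_, horoPt_perpPart ξ x⟩

/-- On a horosphere the Minkowski chord is exactly the Euclidean distance of the parameters. The
parametrisation is thus almost isometric at small scale, uniformly in the point, and no transport by
symmetries is needed. -/
lemma two_mul_cosh_dist_horoPt {s : ℝ} (hs : 0 < s) (ξ : Bdry n) (w w' : perp ξ) :
    2 * (Real.cosh (dist (horoPt s ξ w) (horoPt s ξ w')) - 1) = dist w w' ^ 2 := by
  rw [two_mul_cosh_dist_sub_one, horoPt_fst hs, horoPt_fst hs, norm_snd_sq ξ, map_sub, ← perpPart,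
    ← perpPart, perpPart_horoPt, perpPart_horoPt, dist_eq_norm, inner_sub_left]
  have h : ∀ w : perp ξ, ⟪(horoPt s ξ w).pt.2, (ξ : EuclideanSpace ℝ (Fin n))⟫ =
      ((1 + ‖w‖ ^ 2) / s - s) / 2 := by
    intro w
    change ⟪_ + (w : EuclideanSpace ℝ (Fin n)), _⟫ = _
    rw [inner_add_left, real_inner_smul_left, inner_bdry_self, inner_perp]
    ring
  rw [h, h]
  ring

/-- The Riemannian measure of a horosphere. -/
lemma euclideanHausdorffMeasure_restrict_horosphere {s : ℝ} (hs : 0 < s) (ξ : Bdry n) :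
    (μHE[n - 1] : Measure (Hyp n)).restrict {x | hor ξ x = s} =
      (volume : Measure (perp ξ)).map (horoPt s ξ) := by
  rw [← finrank_perp ξ]
  set k := Module.finrank ℝ (perp ξ)
  have hφm := (continuous_horoPt s ξ).measurable
  set φ := horoPt s ξ
  have hlocal : ∀ r, 0 < r → ∀ x A, A ⊆ Metric.ball x r → MeasurableSet A →
      (μHE[k] : Measure (Hyp n)).restrict {x | hor ξ x = s} A ≤
        ENNReal.ofReal 1 * (volume : Measure (perp ξ)).map φ A ∧
      (volume : Measure (perp ξ)).map φ A ≤ ENNReal.ofReal (Real.exp (r ^ 2) ^ k) *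
        (μHE[k] : Measure (Hyp n)).restrict {x | hor ξ x = s} A := by
    intro r hr x A hAr hA
    rw [Measure.restrict_apply hA, ← range_horoPt hs, ← image_preimage_eq_inter_range,
      Measure.map_apply hφm hA]
    constructor
    · rw [ENNReal.ofReal_one, one_mul]
      refine euclideanHausdorffMeasure_image_le fun y _ y' _ => ?_
      refine le_of_sq_le_sq ((sq_le_two_mul_cosh_sub_one dist_nonneg).trans ?_) dist_nonneg
      exact (two_mul_cosh_dist_horoPt hs ξ y y').le
    · refine volume_le_euclideanHausdorffMeasure_image (by positivity) fun y hy y' hy' => ?_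
      refine le_of_sq_le_sq ?_ (by positivity)
      rw [← two_mul_cosh_dist_horoPt hs ξ y y', mul_pow]
      set d := dist (φ y) (φ y')
      have hd : d ≤ 2 * r := by
        have h1 : dist (φ y) x < r := hAr hy
        have h2 : dist (φ y') x < r := hAr hy'
        have := dist_triangle_right (φ y) (φ y') x
        linarith
      have hd0 : 0 ≤ d := dist_nonneg
      refine (two_mul_cosh_sub_one_le d).trans ?_
      rw [mul_comm]
      refine mul_le_mul_of_nonneg_right ?_ (sq_nonneg _)
      rw [← Real.exp_nat_mul]
      apply Real.exp_le_exp.2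
      push_cast
      nlinarith
  refine le_antisymm (measure_le_of_local_le (K := fun _ => 1) tendsto_const_nhds
    fun r hr x A h1 h2 => (hlocal r hr x A h1 h2).1) (measure_le_of_local_le
    (K := fun r => Real.exp (r ^ 2) ^ k) ?_ fun r hr x A h1 h2 => (hlocal r hr x A h1 h2).2)
  have : Continuous fun r : ℝ => Real.exp (r ^ 2) ^ k := by fun_prop
  have h := this.tendsto 0
  simp only [ne_eq, OfNat.ofNat_ne_zero, not_false_eq_true, zero_pow,
    Real.exp_zero, one_pow] at h
  exact h.mono_left nhdsWithin_le_nhds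

/-- The retraction of hyperbolic space along the geodesics ending at `ξ` onto the horosphere
`hor ξ = s`. -/
def horoRetract (s : ℝ) (ξ : Bdry n) (x : Hyp n) : Hyp n :=
  horoPt s ξ ((s / hor ξ x) • perpPart ξ x)

lemma measurable_horoRetract (s : ℝ) (ξ : Bdry n) : Measurable (horoRetract s ξ) := by
  have h1 := (continuous_horoPt s ξ).measurable
  have h2 := (continuous_perpPart ξ).measurable
  have h3 := (continuous_hor_right ξ).measurable
  exact h1.comp ((measurable_const.div h3).smul h2)

/-- The Riemannian measure of hyperbolic space in sheet coordinates. -/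
lemma euclideanHausdorffMeasure_eq_map_lam :
    (μHE[n] : Measure (Hyp n)) = (lam 1).map (sheetPt : EuclideanSpace ℝ (Fin n) → Hyp n) := by
  have h := euclideanHausdorffMeasure_restrict_geo (n := n) ⊤
  have hgeo : geo (⊤ : Submodule ℝ (EuclideanSpace ℝ (Fin n))) = univ := eq_univ_of_forall fun x => trivial
  rw [hgeo, Measure.restrict_univ, finrank_top, finrank_euclideanSpace_fin] at h
  rw [h]
  set L : (⊤ : Submodule ℝ (EuclideanSpace ℝ (Fin n))) ≃ₗᵢ[ℝ] EuclideanSpace ℝ (Fin n) :=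
    LinearIsometryEquiv.ofTop _ ⊤ rfl
  have hL : MeasurePreserving L (lam 1) (lam 1) := by
    refine ⟨L.continuous.measurable, Measure.ext_of_lintegral _ fun f hf => ?_⟩
    rw [lintegral_map hf L.continuous.measurable, lintegral_lam 1 hf,
      lintegral_lam 1 (show Measurable fun z => f (L z) from hf.comp L.continuous.measurable),
      ← L.measurePreserving.lintegral_comp
        (show Measurable fun z : EuclideanSpace ℝ (Fin n) => ENNReal.ofReal (hgt 1 z)⁻¹ * f z from
          (measurable_hgt 1).inv.ennreal_ofReal.mul hf)]
    rfl
  rw [← hL.map_eq, Measure.map_map continuous_sheetPt.measurable hL.measurable]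
  rfl

/-- The slab formula on the hyperboloid: there `dep 1` is `hor ξ`, which is always positive. -/
lemma lintegral_horoRetract (hn : 2 ≤ n) {s a : ℝ} (hs : 0 < s) (ha : 0 < a) (ξ : Bdry n)
    {f : Hyp n → ℝ≥0∞} (hf : Measurable f) :
    ∫⁻ x in {x | hor ξ x < a}, f (horoRetract s ξ x) ∂(μHE[n] : Measure (Hyp n)) =
      ENNReal.ofReal ((a / s) ^ (n - 1) / (n - 1 : ℕ)) *
        ∫⁻ x in {x | hor ξ x = s}, f x ∂(μHE[n - 1] : Measure (Hyp n)) := by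
  have hr := measurable_horoRetract s ξ
  have hφ := (continuous_horoPt s ξ).measurable
  have hsm : Measurable (sheetPt : EuclideanSpace ℝ (Fin n) → Hyp n) := continuous_sheetPt.measurable
  have hS : MeasurableSet {x | hor ξ x < a} :=
    measurableSet_lt (continuous_hor_right ξ).measurable measurable_const
  rw [euclideanHausdorffMeasure_eq_map_lam,
    setLIntegral_map hS (show Measurable fun x => f (horoRetract s ξ x) from hf.comp hr) hsm,
    euclideanHausdorffMeasure_restrict_horosphere hs, lintegral_map hf hφ]
  have key := lintegral_lam_horosphere zero_le_one (norm_bdry ξ)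
    (by rwa [finrank_euclideanSpace_fin]) hs ha (hf.comp hφ)
  rw [finrank_euclideanSpace_fin] at key
  simp only [Function.comp_apply] at key
  rw [← key]
  have hset : sheetPt ⁻¹' {x | hor ξ x < a} =
      {z : EuclideanSpace ℝ (Fin n) | 0 < dep 1 (ξ : EuclideanSpace ℝ (Fin n)) z ∧
        dep 1 (ξ : EuclideanSpace ℝ (Fin n)) z < a} := by
    ext z
    rw [mem_preimage, mem_ofPred_eq, hor_eq_dep]
    have h1 := hor_pos ξ (sheetPt z)
    rw [hor_eq_dep] at h1
    exact ⟨fun h => ⟨h1, h⟩, fun h => h.2⟩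
  rw [hset]
  simp only [horoRetract, hor_eq_dep]
  rfl

/-- The volume of a horoball fibres over its boundary horosphere. -/
lemma map_horoRetract_horoball (hn : 2 ≤ n) {s : ℝ} (hs : 0 < s) (ξ : Bdry n) :
    ((μHE[n] : Measure (Hyp n)).restrict {x | hor ξ x ≤ s}).map (horoRetract s ξ) =
      ENNReal.ofReal (1 / (n - 1 : ℕ)) • (μHE[n - 1] : Measure (Hyp n)).restrict {x | hor ξ x = s} := by
  have hn' : (0 : ℝ) < (n - 1 : ℕ) := by
    have : 0 < n - 1 := by omega
    exact_mod_cast this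
  refine Measure.ext_of_lintegral _ fun f hf => ?_
  rw [lintegral_map hf (measurable_horoRetract s ξ), lintegral_smul_measure, smul_eq_mul]
  refine le_antisymm ?_ ?_
  -- The closed horoball is squeezed between the open one at s and the open ones at a > s, so that
  -- the nullity of the horosphere need not be proved.
  · have hlim : Tendsto (fun a : ℝ => ENNReal.ofReal ((a / s) ^ (n - 1) / (n - 1 : ℕ)) *
        ∫⁻ x in {x | hor ξ x = s}, f x ∂(μHE[n - 1] : Measure (Hyp n))) (𝓝[>] s)
        (𝓝 (ENNReal.ofReal (1 / (n - 1 : ℕ)) *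
          ∫⁻ x in {x | hor ξ x = s}, f x ∂(μHE[n - 1] : Measure (Hyp n)))) := by
      refine ENNReal.Tendsto.mul_const ?_ (Or.inl ?_)
      · refine ENNReal.tendsto_ofReal ?_
        have hc : Continuous fun a : ℝ => (a / s) ^ (n - 1) / (n - 1 : ℕ) := by fun_prop
        have := hc.tendsto s
        rw [div_self hs.ne', one_pow] at this
        exact this.mono_left nhdsWithin_le_nhds
      · exact (ENNReal.ofReal_pos.2 (by positivity)).ne'
    refine ge_of_tendsto hlim ?_
    filter_upwards [self_mem_nhdsWithin] with a ha
    have ha' : s < a := ha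
    rw [← lintegral_horoRetract hn hs (hs.trans ha') ξ hf]
    exact lintegral_mono_set fun x (hx : hor ξ x ≤ s) => hx.trans_lt ha'
  · have h := lintegral_horoRetract hn hs hs ξ hf
    rw [div_self hs.ne', one_pow] at h
    rw [← h]
    exact lintegral_mono_set fun x (hx : hor ξ x < s) => hx.le

/-- This expression involves only x, its height and the vector (1, ξ), which makes equivariance
under isometries fixing that vector visible. -/
lemma horoRetract_pt {s : ℝ} (hs : 0 < s) (ξ : Bdry n) (x : Hyp n) : (horoRetract s ξ x).pt =
    (s / hor ξ x) • x.pt + ((1 - (s / hor ξ x) ^ 2) / (2 * s)) • lightVec ξ := by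
  have hh := hor_pos ξ x
  have h1 := norm_snd_sq ξ x.pt.2
  have h2 := hor_eq_dep ξ x
  rw [dep, hgt_snd] at h2
  have h3 := x.norm_sq
  have h4 : ⟪x.pt.2, (ξ : EuclideanSpace ℝ (Fin n))⟫ = x.pt.1 - hor ξ x := by linarith
  have h5 : ‖(s / hor ξ x) • perpPart ξ x‖ ^ 2 =
      (s / hor ξ x) ^ 2 * (2 * x.pt.1 * hor ξ x - hor ξ x ^ 2 - 1) := by
    rw [norm_smul, mul_pow, Real.norm_eq_abs, sq_abs]
    congr 1
    rw [h3, h4] at h1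
    change ‖(perp ξ).orthogonalProjectionOnto x.pt.2‖ ^ 2 = _
    linear_combination -h1
  refine Prod.ext ?_ ?_
  · rw [horoRetract, horoPt_fst hs, h5]
    simp only [Prod.fst_add, Prod.smul_fst, smul_eq_mul, lightVec]
    field_simp
    ring
  · change (((1 + ‖(s / hor ξ x) • perpPart ξ x‖ ^ 2) / s - s) / 2) •
      (ξ : EuclideanSpace ℝ (Fin n)) + (((s / hor ξ x) • perpPart ξ x : perp ξ) :
        EuclideanSpace ℝ (Fin n)) = (s / hor ξ x) • x.pt.2 + _ • (ξ : EuclideanSpace ℝ (Fin n))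
    conv_rhs => rw [perpPart_decomp ξ x.pt.2]
    rw [h5, h4, Submodule.coe_smul]
    change _ + (s / hor ξ x) • (perpPart ξ x : EuclideanSpace ℝ (Fin n)) =
      (s / hor ξ x) • (_ + (perpPart ξ x : EuclideanSpace ℝ (Fin n))) + _
    rw [smul_add, smul_smul, add_right_comm, ← add_smul]
    congr 2
    field_simp
    ring

end Horosphere

/-! ### Strict fundamental domains and descent of invariant measures. -/

section Quotient

variable {G X Y : Type*} [Group G] [MulAction G X] [MeasurableSpace X] [MulAction G Y]
  [MeasurableSpace Y]

/-- A measurable strict fundamental domain of a free action. -/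
structure IsFund (G : Type*) {X : Type*} [Group G] [MulAction G X] [MeasurableSpace X]
    (F : Set X) : Prop where
  measurableSet : MeasurableSet F
  existsUnique : ∀ x, ∃! g : G, g • x ∈ F

/-- The projection to the space of orbits. -/
abbrev orbitMk (G : Type*) {X : Type*} [Group G] [MulAction G X] (x : X) :
    Quotient (MulAction.orbitRel G X) := Quotient.mk (MulAction.orbitRel G X) x

lemma orbitMk_smul (g : G) (x : X) : orbitMk G (g • x) = orbitMk G x :=
  Quotient.sound ⟨g, rfl⟩

lemma orbitMk_eq_iff {x y : X} : orbitMk G x = orbitMk G y ↔ ∃ g : G, g • y = x := Quotient.eq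

lemma IsFund.eq_of_mem {F : Set X} (hF : IsFund G F) {g h : G} {x : X} (hg : g • x ∈ F)
    (hh : h • x ∈ F) : g = h := (hF.existsUnique x).unique hg hh

lemma IsFund.preimage {F : Set Y} (hF : IsFund G F) {f : X → Y} (hf : Measurable f)
    (hfG : ∀ (g : G) x, f (g • x) = g • f x) : IsFund G (f ⁻¹' F) := by
  refine ⟨hf hF.measurableSet, fun x => ?_⟩
  simp only [mem_preimage, hfG]
  exact hF.existsUnique _

lemma quotientMeasure_apply_eq_iSup (m : Measure X) {B : Set (Quotient (MulAction.orbitRel G X))}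
    (hB : MeasurableSet B) : quotientMeasure G m B =
      ⨆ A : {A : Set X // MeasurableSet A ∧ InjOn (orbitMk G) A ∧ A ⊆ orbitMk G ⁻¹' B}, m A.1 := by
  unfold quotientMeasure descend
  rw [Measure.ofMeasurable_apply _ hB]

/-- The supremum defining the quotient measure is attained by the fundamental domain. Any competitor
is cut according to the group element moving each point into F; the moved pieces are disjoint
because the competitor meets each orbit at most once. -/
lemma quotientMeasure_apply [Countable G] [MeasurableConstSMul G X] {F : Set X} (hF : IsFund G F)
    {m : Measure X} (hm : ∀ g : G, m.map (g • ·) = m)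
    {B : Set (Quotient (MulAction.orbitRel G X))} (hB : MeasurableSet B) :
    quotientMeasure G m B = m (F ∩ orbitMk G ⁻¹' B) := by
  rw [quotientMeasure_apply_eq_iSup m hB]
  refine le_antisymm (iSup_le ?_) ?_
  · rintro ⟨A, hA, hinj, hsub⟩
    have hmeas : ∀ g : G, MeasurableSet (A ∩ (g • ·) ⁻¹' F) := fun g =>
      hA.inter (measurable_const_smul g hF.measurableSet)
    have h1 : A = ⋃ g : G, A ∩ (g • ·) ⁻¹' F := by
      rw [← inter_iUnion, eq_comm, inter_eq_left]
      intro x _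
      obtain ⟨g, hg, -⟩ := hF.existsUnique x
      exact mem_iUnion.2 ⟨g, hg⟩
    have h2 : ∀ g : G, m (A ∩ (g • ·) ⁻¹' F) = m ((g⁻¹ • ·) ⁻¹' (A ∩ (g • ·) ⁻¹' F)) := fun g => by
      conv_lhs => rw [← hm g⁻¹]
      exact Measure.map_apply (measurable_const_smul _) (hmeas g)
    calc m A ≤ ∑' g : G, m (A ∩ (g • ·) ⁻¹' F) := by
            conv_lhs => rw [h1]
            exact measure_iUnion_le _
      _ = m (⋃ g : G, (g⁻¹ • ·) ⁻¹' (A ∩ (g • ·) ⁻¹' F)) := by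
          simp_rw [h2]
          refine (measure_iUnion ?_ fun g => measurable_const_smul g⁻¹ (hmeas g)).symm
          intro g h hgh
          refine disjoint_left.2 ?_
          rintro y ⟨hy1, hy2⟩ ⟨hy3, hy4⟩
          have := hinj hy1 hy3 (by rw [orbitMk_smul, orbitMk_smul])
          refine hgh (inv_injective (inv_injective ?_))
          rw [inv_inv, inv_inv]
          refine hF.eq_of_mem hy2 ?_
          change h • g⁻¹ • y ∈ F
          have e : g⁻¹ • y = h⁻¹ • y := this
          rw [e]; exact hy4
      _ ≤ m (F ∩ orbitMk G ⁻¹' B) := by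
          refine measure_mono (iUnion_subset fun g => ?_)
          rintro y ⟨hy1, hy2⟩
          refine ⟨?_, ?_⟩
          · have : g • g⁻¹ • y ∈ F := hy2
            rwa [smul_inv_smul] at this
          · have : orbitMk G (g⁻¹ • y) ∈ B := hsub hy1
            rwa [orbitMk_smul] at this
  · refine le_iSup_of_le ⟨F ∩ orbitMk G ⁻¹' B, hF.measurableSet.inter hB, ?_, inter_subset_right⟩
      le_rfl
    rintro x ⟨hx, -⟩ y ⟨hy, -⟩ hxy
    obtain ⟨g, rfl⟩ := orbitMk_eq_iff.1 hxy
    have := hF.eq_of_mem (g := g) (h := 1) hx (by rwa [one_smul])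
    rw [this, one_smul]

lemma quotientMeasure_smul [Countable G] [MeasurableConstSMul G X] {F : Set X} (hF : IsFund G F)
    {m : Measure X} (hm : ∀ g : G, m.map (g • ·) = m) (c : ℝ≥0∞) :
    quotientMeasure G (c • m) = c • quotientMeasure G m := by
  refine Measure.ext fun B hB => ?_
  rw [quotientMeasure_apply hF (fun g => by rw [Measure.map_smul, hm]) hB, Measure.smul_apply,
    Measure.smul_apply, quotientMeasure_apply hF hm hB]

/-- Total masses of quotient measures are preserved by equivariant maps. -/
lemma quotientMeasure_map_univ [Countable G] [MeasurableConstSMul G X] [MeasurableConstSMul G Y]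
    {F : Set Y} (hF : IsFund G F) {m : Measure X} (hm : ∀ g : G, m.map (g • ·) = m) {f : X → Y}
    (hf : Measurable f) (hfG : ∀ (g : G) x, f (g • x) = g • f x) :
    quotientMeasure G (m.map f) univ = quotientMeasure G m univ := by
  have hm' : ∀ g : G, (m.map f).map (g • ·) = m.map f := fun g => by
    conv_rhs => rw [← hm g, Measure.map_map hf (measurable_const_smul g)]
    rw [Measure.map_map (measurable_const_smul g) hf]
    congr 1
    ext x
    exact (hfG g x).symm
  rw [quotientMeasure_apply hF hm' MeasurableSet.univ,
    quotientMeasure_apply (hF.preimage hf hfG) hm MeasurableSet.univ, preimage_univ, preimage_univ,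
    inter_univ, inter_univ, Measure.map_apply hf hF.measurableSet]

/-- The fundamental domain of a subgroup made of translates of a fundamental domain. -/
def subFund (H : Subgroup G) (F : Set X) : Set X := ⋃ q : G ⧸ H, (q.out • ·) ⁻¹' F

lemma IsFund.subFund [Countable G] [MeasurableConstSMul G X] {F : Set X} (hF : IsFund G F)
    (H : Subgroup G) : IsFund H (subFund H F) := by
  have : Countable (G ⧸ H) := Quotient.countable
  refine ⟨MeasurableSet.iUnion fun q => measurable_const_smul q.out hF.measurableSet, fun x => ?_⟩
  obtain ⟨g, hg, hu⟩ := hF.existsUnique x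
  -- The unique g moving x into F factors uniquely as a chosen coset representative times an element
  -- of H.
  have key : ∀ h : H, h • x ∈ HypSkin.subFund H F ↔ ∃ q : G ⧸ H, q.out * (h : G) = g := by
    intro h
    rw [HypSkin.subFund, mem_iUnion]
    refine exists_congr fun q => ⟨fun hq => hu _ ?_, fun hq => ?_⟩
    · change (q.out * (h : G)) • x ∈ F
      rw [mul_smul]; exact hq
    · change q.out • (h : G) • x ∈ F
      rw [← mul_smul, hq]; exact hg
  have hout : ((g : G ⧸ H).out)⁻¹ * g ∈ H := by
    rw [← QuotientGroup.eq, QuotientGroup.out_eq']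
  refine ⟨⟨_, hout⟩, (key _).2 ⟨(g : G ⧸ H), by simp⟩, fun h hh => ?_⟩
  obtain ⟨q, hq⟩ := (key h).1 hh
  have hqg : q = (g : G ⧸ H) := by
    conv_lhs => rw [← QuotientGroup.out_eq' q]
    rw [QuotientGroup.eq, ← hq, inv_mul_cancel_left]
    exact h.2
  refine Subtype.ext ?_
  change (h : G) = ((g : G ⧸ H).out)⁻¹ * g
  rw [← hqg, ← hq, inv_mul_cancel_left]

/-- Translation by g permutes the cosets; the resulting change of representatives lies in H and
leaves ν unchanged. -/
lemma sum_out_invariant [MeasurableConstSMul G X] (H : Subgroup G) {ν : Measure X}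
    (hν : ∀ h : H, ν.map (h • ·) = ν) (g : G) :
    (Measure.sum fun q : G ⧸ H => ν.map fun x => q.out • x).map (g • ·) =
      Measure.sum fun q : G ⧸ H => ν.map fun x => q.out • x := by
  have hgm := measurable_const_smul (α := X) g
  rw [Measure.map_sum hgm.aemeasurable]
  have h1 : ∀ q : G ⧸ H, (ν.map fun x => q.out • x).map (g • ·) = ν.map fun x => (g • q).out • x := by
    intro q
    have hmem : ((g • q).out)⁻¹ * (g * q.out) ∈ H := by
      rw [← QuotientGroup.eq, QuotientGroup.out_eq', ← smul_eq_mul g,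
        MulAction.Quotient.mk_smul_out]
    have hν' : ν.map (fun x => (((g • q).out)⁻¹ * (g * q.out)) • x) = ν := hν ⟨_, hmem⟩
    conv_rhs => rw [← hν', Measure.map_map (measurable_const_smul _) (measurable_const_smul _)]
    rw [Measure.map_map hgm (measurable_const_smul _)]
    congr 1
    ext x
    change g • q.out • x = (g • q).out • ((((g • q).out)⁻¹ * (g * q.out)) • x)
    rw [mul_smul, smul_inv_smul, mul_smul]
  simp_rw [h1]
  exact Measure.sum_comp_equiv (MulAction.toPerm g) (fun q : G ⧸ H => ν.map fun x => q.out • x)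

/-- Descending the sum of the translates of an `H`-invariant measure to `G \ X` amounts to
descending the measure to `H \ X` and mapping it to `G \ X`. -/
lemma quotientMeasure_sum [Countable G] [MeasurableConstSMul G X] {F : Set X} (hF : IsFund G F)
    (H : Subgroup G) {ν : Measure X} (hν : ∀ h : H, ν.map (h • ·) = ν)
    {p : Quotient (MulAction.orbitRel H X) → Quotient (MulAction.orbitRel G X)}
    (hp : ∀ x, p (orbitMk H x) = orbitMk G x) :
    quotientMeasure G (Measure.sum fun q : G ⧸ H => ν.map fun x => q.out • x) =
      (quotientMeasure H ν).map p := by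
  have hpm : Measurable p := by
    intro B hB
    change MeasurableSet (orbitMk H ⁻¹' (p ⁻¹' B))
    have : orbitMk H ⁻¹' (p ⁻¹' B) = (orbitMk G ⁻¹' B : Set X) := by
      ext x; simp only [mem_preimage, hp]
    rw [this]; exact hB
  have : Countable (G ⧸ H) := Quotient.countable
  refine Measure.ext fun B hB => ?_
  have hBG : MeasurableSet (orbitMk G ⁻¹' B : Set X) := hB
  have : MeasurableConstSMul H X := ⟨fun h => measurable_const_smul h.1⟩
  rw [Measure.map_apply hpm hB, quotientMeasure_apply hF (sum_out_invariant H hν) hB,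
    quotientMeasure_apply (hF.subFund H) hν (hpm hB), ← preimage_comp]
  have hcomp : p ∘ (orbitMk H : X → _) = orbitMk G := funext hp
  rw [hcomp, Measure.sum_apply _ (hF.measurableSet.inter hBG), subFund, iUnion_inter,
    measure_iUnion]
  · refine tsum_congr fun q => ?_
    rw [Measure.map_apply (measurable_const_smul _) (hF.measurableSet.inter hBG), preimage_inter]
    congr 2
    ext x
    simp only [mem_preimage, orbitMk_smul]
  · intro q q' hqq
    refine disjoint_left.2 ?_
    rintro x ⟨h1, -⟩ ⟨h2, -⟩
    apply hqq
    rw [← QuotientGroup.out_eq' q, ← QuotientGroup.out_eq' q']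
    congr 1
    exact hF.eq_of_mem h1 h2
  · exact fun q => (measurable_const_smul _ hF.measurableSet).inter hBG

/-- A free properly discontinuous action of a countable group has a strict fundamental domain. -/
lemma exists_isFund [Countable G] [TopologicalSpace X] [BorelSpace X] [SecondCountableTopology X]
    [ContinuousConstSMul G X] [Nonempty X]
    (h : ∀ x : X, ∃ U : Set X, IsOpen U ∧ x ∈ U ∧ ∀ g : G, ∀ y ∈ U, g • y ∈ U → g = 1) :
    ∃ F : Set X, IsFund G F := by
  choose U hU hxU hfree using h
  obtain ⟨s, hs, hcov⟩ := TopologicalSpace.countable_cover_nhds fun x => (hU x).mem_nhds (hxU x)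
  have hne : s.Nonempty := by
    by_contra hc
    rw [not_nonempty_iff_eq_empty] at hc
    rw [hc, biUnion_empty] at hcov
    exact empty_ne_univ hcov
  obtain ⟨u, rfl⟩ := hs.exists_eq_range hne
  rw [biUnion_range] at hcov
  -- From each orbit keep the point lying in the first set of the countable cover that the orbit
  -- meets; it is unique since no nontrivial element sends a point of such a set into the same set.
  refine ⟨⋃ i, U (u i) ∩ ⋂ j, ⋂ _ : j < i, ⋂ g : G, (g • ·) ⁻¹' (U (u j))ᶜ,
    ?_, fun x => ?_⟩
  · refine MeasurableSet.iUnion fun i => (hU _).measurableSet.inter (MeasurableSet.iInter fun j =>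
      MeasurableSet.iInter fun _ => MeasurableSet.iInter fun g => ?_)
    exact ((continuous_const_smul g).measurable) (hU _).measurableSet.compl
  · simp only [mem_iUnion, mem_inter_iff, mem_iInter, mem_preimage, mem_compl_iff]
    have hex : ∃ i, ∃ g : G, g • x ∈ U (u i) := by
      have : x ∈ ⋃ i, U (u i) := hcov ▸ mem_univ x
      obtain ⟨i, hi⟩ := mem_iUnion.1 this
      exact ⟨i, 1, by rwa [one_smul]⟩
    classical
    obtain ⟨g, hg⟩ := Nat.find_spec hex
    have hmin := fun j (hj : j < Nat.find hex) => not_exists.1 (Nat.find_min hex hj)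
    refine ⟨g, ⟨Nat.find hex, hg, fun j hj k hk => hmin j hj (k * g) (by rwa [mul_smul])⟩, ?_⟩
    rintro k ⟨i, hi, hi'⟩
    have hi1 : i = Nat.find hex := by
      refine le_antisymm ?_ (Nat.find_min' hex ⟨k, hi⟩)
      by_contra hc
      push Not at hc
      refine hi' _ hc (g * k⁻¹) ?_
      rwa [smul_smul, inv_mul_cancel_right]
    have := hfree (u i) (k * g⁻¹) (g • x) (hi1 ▸ hg) (by rwa [smul_smul, inv_mul_cancel_right])
    exact mul_inv_eq_one.1 this

end Quotient

/-! ### Discrete torsion-free groups act freely and properly discontinuously. -/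

section Group

variable {n : ℕ} {Γ : Subgroup (Lorentz n)}

lemma IsHyperbolicManifoldGroup.countable (hΓ : IsHyperbolicManifoldGroup Γ) : Countable Γ := by
  have h : (Γ : Set (Lorentz n)) ⊆ ⋃ k : ℕ, {γ | γ ∈ Γ ∧ dist (origin n) (γ • origin n) ≤ k} := by
    intro γ hγ
    obtain ⟨k, hk⟩ := exists_nat_ge (dist (origin n) (γ • origin n))
    exact mem_iUnion.2 ⟨k, hγ, hk⟩
  exact ((countable_iUnion fun k : ℕ => (hΓ.discrete (origin n) k).countable).mono h).to_subtype

/-- All powers of γ fix x, hence form a finite set by discreteness with radius 0; two of them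
coincide and torsion-freeness applies. -/
lemma IsHyperbolicManifoldGroup.eq_one_of_smul_eq (hΓ : IsHyperbolicManifoldGroup Γ) {γ : Lorentz n}
    (hγ : γ ∈ Γ) {x : Hyp n} (h : γ • x = x) : γ = 1 := by
  have hpow : ∀ m : ℕ, γ ^ m • x = x := fun m => by
    induction m with
    | zero => rw [pow_zero, one_smul]
    | succ m ih => rw [pow_succ, mul_smul, h, ih]
  have hfin : (range fun m : ℕ => γ ^ m).Finite := by
    refine (hΓ.discrete x 0).subset ?_
    rintro _ ⟨m, rfl⟩
    exact ⟨pow_mem hγ m, by rw [hpow, dist_self]⟩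
  have hninj : ¬ Function.Injective fun m : ℕ => γ ^ m := fun hinj =>
    infinite_range_of_injective hinj hfin
  rw [Function.Injective] at hninj
  push Not at hninj
  obtain ⟨a, b, hab, hne⟩ := hninj
  wlog hlt : a < b generalizing a b
  · exact this b a hab.symm hne.symm (lt_of_le_of_ne (not_lt.1 hlt) hne.symm)
  refine hΓ.torsionFree γ hγ (b - a) (by omega) ?_
  have h1 : γ ^ b = γ ^ (b - a) * γ ^ a := by rw [← pow_add]; congr 1; omega
  have h2 : γ ^ a = γ ^ b := hab
  rw [h1] at h2
  exact (mul_eq_right.1 h2.symm)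

lemma IsHyperbolicManifoldGroup.exists_isFund (hΓ : IsHyperbolicManifoldGroup Γ) :
    ∃ F : Set (Hyp n), IsFund Γ F := by
  have := hΓ.countable
  have : ContinuousConstSMul Γ (Hyp n) := ⟨fun g => continuous_const_smul g.1⟩
  refine HypSkin.exists_isFund fun x => ?_
  have hfin : {γ : Lorentz n | γ ∈ Γ ∧ dist x (γ • x) ≤ 1}.Finite := hΓ.discrete x 1
  -- Only finitely many elements move x by at most 1, so some r makes 2r smaller than all their
  -- nonzero displacements. With r < 1/2, an element sending a point of the r-ball into the r-ball
  -- is one of them.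
  have hev : ∀ᶠ r : ℝ in 𝓝[>] 0, ∀ γ ∈ {γ : Lorentz n | γ ∈ Γ ∧ dist x (γ • x) ≤ 1},
      γ ≠ 1 → 2 * r < dist x (γ • x) := by
    rw [Filter.eventually_all_finite hfin]
    rintro γ ⟨hγ, -⟩
    by_cases h1 : γ = 1
    · exact Eventually.of_forall fun r h => absurd h1 h
    · have hpos : 0 < dist x (γ • x) := dist_pos.2 fun h => h1 (hΓ.eq_one_of_smul_eq hγ h.symm)
      have : ∀ᶠ r : ℝ in 𝓝 0, 2 * r < dist x (γ • x) := by
        apply Tendsto.eventually_lt_const hpos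
        have : Continuous fun r : ℝ => 2 * r := by fun_prop
        simpa using this.tendsto 0
      exact (this.filter_mono nhdsWithin_le_nhds).mono fun r hr _ => hr
  have hev2 : ∀ᶠ r : ℝ in 𝓝[>] 0, r < 1 / 2 :=
    (eventually_lt_nhds (by norm_num : (0 : ℝ) < 1 / 2)).filter_mono nhdsWithin_le_nhds
  obtain ⟨r, ⟨h1, h2⟩, hr⟩ := ((hev.and hev2).and self_mem_nhdsWithin).exists
  have hr0 : 0 < r := hr
  refine ⟨Metric.ball x r, Metric.isOpen_ball, Metric.mem_ball_self hr0, ?_⟩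
  rintro ⟨γ, hγ⟩ y hy hy'
  by_contra hne
  have h3 : dist x (γ • x) < 2 * r := by
    have e1 : dist (γ • y) (γ • x) = dist y x := dist_smul γ y x
    have e2 : dist (γ • y) x < r := hy'
    have e3 : dist y x < r := hy
    have := dist_triangle x (γ • y) (γ • x)
    rw [dist_comm x (γ • y)] at this
    linarith
  have h4 := h1 γ ⟨hγ, by linarith⟩ (fun h => hne (Subtype.ext h))
  linarith

end Group

/-! ### Spherical measures under linear isometries. -/

section ToSphere

variable {E F : Type*} [NormedAddCommGroup E] [InnerProductSpace ℝ E] [FiniteDimensional ℝ E]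
  [MeasurableSpace E] [BorelSpace E] [NormedAddCommGroup F] [InnerProductSpace ℝ F]
  [FiniteDimensional ℝ F] [MeasurableSpace F] [BorelSpace F]

/-- The map between unit spheres given by a linear isometry. -/
def sphereMap (L : E ≃ₗᵢ[ℝ] F) (u : Metric.sphere (0 : E) 1) : Metric.sphere (0 : F) 1 :=
  ⟨L u, by rw [mem_sphere_zero_iff_norm, L.norm_map]; exact mem_sphere_zero_iff_norm.1 u.2⟩

lemma continuous_sphereMap (L : E ≃ₗᵢ[ℝ] F) : Continuous (sphereMap L) :=
  (L.continuous.comp continuous_subtype_val).subtype_mk _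

lemma map_sphereMap_toSphere (L : E ≃ₗᵢ[ℝ] F) :
    (volume : Measure E).toSphere.map (sphereMap L) = (volume : Measure F).toSphere := by
  have hm := (continuous_sphereMap L).measurable
  refine Measure.ext fun s hs => ?_
  rw [Measure.map_apply hm hs, Measure.toSphere_apply' _ (hm hs), Measure.toSphere_apply' _ hs,
    L.toLinearEquiv.finrank_eq, ← L.measurePreserving.measure_preimage_emb
      L.toHomeomorph.measurableEmbedding]
  congr 2
  ext x
  simp only [Set.mem_smul, mem_image, mem_preimage]
  constructor
  · rintro ⟨r, hr, _, ⟨u, hu, rfl⟩, rfl⟩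
    exact ⟨r, hr, _, ⟨_, hu, rfl⟩, (map_smul L r _).symm⟩
  · rintro ⟨r, hr, _, ⟨u, hu, rfl⟩, h⟩
    refine ⟨r, hr, _, ⟨sphereMap L.symm u, ?_, rfl⟩, ?_⟩
    · have : sphereMap L (sphereMap L.symm u) = u := Subtype.ext (L.apply_symm_apply _)
      rwa [this]
    · apply L.injective
      rw [map_smul, ← h]
      change r • L (L.symm _) = _
      rw [L.apply_symm_apply]

lemma toSphere_univ_eq (L : E ≃ₗᵢ[ℝ] F) :
    (volume : Measure E).toSphere univ = (volume : Measure F).toSphere univ := by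
  rw [← map_sphereMap_toSphere L, Measure.map_apply (continuous_sphereMap L).measurable
    MeasurableSet.univ, preimage_univ]

end ToSphere

/-! ### Fibre measures of the normal bundle and their naturality. -/

section Fiber

variable {n : ℕ}

/-- The differential of an isometry. -/
def dLor (A : Lorentz n) (x : Hyp n) : Tangent x ≃ₗᵢ[ℝ] Tangent (A • x) where
  toFun u := ⟨A.1 u.vec, by
    change mink (A.1 x.pt) (A.1 u.vec) = 0
    rw [Lorentz.mink_map]; exact u.2⟩
  invFun u := ⟨A⁻¹.1 u.vec, by
    have h : mink (A.1 x.pt) u.vec = 0 := u.2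
    rw [← Lorentz.mink_map A⁻¹] at h
    change mink x.pt _ = 0
    rwa [← smul_pt, ← smul_pt, inv_smul_smul] at h⟩
  map_add' u v := Subtype.ext (map_add A.1 u.vec v.vec)
  map_smul' c u := Subtype.ext (map_smul A.1 c u.vec)
  left_inv u := Subtype.ext (A.1.symm_apply_apply u.vec)
  right_inv u := Subtype.ext (A.1.apply_symm_apply u.vec)
  norm_map' u := by
    rw [← sq_eq_sq₀ (norm_nonneg _) (norm_nonneg _), ← real_inner_self_eq_norm_sq,
      ← real_inner_self_eq_norm_sq]
    exact Lorentz.mink_map A u.vec u.vec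

/-- The underlying vector of Minkowski space, as a linear map. -/
def vecLin (x : Hyp n) : Tangent x →ₗ[ℝ] Mink n where
  toFun u := u.vec
  map_add' _ _ := rfl
  map_smul' _ _ := rfl

lemma measurable_unitOf {x : Hyp n} (N : Submodule ℝ (Tangent x)) : Measurable (unitOf N) := by
  refine Continuous.measurable (continuous_T1_iff.2 ⟨continuous_const, ?_⟩)
  exact (LinearMap.continuous_of_finiteDimensional (vecLin x)).comp
    (continuous_subtype_val.comp continuous_subtype_val)

/-- The spherical measure on the unit vectors of a subspace of the tangent space. -/
def sphereMeasure {x : Hyp n} (N : Submodule ℝ (Tangent x)) : Measure (T1 n) :=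
  (volume : Measure N).toSphere.map (unitOf N)

lemma fiberMeasure_eq (S : Set (T1 n)) (x : Hyp n) :
    fiberMeasure S x = (sphereMeasure (fiberSpan S x)).restrict S := rfl

lemma sphereMeasure_map_of (A : Lorentz n) {x y : Hyp n} (hy : y = A • x)
    {N : Submodule ℝ (Tangent x)} {N' : Submodule ℝ (Tangent y)} (L : N ≃ₗᵢ[ℝ] N')
    (hL : ∀ u : N, (L u : Tangent y).vec = A.1 (u : Tangent x).vec) :
    sphereMeasure N' = (sphereMeasure N).map (A • ·) := by
  have hA : Measurable fun v : T1 n => A • v := measurable_const_smul A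
  have e := map_sphereMap_toSphere L
  have h : unitOf N' ∘ sphereMap L = (fun v : T1 n => A • v) ∘ unitOf N :=
    funext fun u => T1.ext hy (hL u.1)
  unfold sphereMeasure
  rw [← e, Measure.map_map hA (measurable_unitOf N),
    Measure.map_map (measurable_unitOf N') (continuous_sphereMap L).measurable, h]

lemma sphereMeasure_map (A : Lorentz n) {x : Hyp n} (N : Submodule ℝ (Tangent x)) :
    sphereMeasure (N.map (dLor A x).toLinearEquiv.toLinearMap) = (sphereMeasure N).map (A • ·) :=
  sphereMeasure_map_of A rfl ((dLor A x).submoduleMap N) fun _ => rfl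

lemma fiberSpan_smul (A : Lorentz n) (S : Set (T1 n)) (x : Hyp n) :
    fiberSpan (A • S) (A • x) = (fiberSpan S x).map (dLor A x).toLinearEquiv.toLinearMap := by
  rw [fiberSpan, fiberSpan, Submodule.map_span]
  congr 1
  ext u
  constructor
  · rintro ⟨_, ⟨v, hv, rfl⟩, h1, h2⟩
    have hb : v.base = x := MulAction.injective A h1
    subst hb
    exact ⟨⟨v.dir, v.orth⟩, ⟨v, hv, rfl, rfl⟩, Subtype.ext h2⟩
  · rintro ⟨u, ⟨v, hv, rfl, h⟩, rfl⟩
    refine ⟨A • v, smul_mem_smul_set hv, rfl, ?_⟩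
    change A.1 v.dir = A.1 u.vec
    rw [h]

lemma measurableEmbedding_smul_T1 (A : Lorentz n) : MeasurableEmbedding fun v : T1 n => A • v :=
  (Homeomorph.smul A).measurableEmbedding

lemma fiberMeasure_smul (A : Lorentz n) (S : Set (T1 n)) (x : Hyp n) :
    fiberMeasure (A • S) (A • x) = (fiberMeasure S x).map (A • ·) := by
  rw [fiberMeasure_eq, fiberSpan_smul, sphereMeasure_map,
    (measurableEmbedding_smul_T1 A).restrict_map, fiberMeasure_eq]
  congr 2
  ext v
  exact smul_mem_smul_set_iff

lemma HasClosest.outerNormal_smul {C : Set (Hyp n)} (h : HasClosest C) (A : Lorentz n) :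
    outerNormal (A • C) = A • outerNormal C := by
  ext v
  have := h.smul_mem_outerNormal A (A⁻¹ • v)
  rwa [smul_inv_smul, ← mem_smul_set_iff_inv_smul_mem] at this

/-- The integral formula for the Riemannian measure of the outer unit normal bundle. -/
lemma lintegral_normalVolUp {d : ℕ} {C : Set (Hyp n)}
    (hκ : AEMeasurable (fiberMeasure (outerNormal C)) ((μHE[d] : Measure (Hyp n)).restrict (frontier C)))
    {f : T1 n → ℝ≥0∞} (hf : Measurable f) :
    ∫⁻ v, f v ∂normalVolUp d C =
      ∫⁻ x in frontier C, ∫⁻ v, f v ∂fiberMeasure (outerNormal C) x ∂(μHE[d] : Measure (Hyp n)) :=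
  Measure.lintegral_bind hκ hf.aemeasurable

lemma map_smul_restrict_frontier (d : ℕ) (A : Lorentz n) (C : Set (Hyp n)) :
    ((μHE[d] : Measure (Hyp n)).restrict (frontier C)).map (A • ·) =
      (μHE[d] : Measure (Hyp n)).restrict (frontier (A • C)) := by
  have he : MeasurableEmbedding fun x : Hyp n => A • x := (Homeomorph.smul A).measurableEmbedding
  conv_rhs => rw [← map_smul_euclideanHausdorffMeasure d A]
  rw [he.restrict_map, frontier_smul_set]
  congr 2
  ext x
  exact smul_mem_smul_set_iff.symm

lemma HasClosest.aemeasurable_fiberMeasure_smul {d : ℕ} {C : Set (Hyp n)} (hC : HasClosest C)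
    (hκ : AEMeasurable (fiberMeasure (outerNormal C)) ((μHE[d] : Measure (Hyp n)).restrict (frontier C)))
    (A : Lorentz n) : AEMeasurable (fiberMeasure (outerNormal (A • C)))
      ((μHE[d] : Measure (Hyp n)).restrict (frontier (A • C))) := by
  have he : MeasurableEmbedding fun x : Hyp n => A • x := (Homeomorph.smul A).measurableEmbedding
  rw [← map_smul_restrict_frontier, he.aemeasurable_map_iff, hC.outerNormal_smul]
  have : fiberMeasure (A • outerNormal C) ∘ (fun x => A • x) =
      (Measure.map (A • ·)) ∘ fiberMeasure (outerNormal C) :=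
    funext fun x => fiberMeasure_smul A _ x
  rw [this]
  exact (Measure.measurable_map _ (measurable_const_smul A)).comp_aemeasurable hκ

/-- Naturality of the Riemannian measure of the outer unit normal bundle. -/
lemma HasClosest.normalVolUp_smul {d : ℕ} {C : Set (Hyp n)} (hC : HasClosest C)
    (hκ : AEMeasurable (fiberMeasure (outerNormal C)) ((μHE[d] : Measure (Hyp n)).restrict (frontier C)))
    (A : Lorentz n) : normalVolUp d (A • C) = (normalVolUp d C).map (A • ·) := by
  have he : MeasurableEmbedding fun x : Hyp n => A • x := (Homeomorph.smul A).measurableEmbedding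
  have hA : Measurable fun v : T1 n => A • v := measurable_const_smul A
  refine Measure.ext_of_lintegral _ fun f hf => ?_
  rw [lintegral_normalVolUp (hC.aemeasurable_fiberMeasure_smul hκ A) hf, lintegral_map hf hA,
    lintegral_normalVolUp hκ (show Measurable fun v => f (A • v) from hf.comp hA),
    ← map_smul_restrict_frontier, he.lintegral_map]
  refine lintegral_congr fun x => ?_
  rw [hC.outerNormal_smul, fiberMeasure_smul, lintegral_map hf hA]

lemma ae_fiberMeasure_base (S : Set (T1 n)) (x : Hyp n) : ∀ᵐ v ∂fiberMeasure S x, v.base = x := by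
  refine ae_restrict_of_ae ?_
  rw [sphereMeasure.eq_def (fiberSpan S x) |>.symm]
  refine (ae_map_iff (measurable_unitOf _).aemeasurable ?_).2 (Eventually.of_forall fun u => rfl)
  exact measurableSet_eq_fun continuous_base.measurable measurable_const

/-- Each fibre measure sits over its base point, so fibres of constant mass project to a multiple of
the measure of the frontier. -/
lemma map_base_normalVolUp {d : ℕ} {C : Set (Hyp n)}
    (hκ : AEMeasurable (fiberMeasure (outerNormal C)) ((μHE[d] : Measure (Hyp n)).restrict (frontier C)))
    {K : ℝ≥0∞} (hK : ∀ x ∈ frontier C, fiberMeasure (outerNormal C) x univ = K) :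
    (normalVolUp d C).map T1.base = K • (μHE[d] : Measure (Hyp n)).restrict (frontier C) := by
  have hb : Measurable (T1.base : T1 n → Hyp n) := continuous_base.measurable
  refine Measure.ext_of_lintegral _ fun f hf => ?_
  rw [lintegral_map hf hb, lintegral_normalVolUp hκ (show Measurable fun v : T1 n => f v.base from hf.comp hb),
    lintegral_smul_measure, smul_eq_mul, ← lintegral_const_mul K hf]
  refine setLIntegral_congr_fun isClosed_frontier.measurableSet fun x hx => ?_
  have : ∀ᵐ v ∂fiberMeasure (outerNormal C) x, f v.base = f x :=
    (ae_fiberMeasure_base _ x).mono fun v hv => by rw [hv]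
  rw [lintegral_congr_ae this, lintegral_const, hK x hx, mul_comm]

end Fiber

/-! ### Reduction of the statements on the quotient to the universal cover. -/

section Reduction

variable {n : ℕ} {Γ : Subgroup (Lorentz n)}

lemma stabilizer_smul {C : Set (Hyp n)} (h : MulAction.stabilizer Γ C) : (h.1 : Lorentz n) • C = C := h.2

/-- Comparison of the skinning measure and the Riemannian measure, reduced to the comparison in the
universal cover. -/
lemma skinning_eq_smul_normalVol (hΓ : IsHyperbolicManifoldGroup Γ) {d : ℕ} {C : Set (Hyp n)}
    (hC : HasClosest C)
    (hκ : AEMeasurable (fiberMeasure (outerNormal C)) ((μHE[d] : Measure (Hyp n)).restrict (frontier C)))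
    {δ : ℝ} {μ : Hyp n → Measure (Bdry n)} {x₀ : Hyp n} {c : ℝ≥0∞}
    (h : skinningUp δ μ x₀ C = c • normalVolUp d C) :
    skinning Γ δ μ x₀ C = c • normalVol Γ d C := by
  have := hΓ.countable
  obtain ⟨F, hF⟩ := hΓ.exists_isFund
  have : MeasurableConstSMul Γ (T1 n) := ⟨fun g => measurable_const_smul g.1⟩
  have : MeasurableConstSMul (MulAction.stabilizer Γ C) (T1 n) := ⟨fun g => measurable_const_smul g.1⟩
  have hF' : IsFund Γ (T1.base ⁻¹' F : Set (T1 n)) :=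
    hF.preimage continuous_base.measurable fun g v => rfl
  have hinv : ∀ g : MulAction.stabilizer Γ C, (normalVolUp d C).map (g • ·) = normalVolUp d C := by
    intro g
    -- Naturality applied to an isometry preserving C is invariance.
    have := hC.normalVolUp_smul hκ (g.1 : Lorentz n)
    rw [stabilizer_smul] at this
    exact this.symm
  rw [skinning, h, normalVol]
  rw [quotientMeasure_sum hF' (MulAction.stabilizer Γ C) (ν := c • normalVolUp d C)
    (p := stabToQuotient Γ C) (fun g => by rw [Measure.map_smul, hinv]) fun x => rfl,
    quotientMeasure_smul (hF'.subFund _) hinv, Measure.map_smul]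

lemma normalVol_univ (hΓ : IsHyperbolicManifoldGroup Γ) {d : ℕ} {C : Set (Hyp n)}
    (hC : HasClosest C)
    (hκ : AEMeasurable (fiberMeasure (outerNormal C)) ((μHE[d] : Measure (Hyp n)).restrict (frontier C)))
    {K : ℝ≥0∞} (hK : ∀ x ∈ frontier C, fiberMeasure (outerNormal C) x univ = K) :
    normalVol Γ d C univ = K * quotientVol Γ d C (frontier C) := by
  have := hΓ.countable
  obtain ⟨F, hF⟩ := hΓ.exists_isFund
  have : MeasurableConstSMul Γ (Hyp n) := ⟨fun g => measurable_const_smul g.1⟩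
  have : MeasurableConstSMul (MulAction.stabilizer Γ C) (T1 n) := ⟨fun g => measurable_const_smul g.1⟩
  have : MeasurableConstSMul (MulAction.stabilizer Γ C) (Hyp n) := ⟨fun g => measurable_const_smul g.1⟩
  have hinv : ∀ g : MulAction.stabilizer Γ C, (normalVolUp d C).map (g • ·) = normalVolUp d C := by
    intro g
    have := hC.normalVolUp_smul hκ (g.1 : Lorentz n)
    rw [stabilizer_smul] at this
    exact this.symm
  have hinv' : ∀ g : MulAction.stabilizer Γ C,
      ((μHE[d] : Measure (Hyp n)).restrict (frontier C)).map (g • ·) =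
        (μHE[d] : Measure (Hyp n)).restrict (frontier C) := by
    intro g
    have := map_smul_restrict_frontier d (g.1 : Lorentz n) C
    rw [stabilizer_smul] at this
    exact this
  have hpm : Measurable (stabToQuotient Γ C) := by
    intro B hB
    -- Both quotients carry the σ-algebra of sets with measurable preimage upstairs, and the two
    -- preimages coincide by definition.
    exact hB
  have hFs := hF.subFund (MulAction.stabilizer Γ C)
  rw [normalVol, Measure.map_apply hpm MeasurableSet.univ, preimage_univ,
    ← quotientMeasure_map_univ hFs hinv continuous_base.measurable fun g v => rfl,
    map_base_normalVolUp hκ hK, quotientMeasure_smul hFs hinv', Measure.smul_apply, smul_eq_mul,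
    quotientVol]

end Reduction

/-! ### Horoballs: closest points, Dirac fibres, skinning measure and volume. -/

section Horoball

variable {n : ℕ}

instance : T2Space (T1 n) := isEmbedding_base_dir.t2Space

/-- The closed horoball `hor ξ ≤ s`. -/
def horoball (ξ : Bdry n) (s : ℝ) : Set (Hyp n) := {x | hor ξ x ≤ s}

/-- The unit tangent vector at `x` pointing away from `ξ`. -/
def awayFrom (ξ : Bdry n) (x : Hyp n) : T1 n :=
  ⟨x, x.pt + (-(hor ξ x)⁻¹) • lightVec ξ, by
    have h := (hor_pos ξ x).ne'
    have h1 : mink x.pt (lightVec ξ) = -hor ξ x := by rw [hor, neg_neg]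
    rw [mink_add_right, mink_smul_right, x.mink_pt, h1]
    field_simp
    ring, by
    have h := (hor_pos ξ x).ne'
    have h1 : mink x.pt (lightVec ξ) = -hor ξ x := by rw [hor, neg_neg]
    have h2 : mink (lightVec ξ) x.pt = -hor ξ x := by rw [mink_comm, h1]
    simp only [mink_add_left, mink_add_right, mink_smul_right, mink_smul_left, x.mink_pt, h1, h2,
      mink_lightVec_self]
    field_simp
    ring⟩

lemma continuous_awayFrom (ξ : Bdry n) : Continuous (awayFrom ξ) := by
  refine continuous_T1_iff.2 ⟨continuous_id, ?_⟩
  exact continuous_pt.add ((((continuous_hor_right ξ).inv₀ fun x => (hor_pos ξ x).ne').neg).smul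
    continuous_const)

lemma dep_zero_bdry (ξ η : Bdry n) :
    dep 0 (ξ : EuclideanSpace ℝ (Fin n)) (η : EuclideanSpace ℝ (Fin n)) =
      -mink (lightVec η) (lightVec ξ) := by
  rw [dep, hgt_zero_left, norm_bdry]
  simp [mink, lightVec]

lemma dep_zero_pos_iff (ξ η : Bdry n) :
    0 < dep 0 (ξ : EuclideanSpace ℝ (Fin n)) (η : EuclideanSpace ℝ (Fin n)) ↔ η ≠ ξ := by
  rw [dep, hgt_zero_left, norm_bdry, sub_pos, inner_lt_one_iff_real_of_norm_eq_one (norm_bdry η)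
    (norm_bdry ξ)]
  exact Subtype.coe_injective.ne_iff

/-- The point of the geodesic line from `ξ` to `η` at height `s` seen from `ξ`. -/
lemma exists_crossing {ξ η : Bdry n} (h : η ≠ ξ) {s : ℝ} (hs : 0 < s) : ∃ p : Hyp n,
    p.pt = (s / dep 0 (ξ : EuclideanSpace ℝ (Fin n)) (η : EuclideanSpace ℝ (Fin n))) • lightVec η +
      (2 * s)⁻¹ • lightVec ξ := by
  have hq := (dep_zero_pos_iff ξ η).2 h
  have h1 := dep_zero_bdry ξ η
  set q := dep 0 (ξ : EuclideanSpace ℝ (Fin n)) (η : EuclideanSpace ℝ (Fin n))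
  have h2 : mink (lightVec η) (lightVec ξ) = -q := by rw [h1, neg_neg]
  have h3 : mink (lightVec ξ) (lightVec η) = -q := by rw [mink_comm, h2]
  refine ⟨⟨_, ?_, ?_⟩, rfl⟩
  · simp only [mink_add_left, mink_add_right, mink_smul_right, mink_smul_left, h2, h3,
      mink_lightVec_self]
    field_simp
    ring
  · simp only [Prod.fst_add, Prod.smul_fst, lightVec, smul_eq_mul]
    positivity

lemma hor_crossing {ξ η : Bdry n} (h : η ≠ ξ) {s : ℝ} (hs : 0 < s) {p : Hyp n}
    (hp : p.pt = (s / dep 0 (ξ : EuclideanSpace ℝ (Fin n)) (η : EuclideanSpace ℝ (Fin n))) •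
      lightVec η + (2 * s)⁻¹ • lightVec ξ) : hor ξ p = s ∧
    hor η p = dep 0 (ξ : EuclideanSpace ℝ (Fin n)) (η : EuclideanSpace ℝ (Fin n)) / (2 * s) := by
  have hq := (dep_zero_pos_iff ξ η).2 h
  have h1 := dep_zero_bdry ξ η
  set q := dep 0 (ξ : EuclideanSpace ℝ (Fin n)) (η : EuclideanSpace ℝ (Fin n))
  have h2 : mink (lightVec η) (lightVec ξ) = -q := by rw [h1, neg_neg]
  have h3 : mink (lightVec ξ) (lightVec η) = -q := by rw [mink_comm, h2]
  rw [hor, hor, hp]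
  simp only [mink_add_left, mink_smul_left, h2, h3, mink_lightVec_self]
  constructor
  · field_simp
    ring
  · ring

/-- Let a and b be the heights of y seen from ξ and η. The part u of y orthogonal to both isotropic
vectors is spacelike, with square 2ab/q - 1 ≥ 0. As a ≤ s this gives b ≥ q/(2s), the height of p.
Equality forces a = s and u = 0, hence y = p. -/
lemma isClosest_crossing {ξ η : Bdry n} (h : η ≠ ξ) {s : ℝ} (hs : 0 < s) {p : Hyp n}
    (hp : p.pt = (s / dep 0 (ξ : EuclideanSpace ℝ (Fin n)) (η : EuclideanSpace ℝ (Fin n))) •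
      lightVec η + (2 * s)⁻¹ • lightVec ξ) : IsClosest (horoball ξ s) η p := by
  obtain ⟨hp1, hp2⟩ := hor_crossing h hs hp
  have hq := (dep_zero_pos_iff ξ η).2 h
  have h1 := dep_zero_bdry ξ η
  set q := dep 0 (ξ : EuclideanSpace ℝ (Fin n)) (η : EuclideanSpace ℝ (Fin n))
  have h2 : mink (lightVec η) (lightVec ξ) = -q := by rw [h1, neg_neg]
  have h3 : mink (lightVec ξ) (lightVec η) = -q := by rw [mink_comm, h2]
  refine ⟨hp1.le, fun y hy hne => ?_⟩
  have hy' : hor ξ y ≤ s := hy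
  have ha := hor_pos ξ y
  have hb := hor_pos η y
  have h4 : mink y.pt (lightVec ξ) = -hor ξ y := by rw [hor, neg_neg]
  have h5 : mink y.pt (lightVec η) = -hor η y := by rw [hor, neg_neg]
  have h4' : mink (lightVec ξ) y.pt = -hor ξ y := by rw [mink_comm, h4]
  have h5' : mink (lightVec η) y.pt = -hor η y := by rw [mink_comm, h5]
  set a := hor ξ y
  set b := hor η y
  set u : Mink n := y.pt + ((-(a / q)) • lightVec η + (-(b / q)) • lightVec ξ) with hu
  have hpu : mink p.pt u = 0 := by
    rw [hp, hu]
    simp only [mink_add_left, mink_add_right, mink_smul_right, mink_smul_left, h2, h3, h4', h5',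
      mink_lightVec_self]
    field_simp
    ring
  have huu : mink u u = 2 * a * b / q - 1 := by
    rw [hu]
    simp only [mink_add_left, mink_add_right, mink_smul_right, mink_smul_left, h2, h3, h4', h5',
      h4, h5, mink_lightVec_self, y.mink_pt]
    field_simp
    ring
  have h6 := mink_self_nonneg p hpu
  rw [huu, sub_nonneg, le_div_iff₀ hq, one_mul] at h6
  rw [hp2]
  by_contra hc
  push Not at hc
  rw [le_div_iff₀ (by positivity)] at hc
  have h7 : b * a ≤ b * s := mul_le_mul_of_nonneg_left hy' hb.le
  have h8 : a = s := mul_left_cancel₀ hb.ne' (le_antisymm h7 (by nlinarith))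
  have h9 : 2 * a * b = q := le_antisymm (by rw [h8]; linarith) h6
  have hu0 : u = 0 := eq_zero_of_mink_self p hpu (by rw [huu, h9, div_self hq.ne', sub_self])
  apply hne
  apply Hyp.ext
  have hb' : b / q = (2 * s)⁻¹ := by
    rw [← h9, h8]; field_simp
  rw [hu, hb', h8] at hu0
  rw [hp]
  have : y.pt = (y.pt + ((-(s / q)) • lightVec η + (-(2 * s)⁻¹) • lightVec ξ)) +
      ((s / q) • lightVec η + (2 * s)⁻¹ • lightVec ξ) := by module
  rw [this, hu0, zero_add]

lemma toward_crossing {ξ η : Bdry n} (h : η ≠ ξ) {s : ℝ} (hs : 0 < s) {p : Hyp n}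
    (hp : p.pt = (s / dep 0 (ξ : EuclideanSpace ℝ (Fin n)) (η : EuclideanSpace ℝ (Fin n))) •
      lightVec η + (2 * s)⁻¹ • lightVec ξ) : toward p η = awayFrom ξ p := by
  obtain ⟨hp1, hp2⟩ := hor_crossing h hs hp
  have hq := (dep_zero_pos_iff ξ η).2 h
  refine T1.ext rfl ?_
  change (hor η p)⁻¹ • lightVec η + (-1 : ℝ) • p.pt = p.pt + (-(hor ξ p)⁻¹) • lightVec ξ
  rw [hp1, hp2, hp]
  set q := dep 0 (ξ : EuclideanSpace ℝ (Fin n)) (η : EuclideanSpace ℝ (Fin n))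
  have e1 : (q / (2 * s))⁻¹ = s / q + s / q := by field_simp; ring
  have e2 : s⁻¹ = (2 * s)⁻¹ + (2 * s)⁻¹ := by field_simp; ring
  rw [e1, e2]
  module

lemma crossing_eq_horoPt {ξ η : Bdry n} (h : η ≠ ξ) {s : ℝ} (hs : 0 < s) {p : Hyp n}
    (hp : p.pt = (s / dep 0 (ξ : EuclideanSpace ℝ (Fin n)) (η : EuclideanSpace ℝ (Fin n))) •
      lightVec η + (2 * s)⁻¹ • lightVec ξ) :
    p = horoPt s ξ ((s / dep 0 (ξ : EuclideanSpace ℝ (Fin n)) (η : EuclideanSpace ℝ (Fin n))) •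
      (perp ξ).orthogonalProjectionOnto (η : EuclideanSpace ℝ (Fin n))) := by
  have h1 := horoPt_perpPart ξ p
  rw [(hor_crossing h hs hp).1] at h1
  rw [← h1]
  congr 1
  have h2 : p.pt.2 = (s / dep 0 (ξ : EuclideanSpace ℝ (Fin n)) (η : EuclideanSpace ℝ (Fin n))) •
      (η : EuclideanSpace ℝ (Fin n)) + (2 * s)⁻¹ • (ξ : EuclideanSpace ℝ (Fin n)) :=
    congrArg Prod.snd hp
  rw [perpPart, h2, map_add, map_smul, map_smul,
    Submodule.orthogonalProjectionOnto_orthogonal_apply_eq_zero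
      (Submodule.mem_span_singleton_self _), smul_zero, add_zero]

lemma hor_toward_line (ξ η : Bdry n) (x : Hyp n) (t : ℝ) : hor ξ ((toward x η).line t) =
    Real.exp (-t) * hor ξ x + Real.sinh t * ((hor η x)⁻¹ *
      dep 0 (ξ : EuclideanSpace ℝ (Fin n)) (η : EuclideanSpace ℝ (Fin n))) := by
  rw [dep_zero_bdry, hor, toward_line_pt, mink_add_left, mink_smul_left, mink_smul_left, hor, hor]
  ring

lemma dep_zero_self (ξ : Bdry n) :
    dep 0 (ξ : EuclideanSpace ℝ (Fin n)) (ξ : EuclideanSpace ℝ (Fin n)) = 0 := by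
  rw [dep_zero_bdry, mink_lightVec_self, neg_zero]

lemma infinityOf_horoball (ξ : Bdry n) {s : ℝ} (hs : 0 < s) : infinityOf (horoball ξ s) = {ξ} := by
  ext η
  rw [mem_singleton_iff]
  constructor
  · rintro ⟨v, hv, rfl⟩
    by_contra hne
    have hq := (dep_zero_pos_iff ξ v.endpoint).2 hne
    have hb := hor_pos v.endpoint v.base
    set c := (hor v.endpoint v.base)⁻¹ *
      dep 0 (ξ : EuclideanSpace ℝ (Fin n)) (v.endpoint : EuclideanSpace ℝ (Fin n)) with hc
    have hc0 : 0 < c := by positivity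
    have ht : 0 ≤ s / c := by positivity
    have h1 : hor ξ (v.line (s / c)) ≤ s := hv _ ht
    rw [← toward_base_endpoint v, hor_toward_line] at h1
    have h2 : s / c ≤ Real.sinh (s / c) := Real.self_le_sinh_iff.2 ht
    have h3 : s ≤ Real.sinh (s / c) * c := by rwa [div_le_iff₀ hc0] at h2
    have h4 : 0 < Real.exp (-(s / c)) * hor ξ v.base := mul_pos (Real.exp_pos _) (hor_pos _ _)
    have h5 : hor ξ v.base = hor ξ (toward v.base v.endpoint).base := rfl
    change Real.exp (-(s / c)) * hor ξ v.base + Real.sinh (s / c) * c ≤ s at h1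
    linarith
  · rintro rfl
    refine ⟨toward (horoPt s η 0) η, fun t ht => ?_, toward_endpoint _ _⟩
    change hor η _ ≤ s
    rw [hor_toward_line, dep_zero_self, mul_zero, mul_zero, add_zero, hor_horoPt hs]
    have : Real.exp (-t) ≤ 1 := Real.exp_le_one_iff.2 (by linarith)
    nlinarith

lemma hasClosest_horoball (ξ : Bdry n) {s : ℝ} (hs : 0 < s) : HasClosest (horoball ξ s) := by
  intro η hη
  rw [infinityOf_horoball ξ hs] at hη
  obtain ⟨p, hp⟩ := exists_crossing hη hs
  exact ⟨p, isClosest_crossing hη hs hp⟩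

lemma continuous_line (v : T1 n) : Continuous v.line := by
  refine continuous_hyp_iff.2 ?_
  exact (Real.continuous_cosh.smul continuous_const).add (Real.continuous_sinh.smul continuous_const)

lemma line_zero (v : T1 n) : v.line 0 = v.base := by
  apply Hyp.ext
  change Real.cosh 0 • v.base.pt + Real.sinh 0 • v.dir = v.base.pt
  simp

lemma frontier_horoball (ξ : Bdry n) (s : ℝ) : frontier (horoball ξ s) = {x | hor ξ x = s} := by
  refine subset_antisymm (frontier_le_subset_eq (continuous_hor_right ξ) continuous_const) ?_
  rintro x rfl
  have hcl : IsClosed (horoball ξ (hor ξ x)) := isClosed_le (continuous_hor_right ξ) continuous_const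
  refine ⟨subset_closure (le_refl (hor ξ x)), fun hint => ?_⟩
  -- Moving backwards along the geodesic towards ξ strictly increases the height, so boundary points
  -- are not interior.
  have hlim : Tendsto (toward x ξ).line (𝓝[<] 0) (𝓝 x) := by
    have := (continuous_line (toward x ξ)).tendsto 0
    rw [line_zero] at this
    exact this.mono_left nhdsWithin_le_nhds
  have hev := hlim.eventually (mem_interior_iff_mem_nhds.1 hint)
  obtain ⟨t, ht1, ht2⟩ := (hev.and self_mem_nhdsWithin).exists
  have ht : t < 0 := ht2
  have ht3 : hor ξ ((toward x ξ).line t) ≤ hor ξ x := ht1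
  rw [hor_toward_line, dep_zero_self, mul_zero, mul_zero, add_zero] at ht3
  have : 1 < Real.exp (-t) := Real.one_lt_exp_iff.2 (by linarith)
  nlinarith [hor_pos ξ x]

lemma measurable_dep' (ξ : Bdry n) : Measurable fun z : EuclideanSpace ℝ (Fin n) =>
    dep 0 (ξ : EuclideanSpace ℝ (Fin n)) z := measurable_dep 0 _

lemma dep_zero_smul (ξ : Bdry n) {r : ℝ} (hr : 0 < r) (z : EuclideanSpace ℝ (Fin n)) :
    dep 0 (ξ : EuclideanSpace ℝ (Fin n)) (r • z) = r * dep 0 (ξ : EuclideanSpace ℝ (Fin n)) z := by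
  rw [dep, dep, hgt_zero_left, hgt_zero_left, norm_smul, real_inner_smul_left,
    Real.norm_of_nonneg hr.le]
  ring

/-- The closest point to η is the crossing of the geodesic from ξ to η with the horosphere; its
coordinate (s/q) w is homogeneous of degree 0 and its height q/(2s) of degree 1. -/
lemma isProjData_horoball (ξ : Bdry n) {s : ℝ} (hs : 0 < s) : IsProjData (horoball ξ s)
    (fun z => awayFrom ξ (horoPt s ξ ((s / dep 0 (ξ : EuclideanSpace ℝ (Fin n)) z) •
      (perp ξ).orthogonalProjectionOnto z)))
    (fun z => dep 0 (ξ : EuclideanSpace ℝ (Fin n)) z / (2 * s)) where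
  measurable_P := by
    have h1 : Measurable fun z : EuclideanSpace ℝ (Fin n) => (perp ξ).orthogonalProjectionOnto z :=
      (ContinuousLinearMap.continuous _).measurable
    exact (continuous_awayFrom ξ).measurable.comp ((continuous_horoPt s ξ).measurable.comp
      ((measurable_const.div (measurable_dep' ξ)).smul h1))
  measurable_N := (measurable_dep' ξ).div_const _
  P_smul r hr z := by
    rw [dep_zero_smul ξ hr, map_smul, smul_smul]
    congr 3
    field_simp
  N_smul r hr z := by
    rw [dep_zero_smul ξ hr, mul_div_assoc]
  notMem_iff η := by
    rw [infinityOf_horoball ξ hs, mem_singleton_iff, div_pos_iff_of_pos_right (by positivity),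
      dep_zero_pos_iff]
  projPlus_eq η hη := by
    rw [infinityOf_horoball ξ hs] at hη
    obtain ⟨p, hp⟩ := exists_crossing hη hs
    rw [projPlus, (isClosest_crossing hη hs hp).proj_eq, toward_crossing hη hs hp]
    congr 1
    exact crossing_eq_horoPt hη hs hp
  N_eq η hη := by
    rw [infinityOf_horoball ξ hs] at hη
    obtain ⟨p, hp⟩ := exists_crossing hη hs
    rw [(isClosest_crossing hη hs hp).proj_eq, (hor_crossing hη hs hp).2]

lemma mem_outerNormal_horoball (ξ : Bdry n) {s : ℝ} (hs : 0 < s) {v : T1 n}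
    (hv : hor ξ v.base = s) : v ∈ outerNormal (horoball ξ s) ↔ v = awayFrom ξ v.base := by
  constructor
  · rintro ⟨-, h2, h3⟩
    rw [infinityOf_horoball ξ hs] at h2
    obtain ⟨p, hp⟩ := exists_crossing h2 hs
    rw [(isClosest_crossing h2 hs hp).proj_eq] at h3
    conv_lhs => rw [← toward_base_endpoint v]
    rw [← h3, toward_crossing h2 hs hp]
  · intro h
    have hend := smul_lightVec_endpoint v
    have hc := fst_add_pos v
    set c := v.base.pt.1 + v.dir.1
    have hdir : v.dir = v.base.pt + (-s⁻¹) • lightVec ξ := by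
      conv_lhs => rw [h]
      rw [← hv]; rfl
    have hbl : mink v.base.pt (lightVec ξ) = -s := by rw [← hv, hor, neg_neg]
    -- Pairing base + dir, which is c times (1, endpoint), with (1, ξ) gives s/q = c/2, exactly the
    -- coefficient in the formula of the crossing point.
    have hq : c * dep 0 (ξ : EuclideanSpace ℝ (Fin n)) (v.endpoint : EuclideanSpace ℝ (Fin n)) =
        2 * s := by
      rw [dep_zero_bdry, mul_neg, ← mink_smul_left, hend, hdir]
      simp only [mink_add_left, mink_smul_left, mink_lightVec_self, hbl]
      ring
    have hqpos : 0 < dep 0 (ξ : EuclideanSpace ℝ (Fin n)) (v.endpoint : EuclideanSpace ℝ (Fin n)) := by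
      refine pos_of_mul_pos_right ?_ hc.le
      rw [hq]; positivity
    have hne := (dep_zero_pos_iff _ _).1 hqpos
    refine ⟨by rw [frontier_horoball]; exact hv, by rw [infinityOf_horoball ξ hs]; exact hne, ?_⟩
    refine (isClosest_crossing hne hs ?_).proj_eq
    have e : s / dep 0 (ξ : EuclideanSpace ℝ (Fin n)) (v.endpoint : EuclideanSpace ℝ (Fin n)) =
        c / 2 := by
      rw [div_eq_div_iff hqpos.ne' two_ne_zero, hq]; ring
    rw [e, div_eq_inv_mul, mul_smul, hend, hdir]
    have e2 : (2 * s)⁻¹ = 2⁻¹ * s⁻¹ := mul_inv _ _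
    rw [e2]
    module

/-- On a line, the cone over one unit vector is an interval of length 1 and the dimension factor is
1. This makes the fibre measure of a horoball a unit Dirac mass. -/
lemma toSphere_singleton_span {E : Type*} [NormedAddCommGroup E] [InnerProductSpace ℝ E]
    [MeasurableSpace E] [BorelSpace E] {u : E} (hu : ‖u‖ = 1) (v : Metric.sphere (0 : ℝ ∙ u) 1)
    (hv : ((v : ℝ ∙ u) : E) = u) : (volume : Measure (ℝ ∙ u)).toSphere {v} = 1 := by
  set L := LinearIsometryEquiv.toSpanUnitSingleton (𝕜 := ℝ) u hu
  have h1 : (sphereMap L) ⁻¹' {v} = {⟨1, by simp⟩} := by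
    ext r
    simp only [mem_preimage, mem_singleton_iff]
    rw [← Subtype.coe_injective.eq_iff, ← Subtype.coe_injective.eq_iff, hv, Subtype.ext_iff]
    change (r : ℝ) • u = u ↔ _
    constructor
    · intro h
      have h0 : u ≠ 0 := by rintro rfl; simp at hu
      exact smul_left_injective ℝ h0 (h.trans (one_smul ℝ u).symm)
    · intro h
      rw [h]; exact one_smul _ _
  rw [← map_sphereMap_toSphere L, Measure.map_apply (continuous_sphereMap L).measurable
    (measurableSet_singleton v), h1, Measure.toSphere_apply' _ (measurableSet_singleton _)]
  have h2 : Ioo (0 : ℝ) 1 • ((↑) '' ({⟨1, by simp⟩} : Set (Metric.sphere (0 : ℝ) 1)) : Set ℝ) =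
      Ioo 0 1 := by
    rw [image_singleton, smul_singleton]
    simp
  rw [h2]
  simp

lemma fiberMeasure_horoball (ξ : Bdry n) {s : ℝ} (hs : 0 < s) {x : Hyp n} (hx : hor ξ x = s) :
    fiberMeasure (outerNormal (horoball ξ s)) x = Measure.dirac (awayFrom ξ x) := by
  set S := outerNormal (horoball ξ s) with hS
  have hmem : ∀ v : T1 n, v.base = x → (v ∈ S ↔ v = awayFrom ξ x) := by
    rintro v rfl
    exact mem_outerNormal_horoball ξ hs hx
  set u : Tangent x := ⟨(awayFrom ξ x).dir, (awayFrom ξ x).orth⟩ with hu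
  have hun : ‖u‖ = 1 := by
    rw [← sq_eq_sq₀ (norm_nonneg _) zero_le_one, ← real_inner_self_eq_norm_sq, one_pow]
    exact (awayFrom ξ x).unit
  have hspan : fiberSpan S x = ℝ ∙ u := by
    rw [fiberSpan]
    congr 1
    ext w
    rw [mem_singleton_iff]
    constructor
    · rintro ⟨v, hv, hb, hd⟩
      rw [(hmem v hb).1 hv] at hd
      exact Subtype.ext hd.symm
    · rintro rfl
      exact ⟨awayFrom ξ x, (hmem _ rfl).2 rfl, rfl, rfl⟩
  rw [fiberMeasure_eq, hspan]
  -- Only vectors based at x carry mass, and among those the normal bundle is this single vector;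
  -- the opposite unit vector of the line is discarded.
  have hae : S =ᵐ[sphereMeasure (ℝ ∙ u)] ({awayFrom ξ x} : Set (T1 n)) := by
    have hb : ∀ᵐ v ∂sphereMeasure (ℝ ∙ u), v.base = x := by
      refine (ae_map_iff (measurable_unitOf _).aemeasurable ?_).2 (Eventually.of_forall fun u => rfl)
      exact measurableSet_eq_fun continuous_base.measurable measurable_const
    filter_upwards [hb] with v hv
    exact propext (hmem v hv)
  rw [Measure.restrict_congr_set hae, Measure.restrict_singleton, sphereMeasure,
    Measure.map_apply (measurable_unitOf _) (measurableSet_singleton _)]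
  set w : Metric.sphere (0 : ℝ ∙ u) 1 := ⟨⟨u, Submodule.mem_span_singleton_self u⟩, by
    rw [mem_sphere_zero_iff_norm]; exact hun⟩
  have hpre : unitOf (ℝ ∙ u) ⁻¹' {awayFrom ξ x} = {w} := by
    ext v
    rw [mem_preimage, mem_singleton_iff, mem_singleton_iff]
    constructor
    · intro h
      exact Subtype.ext (Subtype.ext (Subtype.ext (congrArg T1.dir h)))
    · rintro rfl; rfl
  rw [hpre, toSphere_singleton_span hun w rfl, one_smul]

lemma aemeasurable_fiberMeasure_horoball (d : ℕ) (ξ : Bdry n) {s : ℝ} (hs : 0 < s) :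
    AEMeasurable (fiberMeasure (outerNormal (horoball ξ s)))
      ((μHE[d] : Measure (Hyp n)).restrict (frontier (horoball ξ s))) := by
  refine ⟨fun x => Measure.dirac (awayFrom ξ x),
    Measure.measurable_dirac.comp (continuous_awayFrom ξ).measurable, ?_⟩
  filter_upwards [ae_restrict_mem isClosed_frontier.measurableSet] with x hx
  rw [frontier_horoball] at hx
  exact fiberMeasure_horoball ξ hs hx

lemma skinningUp_horoball (hn : 2 ≤ n) (ξ : Bdry n) {s : ℝ} (hs : 0 < s) (x₀ : Hyp n) :
    skinningUp ((n : ℝ) - 1) sphericalDensity x₀ (horoball ξ s) =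
      (2 : ℝ≥0∞) ^ (n - 1) • normalVolUp (n - 1) (horoball ξ s) := by
  have hn' : (0 : ℝ) < (n - 1 : ℕ) := by
    have : 0 < n - 1 := by omega
    exact_mod_cast this
  rw [(isProjData_horoball ξ hs).skinningUp_eq hn x₀]
  refine Measure.ext_of_lintegral _ fun f hf => ?_
  have hφ := (continuous_horoPt s ξ).measurable
  have hfa : Measurable fun x => f (awayFrom ξ x) := hf.comp (continuous_awayFrom ξ).measurable
  rw [lintegral_smul_measure, lintegral_smul_measure, smul_eq_mul, smul_eq_mul,
    lintegral_map hf (isProjData_horoball ξ hs).measurable_P,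
    lintegral_normalVolUp (aemeasurable_fiberMeasure_horoball _ ξ hs) hf]
  have h1 : ∫⁻ x in frontier (horoball ξ s),
      ∫⁻ v, f v ∂fiberMeasure (outerNormal (horoball ξ s)) x ∂(μHE[n - 1] : Measure (Hyp n)) =
      ∫⁻ x in {x | hor ξ x = s}, f (awayFrom ξ x) ∂(μHE[n - 1] : Measure (Hyp n)) := by
    rw [frontier_horoball]
    refine setLIntegral_congr_fun (measurableSet_eq_fun (continuous_hor_right ξ).measurable
      measurable_const) fun x hx => ?_
    rw [fiberMeasure_horoball ξ hs hx, lintegral_dirac' _ hf]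
  -- The condition N < 1 reads dep < 2s, so the slab formula with a = 2s yields 2^(n-1)/(n-1).
  have key := lintegral_lam_horosphere (m := 0) le_rfl (norm_bdry ξ)
    (by rwa [finrank_euclideanSpace_fin]) hs (a := 2 * s) (by positivity) (hfa.comp hφ)
  have hset : {z : EuclideanSpace ℝ (Fin n) | 0 < dep 0 (ξ : EuclideanSpace ℝ (Fin n)) z / (2 * s) ∧
      dep 0 (ξ : EuclideanSpace ℝ (Fin n)) z / (2 * s) < 1} =
      {z | 0 < dep 0 (ξ : EuclideanSpace ℝ (Fin n)) z ∧
        dep 0 (ξ : EuclideanSpace ℝ (Fin n)) z < 2 * s} := by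
    ext z
    have h2s : 0 < 2 * s := by positivity
    rw [mem_ofPred_eq, mem_ofPred_eq, div_pos_iff_of_pos_right h2s, div_lt_one h2s]
  rw [finrank_euclideanSpace_fin, mul_div_assoc, div_self hs.ne', mul_one] at key
  simp only [Function.comp_apply] at key
  rw [h1, euclideanHausdorffMeasure_restrict_horosphere hs, lintegral_map hfa hφ, hset, key,
    ← mul_assoc, ← ENNReal.ofReal_mul hn'.le, mul_div_cancel₀ _ hn'.ne',
    ENNReal.ofReal_pow zero_le_two, ENNReal.ofReal_ofNat]

/-- A fixes ξ, the only point at infinity, and the scaling factor on (1, ξ) is 1 because the level s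
of the boundary horosphere is preserved. -/
lemma lightVec_eq_of_smul_horoball {ξ : Bdry n} {s : ℝ} (hs : 0 < s) {A : Lorentz n}
    (hA : A • horoball ξ s = horoball ξ s) : A.1 (lightVec ξ) = lightVec ξ := by
  have h1 : bdAct A ξ = ξ := by
    have : bdAct A ξ ∈ infinityOf (A • horoball ξ s) := by
      rw [bdAct_mem_infinityOf, infinityOf_horoball ξ hs]; rfl
    rwa [hA, infinityOf_horoball ξ hs] at this
  have h2 : hor ξ (horoPt s ξ 0) = s := hor_horoPt hs ξ 0
  have h3 : hor ξ (A • horoPt s ξ 0) = s := by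
    have : A • horoPt s ξ 0 ∈ frontier (A • horoball ξ s) := by
      rw [frontier_smul_set, frontier_horoball]
      exact smul_mem_smul_set h2
    rwa [hA, frontier_horoball] at this
  have h4 := hor_smul A ξ (horoPt s ξ 0)
  rw [h1, h2, h3] at h4
  have h5 : (A.1 (lightVec ξ)).1 = 1 := mul_right_cancel₀ hs.ne' (by rw [h4, one_mul])
  have h6 := smul_lightVec_bdAct A ξ
  rw [h1, h5, one_smul] at h6
  exact h6.symm

lemma horoRetract_smul {ξ : Bdry n} {s : ℝ} (hs : 0 < s) {A : Lorentz n}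
    (hA : A.1 (lightVec ξ) = lightVec ξ) (x : Hyp n) :
    horoRetract s ξ (A • x) = A • horoRetract s ξ x := by
  have h : hor ξ (A • x) = hor ξ x := by
    rw [hor, hor, smul_pt]
    conv_lhs => rw [← hA, Lorentz.mink_map A]
  apply Hyp.ext
  rw [smul_pt, horoRetract_pt hs, horoRetract_pt hs, h, map_add, map_smul, map_smul, hA, smul_pt]

/-- The retraction onto the horosphere commutes with the stabiliser and pushes the volume of the
horoball to 1/(n-1) times that of its boundary, so total masses downstairs compare in the same way.
-/
lemma quotientVol_horoball {Γ : Subgroup (Lorentz n)} (hΓ : IsHyperbolicManifoldGroup Γ)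
    (hn : 2 ≤ n) (ξ : Bdry n) {s : ℝ} (hs : 0 < s) :
    ((n - 1 : ℕ) : ℝ≥0∞) * quotientVol Γ n (horoball ξ s) (horoball ξ s) =
      quotientVol Γ (n - 1) (horoball ξ s) (frontier (horoball ξ s)) := by
  have hn' : (0 : ℝ) < (n - 1 : ℕ) := by
    have : 0 < n - 1 := by omega
    exact_mod_cast this
  have := hΓ.countable
  obtain ⟨F, hF⟩ := hΓ.exists_isFund
  set C := horoball ξ s
  have : MeasurableConstSMul Γ (Hyp n) := ⟨fun g => measurable_const_smul g.1⟩
  have : MeasurableConstSMul (MulAction.stabilizer Γ C) (Hyp n) := ⟨fun g => measurable_const_smul g.1⟩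
  have hFs := hF.subFund (MulAction.stabilizer Γ C)
  have hinv : ∀ g : MulAction.stabilizer Γ C, ((μHE[n] : Measure (Hyp n)).restrict C).map (g • ·) =
      (μHE[n] : Measure (Hyp n)).restrict C := by
    intro g
    have he : MeasurableEmbedding fun x : Hyp n => (g.1 : Lorentz n) • x :=
      (Homeomorph.smul (g.1 : Lorentz n)).measurableEmbedding
    have h1 := he.restrict_map (μHE[n] : Measure (Hyp n)) C
    rw [map_smul_euclideanHausdorffMeasure] at h1
    have h2 : (fun x : Hyp n => (g.1 : Lorentz n) • x) ⁻¹' C = C := by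
      have h3 := stabilizer_smul g
      ext x
      refine Iff.trans ?_ (smul_mem_smul_set_iff (a := (g.1 : Lorentz n)))
      rw [h3]; rfl
    rw [h2] at h1
    exact h1.symm
  have hinv' : ∀ g : MulAction.stabilizer Γ C,
      ((μHE[n - 1] : Measure (Hyp n)).restrict (frontier C)).map (g • ·) =
        (μHE[n - 1] : Measure (Hyp n)).restrict (frontier C) := by
    intro g
    have := map_smul_restrict_frontier (n - 1) (g.1 : Lorentz n) C
    rw [stabilizer_smul] at this
    exact this
  have hmap : ((μHE[n] : Measure (Hyp n)).restrict C).map (horoRetract s ξ) =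
      ENNReal.ofReal (1 / (n - 1 : ℕ)) • (μHE[n - 1] : Measure (Hyp n)).restrict (frontier C) := by
    rw [frontier_horoball]
    exact map_horoRetract_horoball hn hs ξ
  rw [quotientVol, ← quotientMeasure_map_univ hFs hinv (measurable_horoRetract s ξ) fun g x =>
    horoRetract_smul hs (lightVec_eq_of_smul_horoball hs (stabilizer_smul g)) x, hmap,
    quotientMeasure_smul hFs hinv', Measure.smul_apply, smul_eq_mul, ← mul_assoc,
    ← ENNReal.ofReal_natCast, ← ENNReal.ofReal_mul hn'.le, mul_one_div_cancel hn'.ne',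
    ENNReal.ofReal_one, one_mul, quotientVol]

lemma IsHoroballAt.exists_eq_horoball {ξ : Bdry n} {C : Set (Hyp n)} (h : IsHoroballAt ξ C) :
    ∃ s, 0 < s ∧ C = horoball ξ s := by
  obtain ⟨c, rfl⟩ := h
  refine ⟨Real.exp c, Real.exp_pos c, ?_⟩
  ext x
  rw [mem_ofPred_eq, busemann_origin, Real.log_le_iff_le_exp (hor_pos ξ x)]
  rfl

end Horoball

/-! ### Totally geodesic subspaces through the origin. -/

section Geodesic

variable {n : ℕ} {K : Submodule ℝ (EuclideanSpace ℝ (Fin n))}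

/-- The unit normal vector `ν` of `geo K` at the point above `y`. -/
def normalVec (v₀ : T1 n) (w : K × Kᗮ) : T1 n :=
  mkT1 v₀ (sheetPt (w.1 : EuclideanSpace ℝ (Fin n)), ((0 : ℝ), (w.2 : EuclideanSpace ℝ (Fin n))))

lemma measurable_normalVec (v₀ : T1 n) : Measurable (normalVec v₀ : K × Kᗮ → T1 n) := by
  refine (measurable_mkT1 v₀).comp (Continuous.measurable ?_)
  refine (continuous_sheetPt.comp (continuous_subtype_val.comp continuous_fst)).prodMk ?_
  exact continuous_const.prodMk (continuous_subtype_val.comp continuous_snd)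

lemma normalVec_base_dir (v₀ : T1 n) (y : K) {ν : Kᗮ} (hν : ‖ν‖ = 1) :
    (normalVec v₀ (y, ν)).base = sheetPt (y : EuclideanSpace ℝ (Fin n)) ∧
      (normalVec v₀ (y, ν)).dir = ((0 : ℝ), (ν : EuclideanSpace ℝ (Fin n))) := by
  have h1 : mink (sheetPt (y : EuclideanSpace ℝ (Fin n))).pt
      ((0 : ℝ), (ν : EuclideanSpace ℝ (Fin n))) = 0 := by
    have : ⟪(y : EuclideanSpace ℝ (Fin n)), (ν : EuclideanSpace ℝ (Fin n))⟫ = 0 :=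
      Submodule.inner_right_of_mem_orthogonal y.2 ν.2
    simp only [mink, mul_zero, sub_zero]
    exact this
  have h2 : mink ((0 : ℝ), (ν : EuclideanSpace ℝ (Fin n)))
      ((0 : ℝ), (ν : EuclideanSpace ℝ (Fin n))) = 1 := by
    rw [mink_self]
    have : ‖(ν : EuclideanSpace ℝ (Fin n))‖ = 1 := hν
    simp [this]
  rw [normalVec, mkT1_of v₀ h1 h2]
  exact ⟨rfl, rfl⟩

lemma orthogonal_decomp (z : EuclideanSpace ℝ (Fin n)) :
    z = (K.orthogonalProjectionOnto z : EuclideanSpace ℝ (Fin n)) +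
      (Kᗮ.orthogonalProjectionOnto z : EuclideanSpace ℝ (Fin n)) :=
  (Submodule.starProjection_add_starProjection_orthogonal (K := K) z).symm

lemma norm_sq_decomp (z : EuclideanSpace ℝ (Fin n)) : ‖z‖ ^ 2 =
    ‖K.orthogonalProjectionOnto z‖ ^ 2 + ‖Kᗮ.orthogonalProjectionOnto z‖ ^ 2 := by
  have h : ⟪(K.orthogonalProjectionOnto z : EuclideanSpace ℝ (Fin n)),
      (Kᗮ.orthogonalProjectionOnto z : EuclideanSpace ℝ (Fin n))⟫ = 0 :=
    Submodule.inner_right_of_mem_orthogonal (K.orthogonalProjectionOnto z).2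
      (Kᗮ.orthogonalProjectionOnto z).2
  conv_lhs => rw [orthogonal_decomp (K := K) z]
  rw [norm_add_sq_real, h, Submodule.coe_norm, Submodule.coe_norm]
  ring

lemma norm_orthogonal_pos_iff (z : EuclideanSpace ℝ (Fin n)) :
    0 < ‖Kᗮ.orthogonalProjectionOnto z‖ ↔ z ∉ K := by
  rw [norm_pos_iff, not_iff_not]
  constructor
  · intro h
    rw [orthogonal_decomp (K := K) z, h, Submodule.coe_zero, add_zero]
    exact (K.orthogonalProjectionOnto z).2
  · intro h
    exact Submodule.orthogonalProjectionOnto_orthogonal_apply_eq_zero h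

lemma infinityOf_geo : infinityOf (geo K) = {ξ : Bdry n | (ξ : EuclideanSpace ℝ (Fin n)) ∈ K} := by
  ext ξ
  constructor
  · rintro ⟨v, hv, rfl⟩
    have h0 : v.base.pt.2 ∈ K := by
      have := hv 0 le_rfl
      rwa [line_zero] at this
    have h1 : Real.cosh 1 • v.base.pt.2 + Real.sinh 1 • v.dir.2 ∈ K := hv 1 zero_le_one
    have h2 : Real.sinh 1 • v.dir.2 ∈ K := (K.add_mem_iff_right (K.smul_mem _ h0)).1 h1
    have h3 : v.dir.2 ∈ K := (K.smul_mem_iff (Real.sinh_pos_iff.2 one_pos).ne').1 h2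
    exact K.smul_mem _ (K.add_mem h0 h3)
  · intro hξ
    refine ⟨toward (origin n) ξ, fun t _ => ?_, toward_endpoint _ _⟩
    change ((toward (origin n) ξ).line t).pt.2 ∈ K
    rw [toward_line_pt]
    exact K.add_mem (K.smul_mem _ K.zero_mem) (K.smul_mem _ hξ)

/-- The closest point of `geo K` to `ξ`. -/
lemma footPt_pt {ξ : Bdry n} (hξ : (ξ : EuclideanSpace ℝ (Fin n)) ∉ K) :
    (sheetPt (n := n) ((‖Kᗮ.orthogonalProjectionOnto (ξ : EuclideanSpace ℝ (Fin n))‖⁻¹ •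
      K.orthogonalProjectionOnto (ξ : EuclideanSpace ℝ (Fin n)) : K))).pt =
    ‖Kᗮ.orthogonalProjectionOnto (ξ : EuclideanSpace ℝ (Fin n))‖⁻¹ •
      ((1 : ℝ), (K.orthogonalProjectionOnto (ξ : EuclideanSpace ℝ (Fin n)) :
        EuclideanSpace ℝ (Fin n))) := by
  have hb := (norm_orthogonal_pos_iff (K := K) (ξ : EuclideanSpace ℝ (Fin n))).2 hξ
  have h1 := norm_sq_decomp (K := K) (ξ : EuclideanSpace ℝ (Fin n))
  rw [norm_bdry] at h1
  refine Prod.ext ?_ rfl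
  change √_ = _ * 1
  rw [mul_one, Real.sqrt_eq_iff_eq_sq (by positivity) (by positivity), ← Submodule.coe_norm,
    norm_smul, norm_inv, norm_norm]
  field_simp
  linarith

/-- Points over K only see the component (1, a) of (1, ξ), which is ‖b‖ times the foot point; the
height is therefore ‖b‖ times the hyperbolic cosine of the distance to the foot. -/
lemma hor_eq_of_mem_geo {ξ : Bdry n} (hξ : (ξ : EuclideanSpace ℝ (Fin n)) ∉ K) {x : Hyp n}
    (hx : x ∈ geo K) : hor ξ x = ‖Kᗮ.orthogonalProjectionOnto (ξ : EuclideanSpace ℝ (Fin n))‖ *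
      -mink x.pt (sheetPt (n := n) ((‖Kᗮ.orthogonalProjectionOnto (ξ : EuclideanSpace ℝ (Fin n))‖⁻¹ •
      K.orthogonalProjectionOnto (ξ : EuclideanSpace ℝ (Fin n)) : K))).pt := by
  have hb := (norm_orthogonal_pos_iff (K := K) (ξ : EuclideanSpace ℝ (Fin n))).2 hξ
  rw [footPt_pt hξ, mink_smul_right, mul_neg, mul_inv_cancel_left₀ hb.ne', hor]
  have h : ⟪x.pt.2, (Kᗮ.orthogonalProjectionOnto (ξ : EuclideanSpace ℝ (Fin n)) :
      EuclideanSpace ℝ (Fin n))⟫ = 0 :=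
    Submodule.inner_right_of_mem_orthogonal hx (Kᗮ.orthogonalProjectionOnto _).2
  simp only [mink, lightVec]
  conv_lhs => rw [orthogonal_decomp (K := K) (ξ : EuclideanSpace ℝ (Fin n)), inner_add_right, h]
  rw [add_zero]

lemma isClosest_footPt {ξ : Bdry n} (hξ : (ξ : EuclideanSpace ℝ (Fin n)) ∉ K) :
    IsClosest (geo K) ξ (sheetPt (n := n)
      ((‖Kᗮ.orthogonalProjectionOnto (ξ : EuclideanSpace ℝ (Fin n))‖⁻¹ •
      K.orthogonalProjectionOnto (ξ : EuclideanSpace ℝ (Fin n)) : K))) := by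
  have hb := (norm_orthogonal_pos_iff (K := K) (ξ : EuclideanSpace ℝ (Fin n))).2 hξ
  set y := ‖Kᗮ.orthogonalProjectionOnto (ξ : EuclideanSpace ℝ (Fin n))‖⁻¹ •
      K.orthogonalProjectionOnto (ξ : EuclideanSpace ℝ (Fin n)) with hy
  have hmem : sheetPt (y : EuclideanSpace ℝ (Fin n)) ∈ geo K := y.2
  refine ⟨hmem, fun x hx hne => ?_⟩
  rw [hor_eq_of_mem_geo hξ hx, hor_eq_of_mem_geo hξ hmem, ← hy, (sheetPt _).mink_pt, neg_neg]
  refine mul_lt_mul_of_pos_left (lt_of_le_of_ne (one_le_neg_mink _ _) fun h => hne ?_) hb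
  rw [← dist_eq_zero, dist_def, ← h, Real.arcosh_zero]

lemma hor_footPt {ξ : Bdry n} (hξ : (ξ : EuclideanSpace ℝ (Fin n)) ∉ K) :
    hor ξ (sheetPt (n := n) ((‖Kᗮ.orthogonalProjectionOnto (ξ : EuclideanSpace ℝ (Fin n))‖⁻¹ •
      K.orthogonalProjectionOnto (ξ : EuclideanSpace ℝ (Fin n)) : K))) =
      ‖Kᗮ.orthogonalProjectionOnto (ξ : EuclideanSpace ℝ (Fin n))‖ := by
  rw [hor_eq_of_mem_geo hξ (isClosest_footPt hξ).1, (sheetPt _).mink_pt, neg_neg, mul_one]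

lemma hasClosest_geo : HasClosest (geo K) := by
  intro ξ hξ
  rw [infinityOf_geo] at hξ
  exact ⟨_, isClosest_footPt hξ⟩

lemma norm_inv_norm_smul {z : Kᗮ} (hz : 0 < ‖z‖) : ‖‖z‖⁻¹ • z‖ = 1 := by
  rw [norm_smul, norm_inv, norm_norm, inv_mul_cancel₀ hz.ne']

lemma projPlus_geo (v₀ : T1 n) {ξ : Bdry n} (hξ : (ξ : EuclideanSpace ℝ (Fin n)) ∉ K) :
    projPlus (geo K) ξ = normalVec v₀
      (‖Kᗮ.orthogonalProjectionOnto (ξ : EuclideanSpace ℝ (Fin n))‖⁻¹ •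
        K.orthogonalProjectionOnto (ξ : EuclideanSpace ℝ (Fin n)),
      ‖Kᗮ.orthogonalProjectionOnto (ξ : EuclideanSpace ℝ (Fin n))‖⁻¹ •
        Kᗮ.orthogonalProjectionOnto (ξ : EuclideanSpace ℝ (Fin n))) := by
  have hb := (norm_orthogonal_pos_iff (K := K) (ξ : EuclideanSpace ℝ (Fin n))).2 hξ
  obtain ⟨h1, h2⟩ := normalVec_base_dir v₀ (‖Kᗮ.orthogonalProjectionOnto
    (ξ : EuclideanSpace ℝ (Fin n))‖⁻¹ • K.orthogonalProjectionOnto (ξ : EuclideanSpace ℝ (Fin n)))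
    (norm_inv_norm_smul hb)
  rw [projPlus, (isClosest_footPt hξ).proj_eq]
  refine T1.ext h1.symm ?_
  rw [h2]
  change (hor ξ _)⁻¹ • lightVec ξ + (-1 : ℝ) • (sheetPt _).pt = _
  rw [hor_footPt hξ, footPt_pt hξ]
  refine Prod.ext ?_ ?_
  · simp [lightVec]
  · simp only [Prod.snd_add, Prod.smul_snd, lightVec, Submodule.coe_smul]
    conv_lhs =>
      enter [1, 2]
      rw [orthogonal_decomp (K := K) (ξ : EuclideanSpace ℝ (Fin n))]
    module

/-- For z in K the inverse norm is 0 and the value of P is the irrelevant default v₀; such z have N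
= 0. -/
lemma isProjData_geo (v₀ : T1 n) : IsProjData (geo K)
    (fun z => normalVec v₀ (‖Kᗮ.orthogonalProjectionOnto z‖⁻¹ • K.orthogonalProjectionOnto z,
      ‖Kᗮ.orthogonalProjectionOnto z‖⁻¹ • Kᗮ.orthogonalProjectionOnto z))
    (fun z => ‖Kᗮ.orthogonalProjectionOnto z‖) where
  measurable_P := by
    refine (measurable_normalVec v₀).comp ?_
    have h1 : Measurable fun z : EuclideanSpace ℝ (Fin n) => K.orthogonalProjectionOnto z :=
      (ContinuousLinearMap.continuous _).measurable
    have h2 : Measurable fun z : EuclideanSpace ℝ (Fin n) => Kᗮ.orthogonalProjectionOnto z :=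
      (ContinuousLinearMap.continuous _).measurable
    exact (h2.norm.inv.smul h1).prodMk (h2.norm.inv.smul h2)
  measurable_N := (ContinuousLinearMap.continuous _).norm.measurable
  P_smul r hr z := by
    have : ‖r • Kᗮ.orthogonalProjectionOnto z‖⁻¹ * r = ‖Kᗮ.orthogonalProjectionOnto z‖⁻¹ := by
      rw [norm_smul, Real.norm_of_nonneg hr.le, mul_inv, mul_right_comm, inv_mul_cancel₀ hr.ne',
        one_mul]
    rw [map_smul, map_smul, smul_smul, smul_smul, this]
  N_smul r hr z := by rw [map_smul, norm_smul, Real.norm_of_nonneg hr.le]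
  notMem_iff ξ := by
    rw [infinityOf_geo]
    exact (norm_orthogonal_pos_iff _).symm
  projPlus_eq ξ hξ := by
    rw [infinityOf_geo] at hξ
    exact projPlus_geo v₀ hξ
  N_eq ξ hξ := by
    rw [infinityOf_geo] at hξ
    rw [(isClosest_footPt hξ).proj_eq, hor_footPt hξ]

/-- A nonzero normal direction leads out of the subspace immediately, so its interior is empty. -/
lemma frontier_geo [Nontrivial Kᗮ] : frontier (geo K) = geo K := by
  rw [(isClosed_geo K).frontier_eq]
  refine sdiff_eq_left.2 (disjoint_left.2 fun x hx hint => ?_)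
  obtain ⟨ν, hν⟩ := exists_ne (0 : Kᗮ)
  have hc : Continuous fun t : ℝ => sheetPt (x.pt.2 + t • (ν : EuclideanSpace ℝ (Fin n))) :=
    continuous_sheetPt.comp (by fun_prop)
  have hlim : Tendsto (fun t : ℝ => sheetPt (x.pt.2 + t • (ν : EuclideanSpace ℝ (Fin n))))
      (𝓝[≠] 0) (𝓝 x) := by
    have := hc.tendsto 0
    rw [zero_smul, add_zero, sheetPt_snd] at this
    exact this.mono_left nhdsWithin_le_nhds
  obtain ⟨t, ht1, ht2⟩ := ((hlim.eventually (mem_interior_iff_mem_nhds.1 hint)).and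
    self_mem_nhdsWithin).exists
  have h1 : x.pt.2 + t • (ν : EuclideanSpace ℝ (Fin n)) ∈ K := ht1
  have h2 : (ν : EuclideanSpace ℝ (Fin n)) ∈ K :=
    (K.smul_mem_iff ht2).1 ((K.add_mem_iff_right hx).1 h1)
  have h3 : ⟪(ν : EuclideanSpace ℝ (Fin n)), (ν : EuclideanSpace ℝ (Fin n))⟫ = 0 :=
    Submodule.inner_right_of_mem_orthogonal h2 ν.2
  exact hν (Subtype.ext (inner_self_eq_zero.1 h3))

lemma mem_outerNormal_geo [Nontrivial Kᗮ] {v : T1 n} (hv : v.base ∈ geo K) :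
    v ∈ outerNormal (geo K) ↔ v.dir.1 = 0 ∧ v.dir.2 ∈ Kᗮ := by
  constructor
  · rintro ⟨-, h2, h3⟩
    rw [infinityOf_geo] at h2
    have hb := (norm_orthogonal_pos_iff (K := K) (v.endpoint : EuclideanSpace ℝ (Fin n))).2 h2
    have h4 := projPlus_geo v h2
    rw [projPlus, h3, toward_base_endpoint] at h4
    have h5 := (normalVec_base_dir v (‖Kᗮ.orthogonalProjectionOnto
      (v.endpoint : EuclideanSpace ℝ (Fin n))‖⁻¹ •
      K.orthogonalProjectionOnto (v.endpoint : EuclideanSpace ℝ (Fin n))) (norm_inv_norm_smul hb)).2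
    rw [← h4] at h5
    rw [h5]
    exact ⟨rfl, (‖Kᗮ.orthogonalProjectionOnto (v.endpoint : EuclideanSpace ℝ (Fin n))‖⁻¹ •
      Kᗮ.orthogonalProjectionOnto (v.endpoint : EuclideanSpace ℝ (Fin n))).2⟩
  · rintro ⟨h1, h2⟩
    have hx := v.base.pos
    have hnu : ‖v.dir.2‖ = 1 := by
      have := v.unit
      rw [mink_self, h1] at this
      rw [← sq_eq_sq₀ (norm_nonneg _) zero_le_one]
      linarith
    have hξ : (v.endpoint : EuclideanSpace ℝ (Fin n)) =
        v.base.pt.1⁻¹ • (v.base.pt.2 + v.dir.2) := by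
      change (v.base.pt.1 + v.dir.1)⁻¹ • _ = _
      rw [h1, add_zero]
    have hKb : K.orthogonalProjectionOnto v.base.pt.2 = ⟨v.base.pt.2, hv⟩ :=
      Submodule.orthogonalProjectionOnto_mem_subspace_eq_self (⟨v.base.pt.2, hv⟩ : K)
    have hKd : K.orthogonalProjectionOnto v.dir.2 = 0 :=
      Submodule.orthogonalProjectionOnto_eq_zero_iff.2 h2
    have hKb' : Kᗮ.orthogonalProjectionOnto v.base.pt.2 = 0 :=
      Submodule.orthogonalProjectionOnto_orthogonal_apply_eq_zero hv
    have hKd' : Kᗮ.orthogonalProjectionOnto v.dir.2 = ⟨v.dir.2, h2⟩ :=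
      Submodule.orthogonalProjectionOnto_mem_subspace_eq_self (⟨v.dir.2, h2⟩ : Kᗮ)
    have ha : K.orthogonalProjectionOnto (v.endpoint : EuclideanSpace ℝ (Fin n)) =
        v.base.pt.1⁻¹ • ⟨v.base.pt.2, hv⟩ := by
      rw [hξ, map_smul, map_add, hKb, hKd, add_zero]
    have hb : ‖Kᗮ.orthogonalProjectionOnto (v.endpoint : EuclideanSpace ℝ (Fin n))‖ =
        v.base.pt.1⁻¹ := by
      rw [hξ, map_smul, map_add, hKb', hKd', zero_add, norm_smul, Real.norm_of_nonneg
        (inv_nonneg.2 hx.le), Submodule.coe_norm]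
      change _ * ‖v.dir.2‖ = _
      rw [hnu, mul_one]
    have hnot : (v.endpoint : EuclideanSpace ℝ (Fin n)) ∉ K := by
      rw [← norm_orthogonal_pos_iff, hb]; positivity
    -- The endpoint of a normal vector has orthogonal part of norm 1/x₀, with x₀ the height of the
    -- base point, and rescaling its K-part by x₀ recovers the base point.
    refine ⟨by rwa [frontier_geo], by rw [infinityOf_geo]; exact hnot, ?_⟩
    rw [(isClosest_footPt hnot).proj_eq, hb, ha, smul_smul, inv_mul_cancel₀ (inv_ne_zero hx.ne'),
      one_smul]
    exact sheetPt_snd _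

/-- The inclusion of the normal space of `geo K` in the tangent space. -/
def normalIncl {x : Hyp n} (hx : x ∈ geo K) : Kᗮ →ₗᵢ[ℝ] Tangent x where
  toFun ν := ⟨((0 : ℝ), (ν : EuclideanSpace ℝ (Fin n))), by
    have : ⟪x.pt.2, (ν : EuclideanSpace ℝ (Fin n))⟫ = 0 :=
      Submodule.inner_right_of_mem_orthogonal hx ν.2
    change mink _ _ = 0
    simp [mink, this]⟩
  map_add' a b := Subtype.ext (Prod.ext (add_zero (0 : ℝ)).symm rfl)
  map_smul' c a := Subtype.ext (Prod.ext (mul_zero c).symm rfl)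
  norm_map' a := by
    rw [← sq_eq_sq₀ (norm_nonneg _) (norm_nonneg _), ← real_inner_self_eq_norm_sq]
    change mink ((0 : ℝ), (a : EuclideanSpace ℝ (Fin n))) ((0 : ℝ), (a : EuclideanSpace ℝ (Fin n))) = _
    rw [mink_self]
    simp

lemma fiberSpan_geo [Nontrivial Kᗮ] {x : Hyp n} (hx : x ∈ geo K) :
    fiberSpan (outerNormal (geo K)) x = LinearMap.range (normalIncl hx).toLinearMap := by
  apply le_antisymm
  · refine Submodule.span_le.2 ?_
    rintro u ⟨v, hv, rfl, hd⟩
    obtain ⟨h1, h2⟩ := (mem_outerNormal_geo hx).1 hv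
    refine ⟨⟨v.dir.2, h2⟩, Subtype.ext ?_⟩
    change ((0 : ℝ), v.dir.2) = u.vec
    rw [← hd, ← h1]
  · rintro _ ⟨ν, rfl⟩
    by_cases h0 : ν = 0
    · rw [h0, map_zero]; exact Submodule.zero_mem _
    have hpos := norm_pos_iff.2 h0
    have hsm : ν = ‖ν‖ • (‖ν‖⁻¹ • ν) := by rw [smul_smul, mul_inv_cancel₀ hpos.ne', one_smul]
    rw [hsm, map_smul]
    refine Submodule.smul_mem _ _ (Submodule.subset_span ?_)
    set ν' := ‖ν‖⁻¹ • ν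
    have hn' : ‖ν'‖ = 1 := norm_inv_norm_smul hpos
    refine ⟨⟨x, (normalIncl hx ν').vec, (normalIncl hx ν').2, ?_⟩, ?_, rfl, rfl⟩
    · rw [← Tangent.inner_def, real_inner_self_eq_norm_sq, LinearIsometry.norm_map, hn', one_pow]
    · exact (mem_outerNormal_geo hx).2 ⟨rfl, ν'.2⟩

/-- The unit normal vector `ν` of `geo K` at the point above the projection of `x`. -/
def normalAt (v₀ : T1 n) (x : Hyp n) (ν : Metric.sphere (0 : Kᗮ) 1) : T1 n :=
  normalVec v₀ (K.orthogonalProjectionOnto x.pt.2, (ν : Kᗮ))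

lemma measurable_normalAt_uncurry (v₀ : T1 n) :
    Measurable fun q : Hyp n × Metric.sphere (0 : Kᗮ) 1 => normalAt v₀ q.1 q.2 := by
  have h1 : Measurable fun x : Hyp n => K.orthogonalProjectionOnto x.pt.2 :=
    ((ContinuousLinearMap.continuous _).comp continuous_snd_pt).measurable
  exact (measurable_normalVec v₀).comp ((h1.comp measurable_fst).prodMk
    (measurable_subtype_coe.comp measurable_snd))

lemma measurable_normalAt (v₀ : T1 n) (x : Hyp n) :
    Measurable (normalAt v₀ x : Metric.sphere (0 : Kᗮ) 1 → T1 n) :=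
  (measurable_normalVec v₀).comp (measurable_const.prodMk measurable_subtype_coe)

lemma fiberMeasure_geo [Nontrivial Kᗮ] (v₀ : T1 n) {x : Hyp n} (hx : x ∈ geo K) :
    fiberMeasure (outerNormal (geo K)) x = (volume : Measure Kᗮ).toSphere.map (normalAt v₀ x) := by
  have hg := measurable_normalAt (K := K) v₀ x
  have hbd : ∀ ν : Metric.sphere (0 : Kᗮ) 1,
      (normalAt v₀ x ν).base = x ∧ (normalAt v₀ x ν).dir =
        ((0 : ℝ), ((ν : Kᗮ) : EuclideanSpace ℝ (Fin n))) := by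
    intro ν
    obtain ⟨h1, h2⟩ := normalVec_base_dir v₀ (K.orthogonalProjectionOnto x.pt.2)
      (mem_sphere_zero_iff_norm.1 ν.2)
    refine ⟨?_, h2⟩
    have : K.orthogonalProjectionOnto x.pt.2 = ⟨x.pt.2, hx⟩ :=
      Submodule.orthogonalProjectionOnto_mem_subspace_eq_self (⟨x.pt.2, hx⟩ : K)
    rw [normalAt, h1, this]
    exact sheetPt_snd x
  have hsph : sphereMeasure (LinearMap.range (normalIncl hx).toLinearMap) =
      (volume : Measure Kᗮ).toSphere.map (normalAt v₀ x) := by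
    have e := map_sphereMap_toSphere (normalIncl hx).equivRange
    unfold sphereMeasure
    rw [← e, Measure.map_map (measurable_unitOf _) (continuous_sphereMap _).measurable]
    congr 1
    funext ν
    exact T1.ext (hbd ν).1.symm (hbd ν).2.symm
  rw [fiberMeasure_eq, fiberSpan_geo hx, hsph]
  -- Every unit vector of the normal space is an outer normal, so restricting to the normal bundle
  -- changes nothing.
  refine Measure.restrict_eq_self_of_ae_mem ?_
  have hmeas : MeasurableSet {v : T1 n | v.base = x ∧ v.dir.1 = 0 ∧ v.dir.2 ∈ Kᗮ} := by
    have h1 : Measurable fun v : T1 n => v.dir := continuous_dir.measurable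
    refine (measurableSet_eq_fun continuous_base.measurable measurable_const).inter
      ((measurableSet_eq_fun h1.fst measurable_const).inter ?_)
    exact h1.snd Kᗮ.closed_of_finiteDimensional.measurableSet
  have hae : ∀ᵐ v ∂((volume : Measure Kᗮ).toSphere.map (normalAt v₀ x)),
      v ∈ {v : T1 n | v.base = x ∧ v.dir.1 = 0 ∧ v.dir.2 ∈ Kᗮ} := by
    refine (ae_map_iff hg.aemeasurable hmeas).2 (Eventually.of_forall fun ν => ?_)
    refine ⟨(hbd ν).1, ?_, ?_⟩
    · rw [(hbd ν).2]
    · rw [(hbd ν).2]; exact (ν : Kᗮ).2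
  filter_upwards [hae] with v hv
  obtain ⟨rfl, h⟩ := hv
  exact (mem_outerNormal_geo hx).2 h

lemma aemeasurable_fiberMeasure_geo [Nontrivial Kᗮ] (v₀ : T1 n) (d : ℕ) :
    AEMeasurable (fiberMeasure (outerNormal (geo K)))
      ((μHE[d] : Measure (Hyp n)).restrict (frontier (geo K))) := by
  refine ⟨fun x => (volume : Measure Kᗮ).toSphere.map (normalAt v₀ x), ?_, ?_⟩
  · refine Measure.measurable_of_measurable_coe _ fun s hs => ?_
    have h : ∀ x : Hyp n, (volume : Measure Kᗮ).toSphere.map (normalAt v₀ x) s =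
        (volume : Measure Kᗮ).toSphere (Prod.mk x ⁻¹' ((fun q : Hyp n × Metric.sphere (0 : Kᗮ) 1 =>
          normalAt v₀ q.1 q.2) ⁻¹' s)) := fun x =>
      Measure.map_apply (measurable_normalAt v₀ x) hs
    simp_rw [h]
    exact measurable_measure_prodMk_left (measurable_normalAt_uncurry v₀ hs)
  · filter_upwards [ae_restrict_mem isClosed_frontier.measurableSet] with x hx
    rw [frontier_geo] at hx
    exact fiberMeasure_geo v₀ hx

lemma fiberMeasure_geo_univ [Nontrivial Kᗮ] (v₀ : T1 n) {x : Hyp n} (hx : x ∈ geo K) {m : ℕ}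
    (hm : Module.finrank ℝ Kᗮ = m + 1) : fiberMeasure (outerNormal (geo K)) x univ = sphereVol m := by
  have hg := measurable_normalAt (K := K) v₀ x
  rw [fiberMeasure_geo v₀ hx, Measure.map_apply hg MeasurableSet.univ, preimage_univ, sphereVol]
  exact toSphere_univ_eq ((stdOrthonormalBasis ℝ Kᗮ).reindex (finCongr hm)).repr

lemma skinningUp_geo [Nontrivial Kᗮ] (hn : 2 ≤ n) (v₀ : T1 n) (x₀ : Hyp n) :
    skinningUp ((n : ℝ) - 1) sphericalDensity x₀ (geo K) =
      normalVolUp (Module.finrank ℝ K) (geo K) := by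
  have hn' : (0 : ℝ) < (n - 1 : ℕ) := by
    have : 0 < n - 1 := by omega
    exact_mod_cast this
  rw [(isProjData_geo v₀).skinningUp_eq hn x₀]
  refine Measure.ext_of_lintegral _ fun f hf => ?_
  have hfn : Measurable fun w : K × Kᗮ => f (normalVec v₀ w) := hf.comp (measurable_normalVec v₀)
  have key := lintegral_lam_tube K (by rwa [finrank_euclideanSpace_fin]) hfn
  rw [finrank_euclideanSpace_fin] at key
  rw [lintegral_smul_measure, smul_eq_mul, lintegral_map hf (isProjData_geo v₀).measurable_P, key,
    ← mul_assoc, ← ENNReal.ofReal_mul hn'.le, mul_inv_cancel₀ hn'.ne', ENNReal.ofReal_one, one_mul,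
    lintegral_normalVolUp (aemeasurable_fiberMeasure_geo v₀ _) hf, frontier_geo]
  have h1 : ∫⁻ x in geo K, ∫⁻ v, f v ∂fiberMeasure (outerNormal (geo K)) x
        ∂(μHE[Module.finrank ℝ K] : Measure (Hyp n)) =
      ∫⁻ x in geo K, ∫⁻ ν, f (normalAt v₀ x ν)
        ∂(volume : Measure Kᗮ).toSphere ∂(μHE[Module.finrank ℝ K] : Measure (Hyp n)) := by
    refine setLIntegral_congr_fun (isClosed_geo K).measurableSet fun x hx => ?_
    have hg := measurable_normalAt (K := K) v₀ x
    rw [fiberMeasure_geo v₀ hx, lintegral_map hf hg]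
  have h2 : Measurable fun x : Hyp n =>
      ∫⁻ ν, f (normalAt v₀ x ν)
        ∂(volume : Measure Kᗮ).toSphere :=
    (hf.comp (measurable_normalAt_uncurry v₀)).lintegral_prod_right'
  rw [h1, euclideanHausdorffMeasure_restrict_geo, lintegral_map h2 (measurable_sheetPt_coe K)]
  have h3 : ∀ y : K, K.orthogonalProjectionOnto (sheetPt (y : EuclideanSpace ℝ (Fin n))).pt.2 = y :=
    fun y => Submodule.orthogonalProjectionOnto_mem_subspace_eq_self y
  simp only [normalAt, h3]
  have : SFinite (lam 1 : Measure K) := by unfold lam; infer_instance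
  -- The tube formula integrates over normals last, the normal bundle measure over base points last.
  refine lintegral_lintegral_swap ?_
  exact (hfn.comp (measurable_snd.prodMk (measurable_subtype_coe.comp measurable_fst))).aemeasurable

end Geodesic

/-! ### Moving a totally geodesic subspace to the origin. -/

section Transport

variable {n : ℕ}

/-- Totally geodesic subspaces are the images of the subspaces through the origin. -/
lemma IsTotallyGeodesic.exists_eq {k : ℕ} {C : Set (Hyp n)} (h : IsTotallyGeodesic k C) :
    ∃ (p : Hyp n) (K : Submodule ℝ (EuclideanSpace ℝ (Fin n))), Module.finrank ℝ K = k ∧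
      C = symLor p • geo K := by
  obtain ⟨⟨p, hp⟩, V, hV, rfl⟩ := h
  set W : Submodule ℝ (Mink n) := V.comap (symLor p).1.toLinearMap with hW
  have hWf : Module.finrank ℝ W = k + 1 := by
    rw [← hV, hW, ← LinearEquiv.finrank_map_eq (symLor p).1 (V.comap (symLor p).1.toLinearMap)]
    rw [Submodule.map_comap_eq_of_surjective (symLor p).1.surjective V]
  have hoW : ((1 : ℝ), (0 : EuclideanSpace ℝ (Fin n))) ∈ W := by
    change (symLor p • origin n).pt ∈ V
    rw [symLor_origin]; exact hp
  set K : Submodule ℝ (EuclideanSpace ℝ (Fin n)) := W.comap (LinearMap.inr ℝ ℝ _) with hK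
  -- After the symmetry the linear subspace contains (1, 0), hence splits as the time axis plus K,
  -- and dim K = k.
  have hiff : ∀ z : Mink n, z ∈ W ↔ z.2 ∈ K := by
    intro z
    have hz : z = z.1 • ((1 : ℝ), (0 : EuclideanSpace ℝ (Fin n))) + ((0 : ℝ), z.2) := by
      refine Prod.ext ?_ ?_ <;> simp
    conv_lhs => rw [hz]
    exact W.add_mem_iff_right (W.smul_mem _ hoW)
  refine ⟨p, K, ?_, ?_⟩
  · set f : ℝ × K →ₗ[ℝ] Mink n := LinearMap.prodMap LinearMap.id K.subtype
    have hf : Function.Injective f := by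
      intro a b hab
      have h1 : a.1 = b.1 := congrArg (fun z : Mink n => z.1) hab
      have h2 : (a.2 : EuclideanSpace ℝ (Fin n)) = b.2 := congrArg (fun z : Mink n => z.2) hab
      exact Prod.ext h1 (Subtype.ext h2)
    have hr : LinearMap.range f = W := by
      ext z
      rw [hiff]
      constructor
      · rintro ⟨a, rfl⟩; exact a.2.2
      · intro hz; exact ⟨(z.1, ⟨z.2, hz⟩), rfl⟩
    have e := LinearMap.finrank_range_of_inj hf
    rw [hr, hWf, Module.finrank_prod, Module.finrank_self] at e
    omega
  · ext x
    rw [mem_smul_set_iff_inv_smul_mem, symLor_inv]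
    change x.pt ∈ V ↔ (symLor p • x).pt.2 ∈ K
    rw [← hiff]
    change _ ↔ (symLor p • symLor p • x).pt ∈ V
    rw [symLor_smul_smul]

end Transport

/-! ### The two cases on the quotient, and the conclusion. -/

section Main

variable {n : ℕ} {Γ : Subgroup (Lorentz n)}

lemma skinning_horoball (hΓ : IsHyperbolicManifoldGroup Γ) (hn : 2 ≤ n) (ξ : Bdry n) {s : ℝ}
    (hs : 0 < s) (x₀ : Hyp n) :
    skinning Γ ((n : ℝ) - 1) sphericalDensity x₀ (horoball ξ s) =
      (2 : ℝ≥0∞) ^ (n - 1) • normalVol Γ (n - 1) (horoball ξ s) :=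
  skinning_eq_smul_normalVol hΓ (hasClosest_horoball ξ hs)
    (aemeasurable_fiberMeasure_horoball _ ξ hs) (skinningUp_horoball hn ξ hs x₀)

lemma normalVol_horoball_univ (hΓ : IsHyperbolicManifoldGroup Γ) (ξ : Bdry n) {s : ℝ}
    (hs : 0 < s) (d : ℕ) : normalVol Γ d (horoball ξ s) univ =
      quotientVol Γ d (horoball ξ s) (frontier (horoball ξ s)) := by
  rw [normalVol_univ hΓ (hasClosest_horoball ξ hs) (aemeasurable_fiberMeasure_horoball _ ξ hs)
    (K := 1), one_mul]
  intro x hx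
  rw [frontier_horoball] at hx
  rw [fiberMeasure_horoball ξ hs hx, measure_univ]

lemma skinning_totallyGeodesic (hΓ : IsHyperbolicManifoldGroup Γ) (hn : 2 ≤ n) {k : ℕ}
    (hk : k ≤ n - 1) {C : Set (Hyp n)} (hC : IsTotallyGeodesic k C) (x₀ : Hyp n) :
    skinning Γ ((n : ℝ) - 1) sphericalDensity x₀ C = normalVol Γ k C ∧
      normalVol Γ k C univ = sphereVol (n - k - 1) * quotientVol Γ k C C := by
  obtain ⟨p, K, hK, rfl⟩ := hC.exists_eq
  have hperp : Module.finrank ℝ Kᗮ = n - k - 1 + 1 := by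
    have := Submodule.finrank_add_finrank_orthogonal K
    rw [hK, finrank_euclideanSpace_fin] at this
    omega
  have : Nontrivial Kᗮ := Module.nontrivial_of_finrank_pos (R := ℝ) (by omega)
  obtain ⟨ν, hν⟩ := exists_ne (0 : Kᗮ)
  have hνpos := norm_pos_iff.2 hν
  -- A unit normal vector at the origin, serving only as the default value required by `mkT1`.
  let v₀ : T1 n := ⟨origin n, ((0 : ℝ), ((‖ν‖⁻¹ • ν : Kᗮ) : EuclideanSpace ℝ (Fin n))),
    by simp [mink, origin], by
      rw [mink_self, ← Submodule.coe_norm, norm_inv_norm_smul hνpos]; norm_num⟩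
  have hκ := aemeasurable_fiberMeasure_geo (K := K) v₀ k
  have hcl : HasClosest (geo K) := hasClosest_geo
  have hκ' := hcl.aemeasurable_fiberMeasure_smul hκ (symLor p)
  have hup : skinningUp ((n : ℝ) - 1) sphericalDensity x₀ (symLor p • geo K) =
      (1 : ℝ≥0∞) • normalVolUp k (symLor p • geo K) := by
    have h1 := skinningUp_geo (K := K) hn v₀ x₀
    rw [hK] at h1
    -- Both measures are natural under the symmetry, so the equality at the origin transports to any
    -- totally geodesic subspace.
    rw [one_smul, hcl.normalVolUp_smul hκ, (isProjData_geo v₀).skinningUp_symLor hcl hn p x₀, h1]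
  have hfr : frontier (symLor p • geo K) = symLor p • geo K := by
    rw [frontier_smul_set, frontier_geo]
  constructor
  · rw [skinning_eq_smul_normalVol hΓ (hcl.smul _) hκ' hup, one_smul]
  · rw [normalVol_univ hΓ (hcl.smul _) hκ' (K := sphereVol (n - k - 1)), hfr]
    rw [hfr]
    rintro _ ⟨x, hx, rfl⟩
    have hm := measurable_const_smul (α := T1 n) (symLor p)
    change fiberMeasure _ (symLor p • x) univ = _
    rw [hcl.outerNormal_smul, fiberMeasure_smul, Measure.map_apply hm MeasurableSet.univ,
      preimage_univ, fiberMeasure_geo_univ v₀ hx hperp]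

end Main

end HypSkin

end

theorem mainTheorem3 (n : ℕ) (hn : 2 ≤ n) (Γ : Subgroup (Lorentz n))
    (hΓ : IsHyperbolicManifoldGroup Γ) (hvol : manifoldVol Γ < ⊤) (x₀ : Hyp n) :
    (∀ C : Set (Hyp n), IsMargulisCusp Γ C →
      skinning Γ ((n : ℝ) - 1) sphericalDensity x₀ C =
          (2 : ENNReal) ^ (n - 1) • normalVol Γ (n - 1) C ∧
        skinning Γ ((n : ℝ) - 1) sphericalDensity x₀ C Set.univ =
          2 ^ (n - 1) * normalVol Γ (n - 1) C Set.univ ∧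
        normalVol Γ (n - 1) C Set.univ = quotientVol Γ (n - 1) C (frontier C) ∧
        skinning Γ ((n : ℝ) - 1) sphericalDensity x₀ C Set.univ =
          2 ^ (n - 1) * ((n - 1 : ℕ) : ENNReal) * quotientVol Γ n C C) ∧
    (∀ (k : ℕ) (C : Set (Hyp n)), 1 ≤ k → k ≤ n - 1 → IsTotallyGeodesic k C →
      LocallyFiniteOrbit Γ C → quotientVol Γ k C C < ⊤ →
      skinning Γ ((n : ℝ) - 1) sphericalDensity x₀ C = normalVol Γ k C ∧
        skinning Γ ((n : ℝ) - 1) sphericalDensity x₀ C Set.univ =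
          sphereVol (n - k - 1) * quotientVol Γ k C C) := by
  refine ⟨?_, ?_⟩
  · rintro C ⟨⟨ξ, hξ, -⟩, -⟩
    obtain ⟨s, hs, rfl⟩ := hξ.exists_eq_horoball
    have h1 := skinning_horoball hΓ hn ξ hs x₀
    have h2 := normalVol_horoball_univ hΓ ξ hs (n - 1)
    refine ⟨h1, by rw [h1]; rfl, h2, ?_⟩
    rw [h1, Measure.smul_apply, smul_eq_mul, h2, mul_assoc, quotientVol_horoball hΓ hn ξ hs]
  · intro k C _ hk hC _ _
    obtain ⟨h1, h2⟩ := skinning_totallyGeodesic hΓ hn hk hC x₀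
    exact ⟨h1, by rw [h1, h2]⟩
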